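/- **Conventions.** A *tree* is a strict partial order $(T,<_T)$ in which the predecessors of each element are well-ordered; $\mathrm{ht}_T(x)$ is their order type, $T_\alpha$ is the set of elements of height $\alpha$, $T\restriction\beta=\bigcup_{\alpha<\beta}T_\alpha$, $\mathrm{Imm}_T(x)$ is the set of immediate successors of $x$, and for $\beta<\mathrm{ht}_T(x)$, $x\restriction\beta$ is the element of $T_\beta$ below $x$ (for tuples, and for sets of tuples, restriction is taken componentwise, respectively elementwise). An *$\omega_1$-tree* has height $\omega_1$ and countable levels; it is *Aronszajn* if it has no cofinal branch. It is *normal* if it has a root, distinct elements of the same limit height have different sets of predecessors, every element has two incomparable elements above it, and every element has uncountably many elements above it. Let $T$ be a normal Aronszajn tree and let $\mathcal S\subseteq\omega\setminus 2$ be non-empty, with $|\mathrm{Imm}_T(x)|\ge\sup(\mathcal S)$ for all $x\in T$. **Generalized promises.** For $0<m<\omega$ and $\gamma<\omega_1$, a *generalized promise on $T$ with dimension $m$ and base level $\gamma$* is a function $\mathcal U$ with domain $[\gamma,\omega_1)$ for which there are distinct $x_0,\dots,x_{m-1}\in T$ of the same height such that for all $\gamma\le\beta<\omega_1$: (1) $\mathcal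 U(\beta)$ is a non-empty countable set, and each $\mathcal Y\in\mathcal U(\beta)$ is a countably infinite set of tuples $(a_0,\dots,a_{m-1})\in T_\beta^m$ with $x_i\le_T a_i$ for all $i<m$; (2) for every $\mathcal Y\in\mathcal U(\beta)$ and every finite $t\subseteq T_\beta$ some tuple in $\mathcal Y$ has no entry in $t$; (3) for all $\gamma\le\alpha<\beta$ and $\mathcal Y\in\mathcal U(\beta)$, $\mathcal Y\restriction\alpha\in\mathcal U(\alpha)$. **The forcing.** An *$\mathcal S$-splitting subtree function with top level $\beta<\omega_1$* is a function $F:T\restriction(\beta+1)\to 2$ such that $F(\text{root})=1$; $F(a)=1$ implies $F(a\restriction\gamma)=1$ for all $\gamma<\mathrm{ht}_T(a)$; whenever $\mathrm{ht}_T(x)<\beta$ and $F(x)=1$, there is $y\in T_\beta$ above $x$ with $F(y)=1$; and whenever $\mathrm{ht}_T(x)<\beta$ and $F(x)=1$, $|\{y\in\mathrm{Imm}_T(x):F(y)=1\}|\in\mathcal S$. Such an $F$ *fulfills* a generalized promise $\mathcal U$ with dimension $m$ and base level at most $\beta$ if for every finite $t\subseteq T_\beta$ and every $\mathcal Y\in\mathcal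 U(\beta)$ there is $(a_0,\dots,a_{m-1})\in\mathcal Y$ with $a_i\notin t$ and $F(a_i)=1$ for all $i<m$. Let $\mathbb P(T,\mathcal S)$ be the forcing poset of all pairs $(F,\Gamma)$ where $F$ is an $\mathcal S$-splitting subtree function and $\Gamma$ is a countable set of generalized promises on $T$ with base levels at most the top level of $F$, all fulfilled by $F$; let $(G,\Sigma)\le(F,\Gamma)$ iff $F\subseteq G$ and $\Gamma\subseteq\Sigma$. **The $\omega_2$-p.i.c.** For a forcing poset $\mathbb Q$ and a set $N$, a condition $q$ is *$(N,\mathbb Q)$-generic* if for every dense $D\subseteq\mathbb Q$ with $D\in N$, $D\cap N$ is predense below $q$. $H(\lambda)$ is the set of all sets whose transitive closure has size less than $\lambda$. The poset $\mathbb Q$ has the *$\omega_2$-p.i.c.* (properness isomorphism condition) if for every regular cardinal $\lambda>\omega_2$ with $\mathbb Q\in H(\lambda)$ the following holds. Suppose that $\alpha<\beta<\omega_2$; that $N_\alpha,N_\beta$ are countable elementary substructures of $(H(\lambda),\in)$ with $\mathbb Q\in N_\alpha\cap N_\beta$; that $\alpha\in N_\alpha$, $\beta\in N_\beta$, $N_\alpha\cap\omega_2\subseteq\beta$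 and $N_\alpha\cap\alpha=N_\beta\cap\beta$; and that $h:(N_\alpha,\in)\to(N_\beta,\in)$ is an isomorphism which is the identity on $N_\alpha\cap N_\beta$ and satisfies $h(\alpha)=\beta$. Then for every $p\in N_\alpha\cap\mathbb Q$ there is a condition $q\le p,h(p)$ which is both $(N_\alpha,\mathbb Q)$-generic and $(N_\beta,\mathbb Q)$-generic and such that for every $u\in N_\alpha\cap\mathbb Q$ and every $r\le q$ there is $s\le r$ with ($s\le u$ iff $s\le h(u)$). **Proposition.** The forcing poset $\mathbb P(T,\mathcal S)$ has the $\omega_2$-p.i.c. -/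

import Mathlib

open Cardinal Ordinal FirstOrder

universe u

namespace SplitTree

/-! ### Set-theoretic trees, as elements of the universe `ZFSet` of sets -/

/-- A set together with a binary relation on it, both given as sets
(the relation as a set of ordered pairs). -/
structure SetTree where
  carrier : ZFSet.{u}
  rel : ZFSet.{u}

namespace SetTree

variable (T : SetTree.{u})

/-- The strict order of the tree. -/
def Lt (x y : ZFSet.{u}) : Prop := ZFSet.pair x y ∈ T.rel

/-- The weak order of the tree. -/
def Le (x y : ZFSet.{u}) : Prop := x = y ∨ T.Lt x y

/-- A tree: a strict partial order in which the predecessors of each element are well-ordered. -/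
structure IsTree : Prop where
  rel_subset : T.rel ⊆ ZFSet.prod T.carrier T.carrier
  irrefl : ∀ x, ¬ T.Lt x x
  trans : ∀ x y z, T.Lt x y → T.Lt y z → T.Lt x z
  wellOrder : ∀ x ∈ T.carrier, IsWellOrder {y // T.Lt y x} (fun a b => T.Lt a.1 b.1)

/-- `α` is the height of `x`: the order type of the set of predecessors of `x`. -/
def HasHeight (x : ZFSet.{u}) (α : Ordinal.{u}) : Prop :=
  Nonempty ((fun a b : {y // T.Lt y x} => T.Lt a.1 b.1) ≃r
    (fun a b : Set.Iio α => a.1 < b.1))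

/-- Level `α` of the tree. -/
def level (α : Ordinal.{u}) : Set ZFSet.{u} := {x | x ∈ T.carrier ∧ T.HasHeight x α}

/-- The set of all elements of the tree of height at most `β`. -/
noncomputable def upTo (β : Ordinal.{u}) : ZFSet.{u} :=
  T.carrier.sep fun x => ∃ α ≤ β, x ∈ T.level α

/-- The immediate successors of `x`. -/
def imm (x : ZFSet.{u}) : Set ZFSet.{u} :=
  {y | T.Lt x y ∧ ¬ ∃ z, T.Lt x z ∧ T.Lt z y}

/-- `y` is the restriction of `x` to level `α`: the element of level `α` which is weakly
below `x`. -/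
def Restr (α : Ordinal.{u}) (x y : ZFSet.{u}) : Prop := y ∈ T.level α ∧ T.Le y x

/-- An `ω₁`-tree: a tree of height `ω₁` with countable levels. -/
structure IsOmega1Tree : Prop where
  isTree : T.IsTree
  level_nonempty_iff : ∀ α, (T.level α).Nonempty ↔ α < ω₁
  level_countable : ∀ α, (T.level α).Countable

/-- An Aronszajn tree: an `ω₁`-tree without a chain which meets every level below `ω₁`. -/
structure IsAronszajn : Prop where
  isOmega1Tree : T.IsOmega1Tree
  no_branch : ¬ ∃ b : Set ZFSet.{u}, (∀ x ∈ b, x ∈ T.carrier) ∧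
    (∀ x ∈ b, ∀ y ∈ b, T.Le x y ∨ T.Le y x) ∧ ∀ α < ω₁, ∃ x ∈ b, x ∈ T.level α

/-- `x` is the root of the tree. -/
def IsRoot (x : ZFSet.{u}) : Prop := x ∈ T.carrier ∧ ∀ y ∈ T.carrier, T.Le x y

/-- Normal trees. -/
structure IsNormal : Prop where
  exists_root : ∃ x, T.IsRoot x
  hausdorff : ∀ α, Order.IsSuccLimit α → ∀ x ∈ T.level α, ∀ y ∈ T.level α,
    (∀ z, T.Lt z x ↔ T.Lt z y) → x = y
  exists_incomparable : ∀ x ∈ T.carrier, ∃ y z, T.Lt x y ∧ T.Lt x z ∧ ¬ T.Le y z ∧ ¬ T.Le z y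
  uncountable_above : ∀ x ∈ T.carrier, ¬ {y | T.Lt x y}.Countable

end SetTree

/-- The finite tuple `(v 0, …, v (m - 1))` as a set: the function `i ↦ v i` on the von Neumann
natural number `m`. -/
noncomputable def tuple {m : ℕ} (v : Fin m → ZFSet.{u}) : ZFSet.{u} :=
  ZFSet.range fun i : Fin m => ZFSet.pair ((i : ℕ) : Ordinal.{u}).toZFSet (v i)

/-! ### Generalized promises -/

section Promises

variable (T : SetTree.{u})

/-- `Y` is a countably infinite set of `m`-tuples from level `β` of the derived tree determined
by `x`. -/
def IsTupleSet {m : ℕ} (x : Fin m → ZFSet.{u}) (β : Ordinal.{u}) (Y : ZFSet.{u}) : Prop :=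
  (Y : Set ZFSet.{u}).Countable ∧ (Y : Set ZFSet.{u}).Infinite ∧
  ∀ a ∈ Y, ∃ v : Fin m → ZFSet.{u}, a = tuple v ∧ ∀ i, v i ∈ T.level β ∧ T.Le (x i) (v i)

/-- `Y` is well-distributed: each finite subset of level `β` is disjoint from some member
of `Y`. -/
def WellDistributed (m : ℕ) (β : Ordinal.{u}) (Y : ZFSet.{u}) : Prop :=
  ∀ t : Finset ZFSet.{u}, (∀ z ∈ t, z ∈ T.level β) →
    ∃ v : Fin m → ZFSet.{u}, tuple v ∈ Y ∧ ∀ i, v i ∉ t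

/-- `Z` is the set of the restrictions to level `α` of the `m`-tuples in `Y`. -/
def IsTupleRestr (m : ℕ) (α : Ordinal.{u}) (Y Z : ZFSet.{u}) : Prop :=
  ∀ a, a ∈ Z ↔ ∃ v w : Fin m → ZFSet.{u}, tuple v ∈ Y ∧ a = tuple w ∧ ∀ i, T.Restr α (v i) (w i)

/-- `U` is a generalized promise on `T` with dimension `m` and base level `γ`: a function on the
interval `[γ, ω₁)` of von Neumann ordinals with the listed properties. -/
structure IsGenPromise (m : ℕ) (γ : Ordinal.{u}) (U : ZFSet.{u}) : Prop where
  dim_pos : 0 < m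
  base_lt : γ < ω₁
  mem_pair : ∀ z ∈ U, ∃ (β : Ordinal.{u}) (V : ZFSet.{u}),
    γ ≤ β ∧ β < ω₁ ∧ z = ZFSet.pair β.toZFSet V
  existsUnique : ∀ β : Ordinal.{u}, γ ≤ β → β < ω₁ → ∃! V, ZFSet.pair β.toZFSet V ∈ U
  nonempty : ∀ (β : Ordinal.{u}) (V : ZFSet.{u}), ZFSet.pair β.toZFSet V ∈ U → V.Nonempty
  countable : ∀ (β : Ordinal.{u}) (V : ZFSet.{u}), ZFSet.pair β.toZFSet V ∈ U →
    (V : Set ZFSet.{u}).Countable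
  derived : ∃ x : Fin m → ZFSet.{u}, Function.Injective x ∧ (∃ α, ∀ i, x i ∈ T.level α) ∧
    ∀ (β : Ordinal.{u}) (V : ZFSet.{u}), ZFSet.pair β.toZFSet V ∈ U →
      ∀ Y ∈ V, IsTupleSet T x β Y
  wellDistributed : ∀ (β : Ordinal.{u}) (V : ZFSet.{u}), ZFSet.pair β.toZFSet V ∈ U →
    ∀ Y ∈ V, WellDistributed T m β Y
  restr : ∀ (α β : Ordinal.{u}) (V W : ZFSet.{u}), α < β →
    ZFSet.pair α.toZFSet V ∈ U → ZFSet.pair β.toZFSet W ∈ U →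
      ∀ Y ∈ W, ∃ Z ∈ V, IsTupleRestr T m α Y Z

/-! ### Subtree functions -/

/-- `F x = 1`, for a set-theoretic function `F`. -/
def IsOne (F x : ZFSet.{u}) : Prop := ZFSet.pair x (1 : Ordinal.{u}).toZFSet ∈ F

/-- `F` is a subtree function with top level `β`. -/
structure IsSubtreeFun (F : ZFSet.{u}) (β : Ordinal.{u}) : Prop where
  top_lt : β < ω₁
  isFunc : ZFSet.IsFunc (T.upTo β) (2 : Ordinal.{u}).toZFSet F
  root : ∀ x, T.IsRoot x → IsOne F x
  downward : ∀ x y, T.Lt y x → IsOne F x → IsOne F y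
  extend : ∀ α < β, ∀ x ∈ T.level α, IsOne F x → ∃ y ∈ T.level β, T.Lt x y ∧ IsOne F y

/-- `F` is an `S`-splitting subtree function with top level `β`: below the top level, each element
with value `1` has exactly `k` immediate successors with value `1`, for some `k ∈ S`. -/
structure IsSplittingFun (S : Set ℕ) (F : ZFSet.{u}) (β : Ordinal.{u}) : Prop where
  isSubtreeFun : IsSubtreeFun T F β
  splitting : ∀ α < β, ∀ x ∈ T.level α, IsOne F x →
    ∃ k ∈ S, {y | y ∈ T.imm x ∧ IsOne F y}.encard = k

/-- The function `F` with top level `β` fulfills the generalized promise `U` with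
dimension `m`. -/
def Fulfills (F : ZFSet.{u}) (β : Ordinal.{u}) (m : ℕ) (U : ZFSet.{u}) : Prop :=
  ∀ t : Finset ZFSet.{u}, (∀ z ∈ t, z ∈ T.level β) →
    ∀ V, ZFSet.pair β.toZFSet V ∈ U → ∀ Y ∈ V,
      ∃ v : Fin m → ZFSet.{u}, tuple v ∈ Y ∧ ∀ i, v i ∉ t ∧ IsOne F (v i)

end Promises

/-! ### The forcing poset -/

/-- A forcing poset: a set with a reflexive transitive relation on it, both given as sets. -/
structure ForcingPoset where
  carrier : ZFSet.{u}
  rel : ZFSet.{u}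
  rel_subset : rel ⊆ ZFSet.prod carrier carrier
  refl : ∀ p ∈ carrier, ZFSet.pair p p ∈ rel
  trans : ∀ p q r, ZFSet.pair p q ∈ rel → ZFSet.pair q r ∈ rel → ZFSet.pair p r ∈ rel

namespace ForcingPoset

/-- `p ≤ q` in the poset. -/
def Le (Q : ForcingPoset.{u}) (p q : ZFSet.{u}) : Prop := ZFSet.pair p q ∈ Q.rel

/-- The poset as one set: the ordered pair of its underlying set and its order. -/
def toSet (Q : ForcingPoset.{u}) : ZFSet.{u} := ZFSet.pair Q.carrier Q.rel

/-- `D` is a dense subset of the poset. -/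
def IsDense (Q : ForcingPoset.{u}) (D : ZFSet.{u}) : Prop :=
  D ⊆ Q.carrier ∧ ∀ p ∈ Q.carrier, ∃ d ∈ D, Q.Le d p

/-- `q` is an `(N, Q)`-generic condition: for each dense set `D ∈ N`, the set `D ∩ N` is predense
below `q`. -/
def IsGeneric (Q : ForcingPoset.{u}) (N : Set ZFSet.{u}) (q : ZFSet.{u}) : Prop :=
  ∀ D ∈ N, Q.IsDense D → ∀ r, Q.Le r q → ∃ d ∈ D, d ∈ N ∧ ∃ s, Q.Le s r ∧ Q.Le s d

end ForcingPoset

/-- `p` is a condition: a pair `(F, Γ)` where `F` is an `S`-splitting subtree function and `Γ` is a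
countable set of generalized promises with base levels at most the top level of `F`, all of which
are fulfilled by `F`. -/
def IsCondition (T : SetTree.{u}) (S : Set ℕ) (p : ZFSet.{u}) : Prop :=
  ∃ (F Γ : ZFSet.{u}) (β : Ordinal.{u}), p = ZFSet.pair F Γ ∧ IsSplittingFun T S F β ∧
    (Γ : Set ZFSet.{u}).Countable ∧
    ∀ U ∈ Γ, ∃ (m : ℕ) (γ : Ordinal.{u}), γ ≤ β ∧ IsGenPromise T m γ U ∧ Fulfills T F β m U

/-- The order of conditions: `(G, Σ) ≤ (F, Γ)` if `F ⊆ G` and `Γ ⊆ Σ`. -/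
def Extends (q p : ZFSet.{u}) : Prop :=
  ∃ G Δ F Γ : ZFSet.{u}, q = ZFSet.pair G Δ ∧ p = ZFSet.pair F Γ ∧ F ⊆ G ∧ Γ ⊆ Δ

/-- A set which contains all conditions. -/
noncomputable def conditionBound (T : SetTree.{u}) : ZFSet.{u} :=
  ZFSet.prod (ZFSet.prod T.carrier (2 : Ordinal.{u}).toZFSet).powerset
    (ZFSet.prod (ω₁ : Ordinal.{u}).toZFSet
      (ZFSet.prod (ω : Ordinal.{u}).toZFSet T.carrier).powerset.powerset.powerset).powerset.powerset

/-- The set of all conditions. -/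
noncomputable def conditions (T : SetTree.{u}) (S : Set ℕ) : ZFSet.{u} :=
  (conditionBound T).sep (IsCondition T S)

theorem tuple_subset {T : SetTree.{u}} {m : ℕ} {v : Fin m → ZFSet.{u}}
    (hv : ∀ i, v i ∈ T.carrier) :
    tuple v ⊆ ZFSet.prod (ω : Ordinal.{u}).toZFSet T.carrier := by
  intro z hz
  obtain ⟨i, rfl⟩ := ZFSet.mem_range.1 hz
  rw [ZFSet.pair_mem_prod]
  exact ⟨Ordinal.toZFSet_mem_toZFSet_iff.2 (Ordinal.natCast_lt_omega0 _), hv i⟩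

theorem mem_conditions {T : SetTree.{u}} {S : Set ℕ} {p : ZFSet.{u}} :
    p ∈ conditions T S ↔ IsCondition T S p := by
  refine ⟨fun h => (ZFSet.mem_sep.1 h).2, fun h => ZFSet.mem_sep.2 ⟨?_, h⟩⟩
  obtain ⟨F, Γ, β, rfl, hF, -, hΓ⟩ := h
  rw [conditionBound, ZFSet.pair_mem_prod, ZFSet.mem_powerset, ZFSet.mem_powerset]
  constructor
  · intro z hz
    obtain ⟨a, ha, b, hb, rfl⟩ := ZFSet.mem_prod.1 (hF.isSubtreeFun.isFunc.1 hz)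
    exact ZFSet.pair_mem_prod.2 ⟨(ZFSet.mem_sep.1 ha).1, hb⟩
  · intro U hU
    obtain ⟨m, γ, -, hP, -⟩ := hΓ U hU
    rw [ZFSet.mem_powerset]
    intro z hz
    obtain ⟨δ, V, -, hδ, rfl⟩ := hP.mem_pair z hz
    obtain ⟨x, -, -, hx⟩ := hP.derived
    refine ZFSet.pair_mem_prod.2 ⟨Ordinal.toZFSet_mem_toZFSet_iff.2 hδ, ?_⟩
    rw [ZFSet.mem_powerset]
    intro Y hY
    rw [ZFSet.mem_powerset]
    intro a ha
    obtain ⟨v, rfl, hv⟩ := (hx δ V hz Y hY).2.2 a ha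
    rw [ZFSet.mem_powerset]
    exact tuple_subset fun i => (hv i).1.1

/-- The forcing poset `ℙ(T, S)`. -/
noncomputable def forcing (T : SetTree.{u}) (S : Set ℕ) : ForcingPoset.{u} where
  carrier := conditions T S
  rel := (ZFSet.prod (conditions T S) (conditions T S)).sep
    fun z => ∃ q p, z = ZFSet.pair q p ∧ Extends q p
  rel_subset := fun _ hz => (ZFSet.mem_sep.1 hz).1
  refl := by
    intro p hp
    obtain ⟨F, Γ, β, h, -⟩ := mem_conditions.1 hp
    exact ZFSet.mem_sep.2 ⟨ZFSet.pair_mem_prod.2 ⟨hp, hp⟩, p, p, rfl, F, Γ, F, Γ, h, h,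
      fun _ hz => hz, fun _ hz => hz⟩
  trans := by
    intro p q r h₁ h₂
    obtain ⟨h₁, a, b, hab, G, Δ, F, Γ, rfl, rfl, hF, hΓ⟩ := ZFSet.mem_sep.1 h₁
    obtain ⟨h₂, c, d, hcd, G', Δ', F', Γ', rfl, rfl, hF', hΓ'⟩ := ZFSet.mem_sep.1 h₂
    obtain ⟨rfl, rfl⟩ := ZFSet.pair_inj.1 hab
    obtain ⟨hq, rfl⟩ := ZFSet.pair_inj.1 hcd
    obtain ⟨rfl, rfl⟩ := ZFSet.pair_inj.1 hq
    refine ZFSet.mem_sep.2 ⟨ZFSet.pair_mem_prod.2 ⟨(ZFSet.pair_mem_prod.1 h₁).1,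
      (ZFSet.pair_mem_prod.1 h₂).2⟩, _, _, rfl, G, Δ, F', Γ', rfl, rfl,
      fun _ hz => hF (hF' hz), fun _ hz => hΓ (hΓ' hz)⟩

/-! ### Elementary submodels and the `ω₂`-p.i.c. -/

/-- The language of set theory has one relation symbol, which is binary. -/
inductive SetRel : ℕ → Type
  | mem : SetRel 2

/-- The first-order language of set theory. -/
def setLanguage : Language := ⟨fun _ => Empty, SetRel⟩

/-- `H(κ)`: the collection of all sets whose transitive closure has cardinality less than `κ`.
(A set `x` has this property iff it is included in a transitive set of cardinality less
than `κ`.) -/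
def H (κ : Cardinal.{u}) : Set ZFSet.{u} :=
  {x | ∃ t : ZFSet.{u}, t.IsTransitive ∧ x ⊆ t ∧ t.card < κ}

/-- `H(κ)` as a structure of the language of set theory. -/
instance (κ : Cardinal.{u}) : setLanguage.Structure (H κ) where
  funMap f := f.elim
  RelMap r := match r with
    | SetRel.mem => fun x => (x 0).1 ∈ (x 1).1

/-- The elementary substructures of `(H(κ), ∈)`. -/
abbrev ElemSub (κ : Cardinal.{u}) := setLanguage.ElementarySubstructure (H κ)

/-- The underlying set of an elementary substructure of `H(κ)`, as a collection of sets. -/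
def ElemSub.sets {κ : Cardinal.{u}} (N : ElemSub κ) : Set ZFSet.{u} :=
  {x | ∃ y : N, y.1.1 = x}

/-- The `ω₂`-properness isomorphism condition of a forcing poset `Q`. A regular cardinal `κ > ω₂`
is large enough if `Q` is in `H(κ)`. -/
def HasOmega2PIC (Q : ForcingPoset.{u}) : Prop :=
  ∀ κ : Cardinal.{u}, κ.IsRegular → ℵ_ 2 < κ → Q.toSet ∈ H κ →
  ∀ α β : Ordinal.{u}, α < β → β < ω_ 2 →
  ∀ Nα Nβ : ElemSub κ, Nα.sets.Countable → Nβ.sets.Countable →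
  Q.toSet ∈ Nα.sets → Q.toSet ∈ Nβ.sets →
  α.toZFSet ∈ Nα.sets → β.toZFSet ∈ Nβ.sets →
  (∀ ξ < ω_ 2, ξ.toZFSet ∈ Nα.sets → ξ < β) →
  (∀ ξ : Ordinal.{u}, (ξ.toZFSet ∈ Nα.sets ∧ ξ < α) ↔ (ξ.toZFSet ∈ Nβ.sets ∧ ξ < β)) →
  ∀ h : Nα ≃[setLanguage] Nβ,
  (∀ (x : Nα) (y : Nβ), x.1.1 = y.1.1 → (h x).1.1 = x.1.1) →
  (∀ x : Nα, x.1.1 = α.toZFSet → (h x).1.1 = β.toZFSet) →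
  ∀ p : Nα, p.1.1 ∈ Q.carrier →
  ∃ q, Q.Le q p.1.1 ∧ Q.Le q (h p).1.1 ∧
    Q.IsGeneric Nα.sets q ∧ Q.IsGeneric Nβ.sets q ∧
    ∀ w : Nα, w.1.1 ∈ Q.carrier → ∀ r, Q.Le r q →
      ∃ s, Q.Le s r ∧ (Q.Le s w.1.1 ↔ Q.Le s (h w).1.1)

end SplitTree

namespace SplitTree

/-! ### Levels, restrictions and comparability in trees -/

namespace SetTree

variable {T : SetTree.{u}}

/-! The core is properness with control over a limit level. Let `N` be a countable elementary
submodel and let `δ` be the height of the part of the tree lying in `N`. A generic condition with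
top level `δ` is the limit of conditions `p_n = (F_n, Γ_n)` in `N`, built together with growing
finite sets `A_n` of elements of level `δ` at which the limit function will be 1. The danger is that
`p_(n+1)`, chosen in `N` so as to enter a dense set `D`, gets the value 0 somewhere below `A_n`; and
`A_n` is not available inside `N`.

The remedy is `exists_countable_admits`: below a condition `p` there is a countable part `E` of `D`
such that every finite set admitted by `p` (some extension of `p` is 1 on it) is admitted by a
member of `E`. Such an `E` can be found in `N`, so all its members are in `N`, and one of them suits
`A_n` (`ElemSub.exists_mem_of_admits`).

The countable part exists because of the promises. Call a finite set on level `η` bad if `p` admits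
it but no member of `D` below `p` with top level at most `η` is 1 on its restriction to that top
level. If every level had bad sets, then after thinning out they would form a tree of tuples through
all levels. As `T` is Aronszajn, such a tree splits in all coordinates, so some level has infinitely
many pairwise disjoint tuples whose entries branch at most binarily
(`IsFullTupleTree.exists_disjoint_seq`). Members of `S` are at least 2, so `p` extends to a
condition which is 1 on all these tuples and contains the tree of tuples as a promise
(`IsCond.exists_extension_promise`). A member of `D` below it is then 1 on a bad tuple at its own
top level, a contradiction.

With two isomorphic models, `h` fixes the tree elements in `N`, so `p` and `h(p)` have the same
function and differ only in their promises (`ElemSub.fst_iso_eq`). One construction can therefore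
serve the promises of all `p_n` and all `h(p_n)`, and its limit lies below all of them. It is
generic for both models, and the last clause follows by entering the dense set of conditions that
are below `u` or incompatible with `u`. -/

theorem level_unique {x : ZFSet.{u}} {α β : Ordinal.{u}} (h₁ : x ∈ T.level α)
    (h₂ : x ∈ T.level β) : α = β := by
  obtain ⟨e₁⟩ := h₁.2
  obtain ⟨e₂⟩ := h₂.2
  have e : (fun a b : Set.Iio α => a.1 < b.1) ≃r (fun a b : Set.Iio β => a.1 < b.1) :=
    e₁.symm.trans e₂
  have e' : Set.Iio α ≃o Set.Iio β := OrderIso.ofRelIsoLT e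
  have h := Ordinal.type_eq.2 ⟨e'.toRelIsoLT⟩
  rwa [Ordinal.type_lt_Iio, Ordinal.type_lt_Iio, Ordinal.lift_inj] at h

theorem IsTree.mem_left (hT : T.IsTree) {x y : ZFSet.{u}} (h : T.Lt x y) : x ∈ T.carrier :=
  (ZFSet.pair_mem_prod.1 (hT.rel_subset h)).1

theorem IsTree.mem_right (hT : T.IsTree) {x y : ZFSet.{u}} (h : T.Lt x y) : y ∈ T.carrier :=
  (ZFSet.pair_mem_prod.1 (hT.rel_subset h)).2

theorem Lt.le {x y : ZFSet.{u}} (h : T.Lt x y) : T.Le x y := Or.inr h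

theorem IsTree.le_trans (hT : T.IsTree) {x y z : ZFSet.{u}} (h₁ : T.Le x y) (h₂ : T.Le y z) :
    T.Le x z := by
  rcases h₁ with rfl | h₁
  · exact h₂
  · rcases h₂ with rfl | h₂
    · exact Or.inr h₁
    · exact Or.inr (hT.trans _ _ _ h₁ h₂)

theorem IsTree.lt_of_lt_of_le (hT : T.IsTree) {x y z : ZFSet.{u}} (h₁ : T.Lt x y)
    (h₂ : T.Le y z) : T.Lt x z := by
  rcases h₂ with rfl | h₂
  · exact h₁
  · exact hT.trans _ _ _ h₁ h₂

/-- The predecessors of a predecessor correspond to an initial segment of the height. -/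
theorem IsTree.hasHeight_of_iso (hT : T.IsTree) {x y : ZFSet.{u}} {α : Ordinal.{u}}
    (e : (fun a b : {y // T.Lt y x} => T.Lt a.1 b.1) ≃r (fun a b : Set.Iio α => a.1 < b.1))
    (hy : T.Lt y x) : T.HasHeight y (e ⟨y, hy⟩).1 := by
  refine ⟨⟨⟨fun z => ⟨(e ⟨z.1, hT.trans _ _ _ z.2 hy⟩).1, ?_⟩,
    fun ξ => ⟨(e.symm ⟨ξ.1, (show ξ.1 < _ from ξ.2).trans (e ⟨y, hy⟩).2⟩).1, ?_⟩, ?_, ?_⟩, ?_⟩⟩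
  · exact e.map_rel_iff.2 z.2
  · have : T.Lt (e.symm ⟨ξ.1, (show ξ.1 < _ from ξ.2).trans (e ⟨y, hy⟩).2⟩).1
        (⟨y, hy⟩ : {y // T.Lt y x}).1 := by
      rw [← e.map_rel_iff, RelIso.apply_symm_apply]
      exact ξ.2
    exact this
  · intro z
    apply Subtype.ext
    change (e.symm (e ⟨z.1, hT.trans _ _ _ z.2 hy⟩)).1 = z.1
    exact (congrArg Subtype.val
      (e.symm_apply_apply ⟨z.1, hT.trans _ _ _ z.2 hy⟩))
  · intro ξ
    simp
  · intro a b
    exact e.map_rel_iff (a := ⟨a.1, hT.trans _ _ _ a.2 hy⟩) (b := ⟨b.1, hT.trans _ _ _ b.2 hy⟩)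

theorem IsTree.exists_level_lt (hT : T.IsTree) {x : ZFSet.{u}} {α ξ : Ordinal.{u}}
    (hx : x ∈ T.level α) (hξ : ξ < α) : ∃ y ∈ T.level ξ, T.Lt y x := by
  obtain ⟨e⟩ := hx.2
  have hy := (e.symm ⟨ξ, hξ⟩).2
  refine ⟨(e.symm ⟨ξ, hξ⟩).1, ⟨hT.mem_left hy, ?_⟩, hy⟩
  have := hT.hasHeight_of_iso e hy
  rwa [Subtype.coe_eta, RelIso.apply_symm_apply] at this

theorem IsTree.exists_level_le (hT : T.IsTree) {x : ZFSet.{u}} {α ξ : Ordinal.{u}}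
    (hx : x ∈ T.level α) (hξ : ξ ≤ α) : ∃ y ∈ T.level ξ, T.Le y x := by
  rcases hξ.eq_or_lt with rfl | hξ
  · exact ⟨x, hx, Or.inl rfl⟩
  · obtain ⟨y, hy, h⟩ := hT.exists_level_lt hx hξ
    exact ⟨y, hy, Or.inr h⟩

theorem IsTree.exists_level_of_lt (hT : T.IsTree) {x y : ZFSet.{u}} {α : Ordinal.{u}}
    (hx : x ∈ T.level α) (h : T.Lt y x) : ∃ ξ < α, y ∈ T.level ξ := by
  obtain ⟨e⟩ := hx.2
  exact ⟨(e ⟨y, h⟩).1, (e ⟨y, h⟩).2, hT.mem_left h, hT.hasHeight_of_iso e h⟩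

theorem IsTree.level_lt_level (hT : T.IsTree) {x y : ZFSet.{u}} {α ξ : Ordinal.{u}}
    (hx : x ∈ T.level α) (hy : y ∈ T.level ξ) (h : T.Lt y x) : ξ < α := by
  obtain ⟨ζ, hζ, hy'⟩ := hT.exists_level_of_lt hx h
  rwa [level_unique hy hy']

theorem IsTree.comparable (hT : T.IsTree) {x y z : ZFSet.{u}} (hx : x ∈ T.carrier)
    (hy : T.Le y x) (hz : T.Le z x) : T.Lt y z ∨ y = z ∨ T.Lt z y := by
  rcases hy with rfl | hy
  · rcases hz with rfl | hz
    · exact Or.inr (Or.inl rfl)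
    · exact Or.inr (Or.inr hz)
  · rcases hz with rfl | hz
    · exact Or.inl hy
    · have := hT.wellOrder x hx
      rcases trichotomous_of (fun a b : {y // T.Lt y x} => T.Lt a.1 b.1) ⟨y, hy⟩ ⟨z, hz⟩ with
        h | h | h
      · exact Or.inl h
      · exact Or.inr (Or.inl (congrArg Subtype.val h))
      · exact Or.inr (Or.inr h)

theorem IsTree.lt_of_level_lt (hT : T.IsTree) {x y z : ZFSet.{u}} {ξ ζ : Ordinal.{u}}
    (hx : x ∈ T.carrier) (hy : y ∈ T.level ξ) (hz : z ∈ T.level ζ) (hyx : T.Le y x)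
    (hzx : T.Le z x) (h : ξ < ζ) : T.Lt y z := by
  rcases hT.comparable hx hyx hzx with h' | rfl | h'
  · exact h'
  · exact absurd (level_unique hy hz) h.ne
  · exact absurd (hT.level_lt_level hy hz h') h.asymm

theorem IsTree.eq_of_level_eq (hT : T.IsTree) {x y z : ZFSet.{u}} {ξ : Ordinal.{u}}
    (hx : x ∈ T.carrier) (hy : y ∈ T.level ξ) (hz : z ∈ T.level ξ) (hyx : T.Le y x)
    (hzx : T.Le z x) : y = z := by
  rcases hT.comparable hx hyx hzx with h' | rfl | h'
  · exact absurd (hT.level_lt_level hz hy h') (lt_irrefl _)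
  · rfl
  · exact absurd (hT.level_lt_level hy hz h') (lt_irrefl _)

theorem IsTree.le_of_level_le (hT : T.IsTree) {x y z : ZFSet.{u}} {ξ ζ : Ordinal.{u}}
    (hx : x ∈ T.carrier) (hy : y ∈ T.level ξ) (hz : z ∈ T.level ζ) (hyx : T.Le y x)
    (hzx : T.Le z x) (h : ξ ≤ ζ) : T.Le y z := by
  rcases h.eq_or_lt with rfl | h
  · exact Or.inl (hT.eq_of_level_eq hx hy hz hyx hzx)
  · exact Or.inr (hT.lt_of_level_lt hx hy hz hyx hzx h)

theorem IsTree.exists_level (hT : T.IsTree) {x : ZFSet.{u}} (hx : x ∈ T.carrier) :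
    ∃ α, x ∈ T.level α := by
  have := hT.wellOrder x hx
  -- The predecessors form a type in the next universe. They embed in the set `T.carrier`, so they
  -- have a copy in universe `u`, whose order type is an `Ordinal.{u}`.
  have hsmall : Small.{u} {y // T.Lt y x} := by
    refine small_of_injective (β := T.carrier)
      (f := fun y => ⟨y.1, hT.mem_left y.2⟩) ?_
    intro a b h
    exact Subtype.ext (congrArg (fun z : T.carrier => z.1) h)
  let e := equivShrink.{u} {y // T.Lt y x}
  let r : Shrink.{u} {y // T.Lt y x} → Shrink.{u} {y // T.Lt y x} → Prop :=
    fun a b => T.Lt (e.symm a).1 (e.symm b).1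
  let f : r ≃r (fun a b : {y // T.Lt y x} => T.Lt a.1 b.1) := ⟨e.symm, Iff.rfl⟩
  have : IsWellOrder _ r := f.toRelEmbedding.isWellOrder
  exact ⟨Ordinal.type r, hx, ⟨f.symm.trans (Ordinal.enum r).symm⟩⟩

theorem IsTree.mem_imm_iff (hT : T.IsTree) {x y : ZFSet.{u}} {α : Ordinal.{u}}
    (hx : x ∈ T.level α) : y ∈ T.imm x ↔ y ∈ T.level (α + 1) ∧ T.Lt x y := by
  constructor
  · rintro ⟨h, h'⟩
    refine ⟨?_, h⟩
    obtain ⟨β, hβ⟩ := hT.exists_level (hT.mem_right h)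
    have h1 : α < β := hT.level_lt_level hβ hx h
    rcases (Order.add_one_le_of_lt h1).eq_or_lt with h2 | h2
    · rwa [h2]
    · obtain ⟨z, hz, hzy⟩ := hT.exists_level_lt hβ h2
      exact absurd ⟨z, hT.lt_of_level_lt hβ.1 hx hz h.le hzy.le (Order.lt_add_one_iff.2 le_rfl),
        hzy⟩ h'
  · rintro ⟨hy, h⟩
    refine ⟨h, ?_⟩
    rintro ⟨z, h1, h2⟩
    obtain ⟨ζ, hζ, hz⟩ := hT.exists_level_of_lt hy h2
    have := hT.level_lt_level hz hx h1
    exact absurd (Order.lt_add_one_iff.1 hζ) (not_le.2 this)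

theorem IsOmega1Tree.lt_omega_one (hT : T.IsOmega1Tree) {x : ZFSet.{u}} {α : Ordinal.{u}}
    (hx : x ∈ T.level α) : α < ω₁ := (hT.level_nonempty_iff α).1 ⟨x, hx⟩

theorem countable_Iio {α : Ordinal.{u}} (h : α < ω₁) : (Set.Iio α).Countable := by
  rw [← Set.countable_coe_iff, ← Cardinal.mk_le_aleph0_iff, Cardinal.mk_Iio_ordinal,
    Cardinal.lift_le_aleph0, ← Order.lt_succ_iff, Cardinal.succ_aleph0, ← Cardinal.lt_ord,
    Cardinal.ord_aleph]
  exact h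

theorem add_one_lt_omega_one {α : Ordinal.{u}} (h : α < ω₁) : α + 1 < ω₁ :=
  (Cardinal.isSuccLimit_omega 1).add_one_lt h

theorem IsOmega1Tree.countable_upTo (hT : T.IsOmega1Tree) {β : Ordinal.{u}} (h : β < ω₁) :
    (T.upTo β : Set ZFSet.{u}).Countable := by
  have : (⋃ α ∈ Set.Iic β, T.level α).Countable := by
    refine Set.Countable.biUnion ?_ fun α _ => hT.level_countable α
    rw [← Order.Iio_succ]
    exact countable_Iio (add_one_lt_omega_one h)
  refine this.mono fun x hx => ?_
  obtain ⟨-, α, hα, hx⟩ := ZFSet.mem_sep.1 hx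
  exact Set.mem_biUnion (show α ∈ Set.Iic β from hα) hx

/-- Above each element there are elements of all higher levels. -/
theorem IsNormal.exists_above (hN : T.IsNormal) (hT : T.IsOmega1Tree) {x : ZFSet.{u}}
    {α γ : Ordinal.{u}} (hx : x ∈ T.level α) (h : α ≤ γ) (hγ : γ < ω₁) :
    ∃ y ∈ T.level γ, T.Le x y := by
  -- Otherwise nothing above `x` reaches level `γ`, so everything above `x` lies in the countable
  -- set `T.upTo γ`, against normality.
  by_contra! hcon
  refine hN.uncountable_above x hx.1 ((hT.countable_upTo hγ).mono fun y hy => ?_)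
  obtain ⟨β, hβ⟩ := hT.isTree.exists_level (hT.isTree.mem_right hy)
  refine ZFSet.mem_sep.2 ⟨hβ.1, β, ?_, hβ⟩
  by_contra! hlt
  obtain ⟨z, hz, hzy⟩ := hT.isTree.exists_level_lt hβ hlt
  exact hcon z hz (hT.isTree.le_of_level_le hβ.1 hx hz (Or.inr hy) hzy.le h)

theorem mem_upTo {x : ZFSet.{u}} {α β : Ordinal.{u}} (hx : x ∈ T.level α) :
    x ∈ T.upTo β ↔ α ≤ β := by
  rw [upTo, ZFSet.mem_sep]
  constructor
  · rintro ⟨-, ζ, hζ, hx'⟩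
    rwa [level_unique hx hx']
  · exact fun h => ⟨hx.1, α, h, hx⟩

end SetTree

end SplitTree

/-! ### Bookkeeping, coding of tuples and functions, conditions and their order -/

namespace SplitTree

/-- Along a suitable sequence, each of countably many tasks is carried out infinitely often. -/
theorem exists_seq_forall_exists_ge {σ : Type*} {ι : Type*} [Countable ι] (P : σ → Prop)
    (r : σ → σ → Prop) (hrefl : ∀ s, r s s) (htrans : ∀ a b c, r a b → r b c → r a c)
    (R : ι → σ → σ → Prop) (s₀ : σ) (h₀ : P s₀)
    (h : ∀ i s, P s → ∃ s', P s' ∧ r s s' ∧ R i s s') :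
    ∃ s : ℕ → σ, s 0 = s₀ ∧ (∀ n, P (s n)) ∧ (∀ n m, n ≤ m → r (s n) (s m)) ∧
      ∀ i n, ∃ m ≥ n, R i (s m) (s (m + 1)) := by
  rcases isEmpty_or_nonempty ι with hι | hι
  · exact ⟨fun _ => s₀, rfl, fun _ => h₀, fun _ _ _ => hrefl _, fun i => hι.elim i⟩
  obtain ⟨g, hg⟩ := exists_surjective_nat ι
  choose! f hfP hfr hfR using h
  -- Step `n` performs the task numbered by the first component of `n` under unpairing. Task `k` is
  -- thus performed at each step `Nat.pair k n`, which is at least `n`.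
  let s : ℕ → σ := fun n => Nat.rec s₀ (fun k a => f (g (Nat.unpair k).1) a) n
  have hs : ∀ n, s (n + 1) = f (g (Nat.unpair n).1) (s n) := fun n => rfl
  have hP : ∀ n, P (s n) := by
    intro n
    induction n with
    | zero => exact h₀
    | succ n ih => rw [hs]; exact hfP _ _ ih
  refine ⟨s, rfl, hP, ?_, ?_⟩
  · intro n m hnm
    induction m, hnm using Nat.le_induction with
    | base => exact hrefl _
    | succ k _ ih => exact htrans _ _ _ ih (by rw [hs]; exact hfr _ _ (hP k))
  · intro i n
    obtain ⟨k, rfl⟩ := hg i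
    refine ⟨Nat.pair k n, Nat.right_le_pair k n, ?_⟩
    rw [hs, Nat.unpair_pair]
    exact hfR _ _ (hP _)

theorem exists_eq_of_tuple_eq {m n : ℕ} {v : Fin m → ZFSet.{u}} {w : Fin n → ZFSet.{u}}
    (h : tuple v = tuple w) (i : Fin m) : ∃ j : Fin n, (j : ℕ) = i ∧ w j = v i := by
  have : ZFSet.pair ((i : ℕ) : Ordinal.{u}).toZFSet (v i) ∈ tuple w := by
    rw [← h]
    exact ZFSet.mem_range.2 ⟨i, rfl⟩
  obtain ⟨j, hj⟩ := ZFSet.mem_range.1 this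
  obtain ⟨h1, h2⟩ := ZFSet.pair_inj.1 hj
  exact ⟨j, Nat.cast_injective (Ordinal.toZFSet_injective h1), h2⟩

theorem tuple_injective {m : ℕ} :
    Function.Injective (tuple : (Fin m → ZFSet.{u}) → ZFSet.{u}) := by
  intro v w h
  funext i
  obtain ⟨j, hj, h'⟩ := exists_eq_of_tuple_eq h i
  rw [← h', Fin.ext hj]

/-- A promise, as a set, does not record its dimension; it is recovered from any of its tuples,
which are functions on a von Neumann natural number. -/
theorem dim_eq_of_tuple_eq {m n : ℕ} {v : Fin m → ZFSet.{u}} {w : Fin n → ZFSet.{u}}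
    (h : tuple v = tuple w) : m = n := by
  have key : ∀ {m n : ℕ} {v : Fin m → ZFSet.{u}} {w : Fin n → ZFSet.{u}},
      tuple v = tuple w → m ≤ n := by
    intro m n v w h
    by_contra! hlt
    obtain ⟨j, hj, -⟩ := exists_eq_of_tuple_eq h ⟨n, hlt⟩
    exact absurd j.2 (by simp [hj])
  exact le_antisymm (key h) (key h.symm)

theorem zero_mem_two : (0 : Ordinal.{u}).toZFSet ∈ (2 : Ordinal.{u}).toZFSet :=
  Ordinal.toZFSet_mem_toZFSet_iff.2 zero_lt_two

theorem one_mem_two : (1 : Ordinal.{u}).toZFSet ∈ (2 : Ordinal.{u}).toZFSet :=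
  Ordinal.toZFSet_mem_toZFSet_iff.2 one_lt_two

theorem eq_zero_or_one_of_mem_two {i : ZFSet.{u}} (h : i ∈ (2 : Ordinal.{u}).toZFSet) :
    i = (0 : Ordinal.{u}).toZFSet ∨ i = (1 : Ordinal.{u}).toZFSet := by
  obtain ⟨a, ha, rfl⟩ := Ordinal.mem_toZFSet_iff.1 h
  have h2 : (2 : Ordinal.{u}) = 1 + 1 := one_add_one_eq_two.symm
  rw [h2, Order.lt_add_one_iff] at ha
  rcases ha.eq_or_lt with rfl | ha
  · exact Or.inr rfl
  · left
    rw [Order.lt_one_iff.1 ha]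

theorem zero_ne_one_toZFSet : (0 : Ordinal.{u}).toZFSet ≠ (1 : Ordinal.{u}).toZFSet :=
  fun h => zero_ne_one (Ordinal.toZFSet_injective h)

theorem isOne_mono {F G x : ZFSet.{u}} (h : F ⊆ G) (hx : IsOne F x) : IsOne G x := h hx

theorem IsOne.mem_of_isFunc {A B F x : ZFSet.{u}} (hF : ZFSet.IsFunc A B F) (hx : IsOne F x) :
    x ∈ A := (ZFSet.pair_mem_prod.1 (hF.1 hx)).1

/-- A larger function cannot change a value 0 into 1, because single-valuedness keeps the old value.
-/
theorem isOne_iff_of_subset {A B C D F G x : ZFSet.{u}} (hF : ZFSet.IsFunc A B F)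
    (hG : ZFSet.IsFunc C D G) (h : F ⊆ G) (hx : x ∈ A) : IsOne F x ↔ IsOne G x := by
  refine ⟨isOne_mono h, fun hx' => ?_⟩
  obtain ⟨w, hw, -⟩ := hF.2 x hx
  have hC : x ∈ C := hx'.mem_of_isFunc hG
  obtain ⟨w', -, hw'⟩ := hG.2 x hC
  have h1 : w = w' := hw' _ (h hw)
  have h2 : (1 : Ordinal.{u}).toZFSet = w' := hw' _ hx'
  rw [IsOne, h2, ← h1]
  exact hw

section MkFun

variable (T : SetTree.{u})

/-- The characteristic function of `W` on the set of elements of height at most `β`. -/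
noncomputable def mkFun (β : Ordinal.{u}) (W : Set ZFSet.{u}) : ZFSet.{u} :=
  (ZFSet.prod (T.upTo β) (2 : Ordinal.{u}).toZFSet).sep fun z =>
    ∃ x, (x ∈ W ∧ z = ZFSet.pair x (1 : Ordinal.{u}).toZFSet) ∨
      (x ∉ W ∧ z = ZFSet.pair x (0 : Ordinal.{u}).toZFSet)

variable {T}

theorem pair_mem_mkFun {β : Ordinal.{u}} {W : Set ZFSet.{u}} {x i : ZFSet.{u}} :
    ZFSet.pair x i ∈ mkFun T β W ↔ x ∈ T.upTo β ∧
      ((x ∈ W ∧ i = (1 : Ordinal.{u}).toZFSet) ∨ (x ∉ W ∧ i = (0 : Ordinal.{u}).toZFSet)) := by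
  rw [mkFun, ZFSet.mem_sep, ZFSet.pair_mem_prod]
  constructor
  · rintro ⟨⟨hx, hi⟩, y, ⟨hy, h⟩ | ⟨hy, h⟩⟩
    · obtain ⟨rfl, rfl⟩ := ZFSet.pair_inj.1 h
      exact ⟨hx, Or.inl ⟨hy, rfl⟩⟩
    · obtain ⟨rfl, rfl⟩ := ZFSet.pair_inj.1 h
      exact ⟨hx, Or.inr ⟨hy, rfl⟩⟩
  · rintro ⟨hx, ⟨hy, rfl⟩ | ⟨hy, rfl⟩⟩
    · exact ⟨⟨hx, one_mem_two⟩, x, Or.inl ⟨hy, rfl⟩⟩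
    · exact ⟨⟨hx, zero_mem_two⟩, x, Or.inr ⟨hy, rfl⟩⟩

theorem isOne_mkFun {β : Ordinal.{u}} {W : Set ZFSet.{u}} {x : ZFSet.{u}} :
    IsOne (mkFun T β W) x ↔ x ∈ T.upTo β ∧ x ∈ W := by
  rw [IsOne, pair_mem_mkFun]
  refine and_congr_right fun _ => ⟨?_, fun h => Or.inl ⟨h, rfl⟩⟩
  rintro (h | h)
  · exact h.1
  · exact absurd h.2.symm zero_ne_one_toZFSet

theorem isFunc_mkFun (β : Ordinal.{u}) (W : Set ZFSet.{u}) :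
    ZFSet.IsFunc (T.upTo β) (2 : Ordinal.{u}).toZFSet (mkFun T β W) := by
  refine ⟨fun z hz => (ZFSet.mem_sep.1 hz).1, fun x hx => ?_⟩
  by_cases hW : x ∈ W
  · refine ⟨(1 : Ordinal.{u}).toZFSet, pair_mem_mkFun.2 ⟨hx, Or.inl ⟨hW, rfl⟩⟩, fun i hi => ?_⟩
    rcases (pair_mem_mkFun.1 hi).2 with h | h
    · exact h.2
    · exact absurd hW h.1
  · refine ⟨(0 : Ordinal.{u}).toZFSet, pair_mem_mkFun.2 ⟨hx, Or.inr ⟨hW, rfl⟩⟩, fun i hi => ?_⟩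
    rcases (pair_mem_mkFun.1 hi).2 with h | h
    · exact absurd h.1 hW
    · exact h.2

theorem upTo_subset {β γ : Ordinal.{u}} (h : β ≤ γ) : T.upTo β ⊆ T.upTo γ := by
  intro x hx
  obtain ⟨hx, α, hα, h'⟩ := ZFSet.mem_sep.1 hx
  exact ZFSet.mem_sep.2 ⟨hx, α, hα.trans h, h'⟩

theorem subset_mkFun {β γ : Ordinal.{u}} {W : Set ZFSet.{u}} {F : ZFSet.{u}}
    (hF : ZFSet.IsFunc (T.upTo β) (2 : Ordinal.{u}).toZFSet F) (h : β ≤ γ)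
    (hW : ∀ x ∈ T.upTo β, IsOne F x ↔ x ∈ W) : F ⊆ mkFun T γ W := by
  intro z hz
  obtain ⟨x, hx, i, hi, rfl⟩ := ZFSet.mem_prod.1 (hF.1 hz)
  refine pair_mem_mkFun.2 ⟨upTo_subset h hx, ?_⟩
  rcases eq_zero_or_one_of_mem_two hi with rfl | rfl
  · refine Or.inr ⟨fun hxW => ?_, rfl⟩
    exact zero_ne_one_toZFSet ((hF.2 x hx).unique hz ((hW x hx).2 hxW))
  · exact Or.inl ⟨(hW x hx).1 hz, rfl⟩

end MkFun

/-- The standing assumptions on the tree `T` and the set `S` of splitting numbers. -/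
structure IsSuitable (T : SetTree.{u}) (S : Set ℕ) : Prop where
  aronszajn : T.IsAronszajn
  normal : T.IsNormal
  nonempty : S.Nonempty
  two_le : ∀ n ∈ S, 2 ≤ n
  le_imm : ∀ x ∈ T.carrier, ∀ k ∈ S, (k : ℕ∞) ≤ (T.imm x).encard

theorem IsSuitable.isOmega1Tree {T : SetTree.{u}} {S : Set ℕ} (h : IsSuitable T S) :
    T.IsOmega1Tree := h.aronszajn.isOmega1Tree

theorem IsSuitable.isTree {T : SetTree.{u}} {S : Set ℕ} (h : IsSuitable T S) :
    T.IsTree := h.isOmega1Tree.isTree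

/-- `(F, Γ)` is a condition with top level `β`. -/
structure IsCond (T : SetTree.{u}) (S : Set ℕ) (F Γ : ZFSet.{u}) (β : Ordinal.{u}) : Prop where
  isSplittingFun : IsSplittingFun T S F β
  countable : (Γ : Set ZFSet.{u}).Countable
  fulfills : ∀ U ∈ Γ, ∃ (m : ℕ) (γ : Ordinal.{u}), γ ≤ β ∧ IsGenPromise T m γ U ∧
    Fulfills T F β m U

theorem IsCond.isSubtreeFun {T : SetTree.{u}} {S : Set ℕ} {F Γ : ZFSet.{u}} {β : Ordinal.{u}}
    (h : IsCond T S F Γ β) : IsSubtreeFun T F β := h.isSplittingFun.isSubtreeFun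

theorem IsCond.isFunc {T : SetTree.{u}} {S : Set ℕ} {F Γ : ZFSet.{u}} {β : Ordinal.{u}}
    (h : IsCond T S F Γ β) : ZFSet.IsFunc (T.upTo β) (2 : Ordinal.{u}).toZFSet F :=
  h.isSubtreeFun.isFunc

theorem mem_conditions_iff {T : SetTree.{u}} {S : Set ℕ} {p : ZFSet.{u}} :
    p ∈ conditions T S ↔ ∃ F Γ β, p = ZFSet.pair F Γ ∧ IsCond T S F Γ β := by
  rw [mem_conditions]
  constructor
  · rintro ⟨F, Γ, β, h, h1, h2, h3⟩
    exact ⟨F, Γ, β, h, h1, h2, h3⟩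
  · rintro ⟨F, Γ, β, h, h1, h2, h3⟩
    exact ⟨F, Γ, β, h, h1, h2, h3⟩

theorem forcing_le_iff {T : SetTree.{u}} {S : Set ℕ} {q p : ZFSet.{u}} :
    (forcing T S).Le q p ↔ q ∈ conditions T S ∧ p ∈ conditions T S ∧ Extends q p := by
  change ZFSet.pair q p ∈ (ZFSet.prod (conditions T S) (conditions T S)).sep
    (fun z => ∃ q p, z = ZFSet.pair q p ∧ Extends q p) ↔ _
  constructor
  · intro h
    obtain ⟨h1, a, b, hab, h2⟩ := ZFSet.mem_sep.1 h
    obtain ⟨rfl, rfl⟩ := ZFSet.pair_inj.1 hab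
    exact ⟨(ZFSet.pair_mem_prod.1 h1).1, (ZFSet.pair_mem_prod.1 h1).2, h2⟩
  · rintro ⟨h1, h2, h3⟩
    exact ZFSet.mem_sep.2 ⟨ZFSet.pair_mem_prod.2 ⟨h1, h2⟩, q, p, rfl, h3⟩

theorem extends_pair_iff {G Δ F Γ : ZFSet.{u}} :
    Extends (ZFSet.pair G Δ) (ZFSet.pair F Γ) ↔ F ⊆ G ∧ Γ ⊆ Δ := by
  constructor
  · rintro ⟨G', Δ', F', Γ', h1, h2, h3, h4⟩
    obtain ⟨rfl, rfl⟩ := ZFSet.pair_inj.1 h1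
    obtain ⟨rfl, rfl⟩ := ZFSet.pair_inj.1 h2
    exact ⟨h3, h4⟩
  · exact fun h => ⟨G, Δ, F, Γ, rfl, rfl, h.1, h.2⟩

theorem IsCond.mem {T : SetTree.{u}} {S : Set ℕ} {F Γ : ZFSet.{u}} {β : Ordinal.{u}}
    (h : IsCond T S F Γ β) : ZFSet.pair F Γ ∈ conditions T S :=
  mem_conditions_iff.2 ⟨F, Γ, β, rfl, h⟩

theorem IsCond.pair_le {T : SetTree.{u}} {S : Set ℕ} {F Γ G Δ : ZFSet.{u}} {β γ : Ordinal.{u}}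
    (hq : IsCond T S G Δ γ) (hp : IsCond T S F Γ β) (h1 : F ⊆ G) (h2 : Γ ⊆ Δ) :
    (forcing T S).Le (ZFSet.pair G Δ) (ZFSet.pair F Γ) :=
  forcing_le_iff.2 ⟨hq.mem, hp.mem, extends_pair_iff.2 ⟨h1, h2⟩⟩

theorem top_le_of_subset {T : SetTree.{u}} (hT : T.IsOmega1Tree) {F G : ZFSet.{u}}
    {β γ : Ordinal.{u}} (hF : IsSubtreeFun T F β) (hG : IsSubtreeFun T G γ) (h : F ⊆ G) :
    β ≤ γ := by
  obtain ⟨x, hx⟩ := (hT.level_nonempty_iff β).2 hF.top_lt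
  obtain ⟨w, hw, -⟩ := hF.isFunc.2 x ((SetTree.mem_upTo hx).2 le_rfl)
  exact (SetTree.mem_upTo hx).1 (ZFSet.pair_mem_prod.1 (hG.isFunc.1 (h hw))).1

/-- Below a condition, conditions are pairs which extend it. -/
theorem exists_of_le {T : SetTree.{u}} {S : Set ℕ} (hT : T.IsOmega1Tree) {F Γ q : ZFSet.{u}}
    {β : Ordinal.{u}} (hp : IsCond T S F Γ β) (h : (forcing T S).Le q (ZFSet.pair F Γ)) :
    ∃ G Δ γ, q = ZFSet.pair G Δ ∧ IsCond T S G Δ γ ∧ F ⊆ G ∧ Γ ⊆ Δ ∧ β ≤ γ := by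
  obtain ⟨h1, -, h2⟩ := forcing_le_iff.1 h
  obtain ⟨G, Δ, γ, rfl, hG⟩ := mem_conditions_iff.1 h1
  obtain ⟨h3, h4⟩ := extends_pair_iff.1 h2
  exact ⟨G, Δ, γ, rfl, hG, h3, h4, top_le_of_subset hT hp.isSubtreeFun hG.isSubtreeFun h3⟩

/-! ### Restrictions of sets to a level, and branching -/

namespace SetTree

variable (T : SetTree.{u})

/-- The set of the elements of level `β` which are weakly below some member of `A`. -/
def below (β : Ordinal.{u}) (A : Set ZFSet.{u}) : Set ZFSet.{u} :=
  {y | y ∈ T.level β ∧ ∃ a ∈ A, T.Le y a}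

/-- The set of the immediate successors of `z` which are weakly below some member of `A`. -/
def branching (A : Set ZFSet.{u}) (z : ZFSet.{u}) : Set ZFSet.{u} :=
  {y | y ∈ T.imm z ∧ ∃ a ∈ A, T.Le y a}

variable {T}

theorem below_mono {β : Ordinal.{u}} {A B : Set ZFSet.{u}} (h : A ⊆ B) :
    T.below β A ⊆ T.below β B := fun _ hy => ⟨hy.1, hy.2.imp fun _ ha => ⟨h ha.1, ha.2⟩⟩

theorem below_union {β : Ordinal.{u}} {A B : Set ZFSet.{u}} :
    T.below β (A ∪ B) = T.below β A ∪ T.below β B := by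
  ext y
  constructor
  · rintro ⟨hy, a, ha | ha, h⟩
    · exact Or.inl ⟨hy, a, ha, h⟩
    · exact Or.inr ⟨hy, a, ha, h⟩
  · rintro (h | h)
    · exact below_mono Set.subset_union_left h
    · exact below_mono Set.subset_union_right h

theorem IsTree.finite_below (hT : T.IsTree) {β : Ordinal.{u}} {A : Set ZFSet.{u}}
    (hc : ∀ a ∈ A, a ∈ T.carrier) (hA : A.Finite) : (T.below β A).Finite := by
  have : T.below β A ⊆ ⋃ a ∈ A, {y | y ∈ T.level β ∧ T.Le y a} := by
    rintro y ⟨hy, a, ha, h⟩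
    exact Set.mem_biUnion ha ⟨hy, h⟩
  refine (hA.biUnion fun a ha => Set.Subsingleton.finite ?_).subset this
  rintro y ⟨hy, hya⟩ z ⟨hz, hza⟩
  exact hT.eq_of_level_eq (hc a ha) hy hz hya hza

theorem branching_mono {A B : Set ZFSet.{u}} (h : A ⊆ B) (z : ZFSet.{u}) :
    T.branching A z ⊆ T.branching B z := fun _ hy => ⟨hy.1, hy.2.imp fun _ ha => ⟨h ha.1, ha.2⟩⟩

theorem branching_union {A B : Set ZFSet.{u}} (z : ZFSet.{u}) :
    T.branching (A ∪ B) z = T.branching A z ∪ T.branching B z := by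
  ext y
  constructor
  · rintro ⟨hy, a, ha | ha, h⟩
    · exact Or.inl ⟨hy, a, ha, h⟩
    · exact Or.inr ⟨hy, a, ha, h⟩
  · rintro (h | h)
    · exact branching_mono Set.subset_union_left z h
    · exact branching_mono Set.subset_union_right z h

/-- If the members of `V` have distinct restrictions to level `β`, which are different from those
of the members of `A`, then above level `β` the addition of `V` to `A` creates no new branching. -/
theorem IsTree.encard_branching_union_le (hT : T.IsTree) {β ζ : Ordinal.{u}}
    {A V : Set ZFSet.{u}} (hV : ∀ a ∈ V, a ∈ T.carrier)
    (hdisj : ∀ w ∈ T.below β V, w ∉ T.below β A)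
    (hinj : ∀ v ∈ V, ∀ v' ∈ V, ∀ w ∈ T.level β, T.Le w v → T.Le w v' → v = v')
    {z : ZFSet.{u}} (hz : z ∈ T.level ζ) (hβ : β ≤ ζ) {k : ℕ∞} (hk : 1 ≤ k)
    (h : (T.branching A z).encard ≤ k) : (T.branching (A ∪ V) z).encard ≤ k := by
  rw [branching_union]
  rcases (T.branching V z).eq_empty_or_nonempty with he | ⟨y, hy, v, hv, hyv⟩
  · rwa [he, Set.union_empty]
  -- The restriction `w` of `z` is below a member of `V`, so no member of `A` passes through `z`;
  -- and by injectivity `v` is the only member of `V` that does. This leaves at most one successor.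
  obtain ⟨w, hw, hwz⟩ := hT.exists_level_le hz hβ
  have hzv : T.Lt z v := hT.lt_of_lt_of_le hy.1 hyv
  have hwv : T.Le w v := hT.le_trans hwz hzv.le
  have hA' : T.branching A z = ∅ := by
    rw [Set.eq_empty_iff_forall_notMem]
    rintro y' ⟨hy', a, ha, hya⟩
    exact hdisj w ⟨hw, v, hv, hwv⟩
      ⟨hw, a, ha, hT.le_trans hwz (hT.lt_of_lt_of_le hy'.1 hya).le⟩
  rw [hA', Set.empty_union]
  refine _root_.le_trans (Set.encard_le_one_iff.2 ?_) hk
  rintro a b ⟨ha, v₁, hv₁, hav⟩ ⟨hb, v₂, hv₂, hbv⟩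
  have e₁ := hinj v hv v₁ hv₁ w hw hwv (hT.le_trans hwz (hT.lt_of_lt_of_le ha.1 hav).le)
  have e₂ := hinj v hv v₂ hv₂ w hw hwv (hT.le_trans hwz (hT.lt_of_lt_of_le hb.1 hbv).le)
  subst e₁
  subst e₂
  exact hT.eq_of_level_eq (hV v hv) ((hT.mem_imm_iff hz).1 ha).1 ((hT.mem_imm_iff hz).1 hb).1
    hav hbv

end SetTree

/-- If `F` fulfills a promise, then a tuple of a member of the promise at a higher level can be
found above elements with value `1` which avoid a given finite set. -/
theorem exists_tuple_above {T : SetTree.{u}} (hT : T.IsTree) {F U V Y : ZFSet.{u}} {m : ℕ}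
    {β γ γ₀ : Ordinal.{u}} (hU : IsGenPromise T m γ₀ U) (hβ : γ₀ ≤ β) (hF : Fulfills T F β m U)
    (hβγ : β < γ) (hV : ZFSet.pair γ.toZFSet V ∈ U) (hY : Y ∈ V) {s : Set ZFSet.{u}}
    (hs : s.Finite) (hsl : ∀ z ∈ s, z ∈ T.level β) :
    ∃ v w : Fin m → ZFSet.{u}, tuple v ∈ Y ∧ (∀ i, v i ∈ T.level γ) ∧
      (∀ i, w i ∈ T.level β ∧ T.Le (w i) (v i) ∧ IsOne F (w i) ∧ w i ∉ s) ∧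
      Function.Injective w := by
  have hγ : γ < ω₁ := by
    obtain ⟨δ, W, -, h, e⟩ := hU.mem_pair _ hV
    rw [Ordinal.toZFSet_injective (ZFSet.pair_inj.1 e).1]
    exact h
  obtain ⟨W, hW, -⟩ := hU.existsUnique β hβ (hβγ.trans hγ)
  -- Fulfilment concerns only the top level `β`, so it is applied to the restriction `Z` of `Y`; the
  -- tuple `w` obtained in `Z` is then the restriction of some `v` in `Y`. Its entries are distinct
  -- because they lie above distinct elements of one level.
  obtain ⟨Z, hZ, hZY⟩ := hU.restr β γ W V hβγ hW hV Y hY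
  obtain ⟨w, hw, hw'⟩ := hF hs.toFinset (fun z hz => hsl z (hs.mem_toFinset.1 hz)) W hW Z hZ
  obtain ⟨v, w', hv, e, hvw⟩ := (hZY _).1 hw
  obtain rfl := tuple_injective e
  obtain ⟨x, hx, ⟨α, hα⟩, hder⟩ := hU.derived
  obtain ⟨v', e', hv'⟩ := (hder γ V hV Y hY).2.2 _ hv
  obtain rfl := tuple_injective e'
  obtain ⟨w'', e'', hw''⟩ := (hder β W hW Z hZ).2.2 _ hw
  obtain rfl := tuple_injective e''
  refine ⟨v, w, hv, fun i => (hv' i).1, fun i => ⟨(hvw i).1, (hvw i).2, (hw' i).2, ?_⟩, ?_⟩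
  · intro h
    exact (hw' i).1 (hs.mem_toFinset.2 h)
  · intro i j hij
    refine hx (hT.eq_of_level_eq (hvw i).1.1 (hα i) (hα j) (hw'' i).2 ?_)
    rw [hij]
    exact (hw'' j).2

end SplitTree

/-! ### Extending a condition to a higher top level -/

namespace SplitTree

variable {T : SetTree.{u}} {S : Set ℕ}

namespace SetTree

/-- One can add finitely many elements to `A` so that the number of immediate successors of `z`
below members of `A` becomes `k`, without creating any other branching. -/
theorem exists_fill_branching (hTS : IsSuitable T S) {β γ ζ : Ordinal.{u}} (hγ : γ < ω₁)
    {A : Set ZFSet.{u}} (κ : ZFSet.{u} → ℕ)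
    (hκ : ∀ z, κ z ∈ S)
    (hAκ : ∀ z ξ, z ∈ T.level ξ → β ≤ ξ → ξ < γ → (T.branching A z).encard ≤ κ z)
    {z : ZFSet.{u}} (hz : z ∈ T.level ζ) (hβζ : β ≤ ζ) (hζγ : ζ < γ)
    (hzA : ∃ a ∈ A, T.Lt z a) :
    ∃ V : Set ZFSet.{u}, V.Finite ∧ (∀ v ∈ V, v ∈ T.level γ) ∧ T.below β V ⊆ T.below β A ∧
      (∀ y ξ, y ∈ T.level ξ → β ≤ ξ → ξ < γ → (T.branching (A ∪ V) y).encard ≤ κ y) ∧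
      (T.branching (A ∪ V) z).encard = κ z := by
  have hT := hTS.isTree
  -- `I` is the final set of successors of `z`: it contains those already below `A` and has exactly
  -- `κ z` members. `V` will have one element above each missing successor.
  obtain ⟨I, hI₁, hI₂, hI⟩ := Set.exists_superset_subset_encard_eq
    (show T.branching A z ⊆ T.imm z from fun y hy => hy.1) (hAκ z ζ hz hβζ hζγ)
    (hTS.le_imm z hz.1 (κ z) (hκ z))
  have hIl : ∀ y ∈ I, y ∈ T.level (ζ + 1) ∧ T.Lt z y := fun y hy =>
    (hT.mem_imm_iff hz).1 (hI₂ hy)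
  have hIfin : I.Finite := Set.finite_of_encard_eq_coe hI
  have hab : ∀ y ∈ I, ∃ v ∈ T.level γ, T.Le y v := fun y hy =>
    hTS.normal.exists_above hTS.isOmega1Tree (hIl y hy).1 (Order.add_one_le_of_lt hζγ) hγ
  choose! e he hye using hab
  set V : Set ZFSet.{u} := e '' (I \ T.branching A z) with hV
  have hVl : ∀ v ∈ V, v ∈ T.level γ := by
    rintro _ ⟨y, hy, rfl⟩
    exact he y hy.1
  obtain ⟨a₀, ha₀, hza₀⟩ := hzA
  -- Up to the level of `z`, the new elements follow the path to `z`, hence to `a₀`. So they add no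
  -- restriction to level `β` and no branching strictly below `z`.
  have hlow : ∀ x ξ, x ∈ T.level ξ → ξ ≤ ζ → ∀ v ∈ V, T.Le x v → T.Le x z := by
    rintro x ξ hx hξ _ ⟨y, hy, rfl⟩ hxv
    exact hT.le_of_level_le (he y hy.1).1 hx hz hxv
      (hT.le_trans (hIl y hy.1).2.le (hye y hy.1)) hξ
  have hbz : T.branching (A ∪ V) z = I := by
    rw [branching_union]
    apply Set.Subset.antisymm
    · rintro y (hy | ⟨hy, _, ⟨y', hy', rfl⟩, hyv⟩)
      · exact hI₁ hy
      · rw [hT.eq_of_level_eq (he y' hy'.1).1 ((hT.mem_imm_iff hz).1 hy).1 (hIl y' hy'.1).1 hyv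
          (hye y' hy'.1)]
        exact hy'.1
    · intro y hy
      by_cases h : y ∈ T.branching A z
      · exact Or.inl h
      · exact Or.inr ⟨hI₂ hy, e y, ⟨y, ⟨hy, h⟩, rfl⟩, hye y hy⟩
  refine ⟨V, (hIfin.subset Set.sdiff_subset).image e, hVl, ?_, ?_, by rw [hbz, hI]⟩
  · rintro x ⟨hx, v, hv, hxv⟩
    exact ⟨hx, a₀, ha₀, hT.le_trans (hlow x β hx hβζ v hv hxv) hza₀.le⟩
  · intro y ξ hy hβξ hξγ
    rcases lt_or_ge ζ ξ with h | h
    -- Above `z` the separation level is `ζ + 1`: there the members of `V` restrict to distinct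
    -- missing successors, none of them below `A`.
    · refine hT.encard_branching_union_le (β := ζ + 1) (fun v hv => (hVl v hv).1) ?_ ?_ hy
        (Order.add_one_le_of_lt h) ?_ (hAκ y ξ hy hβξ hξγ)
      · rintro w ⟨hw, _, ⟨y', hy', rfl⟩, hwv⟩ hw'
        have := hT.eq_of_level_eq (he y' hy'.1).1 hw (hIl y' hy'.1).1 hwv (hye y' hy'.1)
        subst this
        exact hy'.2 ⟨hI₂ hy'.1, hw'.2⟩
      · rintro _ ⟨y₁, hy₁, rfl⟩ _ ⟨y₂, hy₂, rfl⟩ w hw h₁ h₂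
        rw [← hT.eq_of_level_eq (he y₁ hy₁.1).1 hw (hIl y₁ hy₁.1).1 h₁ (hye y₁ hy₁.1),
          ← hT.eq_of_level_eq (he y₂ hy₂.1).1 hw (hIl y₂ hy₂.1).1 h₂ (hye y₂ hy₂.1)]
      · have := hTS.two_le _ (hκ y)
        exact_mod_cast (show 1 ≤ κ y by omega)
    · rcases h.eq_or_lt with rfl | h
      · obtain rfl | hne := eq_or_ne y z
        · rw [hbz, hI]
        · refine _root_.le_trans (Set.encard_le_encard ?_) (hAκ y ξ hy hβξ hξγ)
          rintro x ⟨hx, a, ha | ha, hxa⟩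
          · exact ⟨hx, a, ha, hxa⟩
          · exfalso
            have h1 := hlow y ξ hy le_rfl a ha (hT.lt_of_lt_of_le hx.1 hxa).le
            exact hne (hT.eq_of_level_eq hz.1 hy hz h1 (Or.inl rfl))
      · refine _root_.le_trans (Set.encard_le_encard ?_) (hAκ y ξ hy hβξ hξγ)
        rintro x ⟨hx, a, ha | ha, hxa⟩
        · exact ⟨hx, a, ha, hxa⟩
        · refine ⟨hx, a₀, ha₀, hT.le_trans ?_ hza₀.le⟩
          exact hlow x (ξ + 1) ((hT.mem_imm_iff hy).1 hx).1 (Order.add_one_le_of_lt h) a ha hxa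

end SetTree

/-- Every condition can be extended to a condition with a given top level and the same promises
which takes the value `1` at the members of a given subset `C` of the new top level, provided
that `C` has finitely many restrictions to the old top level, all with value `1`, and that the
branching of `C` is compatible with `S`. -/
theorem IsCond.exists_extension (hTS : IsSuitable T S) {F Γ : ZFSet.{u}} {β γ : Ordinal.{u}}
    (hp : IsCond T S F Γ β) (hβγ : β < γ) (hγ : γ < ω₁) {C : Set ZFSet.{u}}
    (hC : ∀ c ∈ C, c ∈ T.level γ) (hfin : (T.below β C).Finite)
    (hone : ∀ y ∈ T.below β C, IsOne F y)
    (hadm : ∀ z ξ, z ∈ T.level ξ → β ≤ ξ → ξ < γ → ∃ k ∈ S, (T.branching C z).encard ≤ k) :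
    ∃ G, IsCond T S G Γ γ ∧ F ⊆ G ∧ ∀ c ∈ C, IsOne G c := by
  have hT := hTS.isTree
  have hF := hp.isSubtreeFun
  obtain ⟨k₀, hk₀⟩ := hTS.nonempty
  -- The final number of successors `κ z` is fixed in advance. The growing set never branches beyond
  -- `κ`, and one kind of task raises the branching at `z` to exactly `κ z`.
  have hκ' : ∀ z, ∃ k ∈ S, ∀ ξ, z ∈ T.level ξ → β ≤ ξ → ξ < γ →
      (T.branching C z).encard ≤ k := by
    intro z
    by_cases h : ∃ ξ, z ∈ T.level ξ ∧ β ≤ ξ ∧ ξ < γ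
    · obtain ⟨ξ, h1, h2, h3⟩ := h
      obtain ⟨k, hk, hk'⟩ := hadm z ξ h1 h2 h3
      exact ⟨k, hk, fun _ _ _ _ => hk'⟩
    · push Not at h
      exact ⟨k₀, hk₀, fun ξ h1 h2 h3 => absurd h3 (not_lt.2 (h ξ h1 h2))⟩
  choose κ hκ hCκ using hκ'
  -- the invariant of the construction
  let P : Set ZFSet.{u} → Prop := fun A => (∀ a ∈ A, a ∈ T.level γ) ∧ (T.below β A).Finite ∧
    (∀ y ∈ T.below β A, IsOne F y) ∧
    ∀ z ξ, z ∈ T.level ξ → β ≤ ξ → ξ < γ → (T.branching A z).encard ≤ κ z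
  -- Finitely many new elements are harmless if their restrictions to level `β` are distinct, have
  -- value 1 and are not yet used.
  have hadd : ∀ A V : Set ZFSet.{u}, P A → V.Finite → (∀ v ∈ V, v ∈ T.level γ) →
      (∀ w ∈ T.below β V, w ∉ T.below β A ∧ IsOne F w) →
      (∀ v ∈ V, ∀ v' ∈ V, ∀ w ∈ T.level β, T.Le w v → T.Le w v' → v = v') → P (A ∪ V) := by
    rintro A V ⟨h1, h2, h3, h4⟩ hV hVl hw hinj
    refine ⟨?_, ?_, ?_, ?_⟩
    · rintro a (ha | ha)
      · exact h1 a ha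
      · exact hVl a ha
    · rw [SetTree.below_union]
      exact h2.union (hT.finite_below (fun v hv => (hVl v hv).1) hV)
    · rw [SetTree.below_union]
      rintro y (hy | hy)
      · exact h3 y hy
      · exact (hw y hy).2
    · intro z ξ hz hβξ hξγ
      refine hT.encard_branching_union_le (fun v hv => (hVl v hv).1) (fun w h => (hw w h).1) hinj
        hz hβξ ?_ (h4 z ξ hz hβξ hξγ)
      have := hTS.two_le _ (hκ z)
      exact_mod_cast (show 1 ≤ κ z by omega)
  -- the tasks
  let 𝒴 : Set ZFSet.{u} := {Y | ∃ U ∈ Γ, ∃ m γ₀, γ₀ ≤ β ∧ IsGenPromise T m γ₀ U ∧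
    ∃ V, ZFSet.pair γ.toZFSet V ∈ U ∧ Y ∈ V}
  have h𝒴 : 𝒴.Countable := by
    have : 𝒴 ⊆ ⋃ U ∈ (Γ : Set ZFSet.{u}), {Y | ∃ m γ₀, γ₀ ≤ β ∧ IsGenPromise T m γ₀ U ∧
        ∃ V, ZFSet.pair γ.toZFSet V ∈ U ∧ Y ∈ V} := by
      rintro Y ⟨U, hU, h⟩
      exact Set.mem_biUnion (show U ∈ (Γ : Set ZFSet.{u}) from hU) h
    refine (Set.Countable.biUnion hp.countable fun U hU => ?_).mono this
    by_cases h : ∃ m γ₀, γ₀ ≤ β ∧ IsGenPromise T m γ₀ U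
    · obtain ⟨m, γ₀, hγ₀, hU⟩ := h
      obtain ⟨V, hV, hV'⟩ := hU.existsUnique γ (hγ₀.trans hβγ.le) hγ
      refine (hU.countable _ _ hV).mono ?_
      rintro Y ⟨-, -, -, -, V', h1, h2⟩
      rwa [hV' V' h1] at h2
    · convert Set.countable_empty
      rw [Set.eq_empty_iff_forall_notMem]
      rintro Y ⟨m, γ₀, h1, h2, -⟩
      exact h ⟨m, γ₀, h1, h2⟩
  have := h𝒴.to_subtype
  have := (hTS.isOmega1Tree.level_countable γ).to_subtype
  have : Countable (T.upTo γ) := (hTS.isOmega1Tree.countable_upTo hγ).to_subtype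
  have : Countable {U : ZFSet.{u} // U ∈ Γ} := hp.countable.to_subtype
  -- There are three kinds of tasks: complete the branching at an element, reach above an element of
  -- level `β` with value 1, and realize a tuple of `Y` outside `t`. The number `m` is part of the
  -- task, since a promise does not display its dimension.
  let ι := (T.upTo γ ⊕ T.upTo γ) ⊕ (ℕ × {U : ZFSet.{u} // U ∈ Γ} × 𝒴 × Finset (T.level γ))
  let R : ι → Set ZFSet.{u} → Set ZFSet.{u} → Prop := fun i A A' => match i with
    | Sum.inl (Sum.inl z) => ∀ ξ, z.1 ∈ T.level ξ → β ≤ ξ → ξ < γ → (∃ a ∈ A, T.Lt z.1 a) →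
        (T.branching A' z.1).encard = κ z.1
    | Sum.inl (Sum.inr x) => x.1 ∈ T.level β → IsOne F x.1 → ∃ a ∈ A', T.Lt x.1 a
    | Sum.inr (m, U, Y, t) => (∃ γ₀ ≤ β, IsGenPromise T m γ₀ U.1) → Fulfills T F β m U.1 →
        (∃ V, ZFSet.pair γ.toZFSet V ∈ U.1 ∧ Y.1 ∈ V) →
        ∃ v : Fin m → ZFSet.{u}, tuple v ∈ Y.1 ∧ ∀ i, (∀ z ∈ t, v i ≠ z.1) ∧ v i ∈ A'
  obtain ⟨A, hA0, hAP, hAmono, hAR⟩ := exists_seq_forall_exists_ge P (fun A A' => A ⊆ A')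
    (fun _ => subset_rfl) (fun _ _ _ => Set.Subset.trans) R C
    ⟨hC, hfin, hone, fun z ξ hz h1 h2 => hCκ z ξ hz h1 h2⟩ (by
      rintro ((z | x) | ⟨m, U, Y, t⟩) A hA
      · by_cases h : ∃ ξ, z.1 ∈ T.level ξ ∧ β ≤ ξ ∧ ξ < γ ∧ (∃ a ∈ A, T.Lt z.1 a)
        · obtain ⟨ξ, h1, h2, h3, h4⟩ := h
          obtain ⟨V, hVf, hVl, hVb, hV1, hV2⟩ := SetTree.exists_fill_branching hTS hγ κ hκ
            hA.2.2.2 h1 h2 h3 h4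
          refine ⟨A ∪ V, ⟨?_, ?_, ?_, hV1⟩, Set.subset_union_left, fun _ _ _ _ _ => hV2⟩
          · rintro a (ha | ha)
            · exact hA.1 a ha
            · exact hVl a ha
          · rw [SetTree.below_union, Set.union_eq_left.2 hVb]
            exact hA.2.1
          · rw [SetTree.below_union, Set.union_eq_left.2 hVb]
            exact hA.2.2.1
        · exact ⟨A, hA, subset_rfl, fun ξ h1 h2 h3 h4 => absurd ⟨ξ, h1, h2, h3, h4⟩ h⟩
      · by_cases h : x.1 ∈ T.level β ∧ IsOne F x.1 ∧ x.1 ∉ T.below β A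
        · obtain ⟨h1, h2, h3⟩ := h
          obtain ⟨y, hy, hxy⟩ := hTS.normal.exists_above hTS.isOmega1Tree h1 hβγ.le hγ
          refine ⟨A ∪ {y}, hadd A {y} hA (Set.finite_singleton y) ?_ ?_ ?_,
            Set.subset_union_left, fun _ _ => ⟨y, Or.inr rfl, ?_⟩⟩
          · rintro _ rfl
            exact hy
          · rintro w ⟨hw, _, rfl, hwy⟩
            obtain rfl := hT.eq_of_level_eq hy.1 hw h1 hwy hxy
            exact ⟨h3, h2⟩
          · rintro _ rfl _ rfl _ _ _ _
            rfl
          · exact hT.lt_of_level_lt hy.1 h1 hy hxy (Or.inl rfl) hβγ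
        · refine ⟨A, hA, subset_rfl, fun h1 h2 => ?_⟩
          by_contra hcon
          refine h ⟨h1, h2, fun h3 => hcon ?_⟩
          obtain ⟨-, a, ha, hxa⟩ := h3
          exact ⟨a, ha, hT.lt_of_level_lt (hA.1 a ha).1 h1 (hA.1 a ha) hxa (Or.inl rfl) hβγ⟩
      · by_cases h : (∃ γ₀ ≤ β, IsGenPromise T m γ₀ U.1) ∧ Fulfills T F β m U.1 ∧
          (∃ V, ZFSet.pair γ.toZFSet V ∈ U.1 ∧ Y.1 ∈ V)
        · obtain ⟨⟨γ₀, hγ₀, hU⟩, hFU, V, hV, hY⟩ := h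
          -- Avoiding the restrictions of `A` to level `β` keeps the branching under control;
          -- avoiding those of `t` keeps the tuple itself out of `t`.
          obtain ⟨v, w, hv, hvl, hw, hwinj⟩ := exists_tuple_above hT hU hγ₀ hFU hβγ hV hY
            (s := T.below β A ∪ T.below β (Subtype.val '' (t : Set (T.level γ))))
            (hA.2.1.union (hT.finite_below (by rintro _ ⟨z, -, rfl⟩; exact z.2.1)
              (t.finite_toSet.image _)))
            (by rintro z (hz | hz) <;> exact hz.1)
          have huniq : ∀ i, ∀ x ∈ T.level β, T.Le x (v i) → x = w i := fun i x hx hxv =>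
            hT.eq_of_level_eq (hvl i).1 hx (hw i).1 hxv (hw i).2.1
          refine ⟨A ∪ Set.range v, hadd A _ hA (Set.finite_range v) ?_ ?_ ?_,
            Set.subset_union_left, fun _ _ _ => ⟨v, hv, fun i => ⟨?_, Or.inr ⟨i, rfl⟩⟩⟩⟩
          · rintro _ ⟨i, rfl⟩
            exact hvl i
          · rintro x ⟨hx, _, ⟨i, rfl⟩, hxv⟩
            rw [huniq i x hx hxv]
            exact ⟨fun h => (hw i).2.2.2 (Or.inl h), (hw i).2.2.1⟩
          · rintro _ ⟨i, rfl⟩ _ ⟨j, rfl⟩ x hx hxi hxj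
            rw [hwinj ((huniq i x hx hxi).symm.trans (huniq j x hx hxj))]
          · intro z hz hvz
            refine (hw i).2.2.2 (Or.inr ⟨(hw i).1, z.1, ⟨z, hz, rfl⟩, ?_⟩)
            rw [← hvz]
            exact (hw i).2.1
        · exact ⟨A, hA, subset_rfl, fun h1 h2 h3 => absurd ⟨h1, h2, h3⟩ h⟩)
  -- the resulting function
  let W : Set ZFSet.{u} := {x | IsOne F x ∨ ∃ n, ∃ a ∈ A n, T.Le x a}
  have hAl : ∀ n, ∀ a ∈ A n, a ∈ T.level γ := fun n => (hAP n).1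
  have hWF : ∀ x ∈ T.upTo β, IsOne F x ↔ x ∈ W := by
    refine fun x hx => ⟨Or.inl, ?_⟩
    rintro (h | ⟨n, a, ha, hxa⟩)
    · exact h
    obtain ⟨-, α, hα, hxα⟩ := ZFSet.mem_sep.1 hx
    obtain ⟨y, hy, hya⟩ := hT.exists_level_le (hAl n a ha) hβγ.le
    have h1 : IsOne F y := (hAP n).2.2.1 y ⟨hy, a, ha, hya⟩
    rcases hT.le_of_level_le (hAl n a ha).1 hxα hy hxa hya hα with rfl | h2
    · exact h1
    · exact hF.downward _ _ h2 h1
  have hFG : F ⊆ mkFun T γ W := subset_mkFun hp.isFunc hβγ.le hWF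
  have hFup : ∀ x, IsOne F x → x ∈ T.upTo β := fun x hx => hx.mem_of_isFunc hp.isFunc
  have hreach : ∀ x, x ∈ T.level β → IsOne F x → ∃ n, ∃ a ∈ A n, T.Lt x a := by
    intro x hx hFx
    obtain ⟨n, -, hn⟩ := hAR (Sum.inl (Sum.inr ⟨x, (SetTree.mem_upTo hx).2 hβγ.le⟩)) 0
    exact ⟨n + 1, hn hx hFx⟩
  refine ⟨mkFun T γ W, ⟨⟨⟨hγ, isFunc_mkFun γ W, ?_, ?_, ?_⟩, ?_⟩, hp.countable, ?_⟩, hFG, ?_⟩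
  · intro x hx
    exact hFG (hF.root x hx)
  · intro x y hyx hx
    obtain ⟨hx, hxW⟩ := isOne_mkFun.1 hx
    obtain ⟨-, α, hα, hxα⟩ := ZFSet.mem_sep.1 hx
    obtain ⟨ξ, hξ, hyξ⟩ := hT.exists_level_of_lt hxα hyx
    refine isOne_mkFun.2 ⟨(SetTree.mem_upTo hyξ).2 (hξ.le.trans hα), ?_⟩
    rcases hxW with h | ⟨n, a, ha, h⟩
    · exact Or.inl (hF.downward _ _ hyx h)
    · exact Or.inr ⟨n, a, ha, hT.le_trans hyx.le h⟩
  · intro α hα x hx hxW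
    have key : ∃ n, ∃ a ∈ A n, T.Le x a := by
      rcases (isOne_mkFun.1 hxW).2 with h | h
      · rcases ((SetTree.mem_upTo hx).1 (hFup x h)).eq_or_lt with rfl | hlt
        · obtain ⟨n, a, ha, h'⟩ := hreach x hx h
          exact ⟨n, a, ha, h'.le⟩
        · obtain ⟨y, hy, hxy, hFy⟩ := hF.extend α hlt x hx h
          obtain ⟨n, a, ha, h'⟩ := hreach y hy hFy
          exact ⟨n, a, ha, (hT.trans _ _ _ hxy h').le⟩
      · exact h
    obtain ⟨n, a, ha, hxa⟩ := key
    exact ⟨a, hAl n a ha, hT.lt_of_level_lt (hAl n a ha).1 hx (hAl n a ha) hxa (Or.inl rfl) hα,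
      isOne_mkFun.2 ⟨(SetTree.mem_upTo (hAl n a ha)).2 le_rfl, Or.inr ⟨n, a, ha, Or.inl rfl⟩⟩⟩
  · intro α hα x hx hxW
    rcases lt_or_ge α β with hαβ | hαβ
    · have hxF : IsOne F x := (hWF x ((SetTree.mem_upTo hx).2 hαβ.le)).2 (isOne_mkFun.1 hxW).2
      obtain ⟨k, hk, hk'⟩ := hp.isSplittingFun.splitting α hαβ x hx hxF
      refine ⟨k, hk, ?_⟩
      rw [← hk']
      congr 1
      ext y
      refine and_congr_right fun hy => ?_
      exact (isOne_iff_of_subset hp.isFunc (isFunc_mkFun γ W) hFG ((SetTree.mem_upTo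
        ((hT.mem_imm_iff hx).1 hy).1).2 (Order.add_one_le_of_lt hαβ))).symm
    · have key : ∃ n, ∃ a ∈ A n, T.Lt x a := by
        rcases (isOne_mkFun.1 hxW).2 with h | ⟨n, a, ha, h⟩
        · obtain rfl := le_antisymm hαβ ((SetTree.mem_upTo hx).1 (hFup x h))
          exact hreach x hx h
        · exact ⟨n, a, ha, hT.lt_of_level_lt (hAl n a ha).1 hx (hAl n a ha) h (Or.inl rfl) hα⟩
      obtain ⟨n, a, ha, hxa⟩ := key
      obtain ⟨N, hnN, hN⟩ := hAR (Sum.inl (Sum.inl ⟨x, (SetTree.mem_upTo hx).2 hα.le⟩)) n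
      have hN : (T.branching (A (N + 1)) x).encard = κ x :=
        hN α hx hαβ hα ⟨a, hAmono n N hnN ha, hxa⟩
      refine ⟨κ x, hκ x, ?_⟩
      rw [← hN]
      congr 1
      ext y
      constructor
      · rintro ⟨hy, hyW⟩
        have hyl := ((hT.mem_imm_iff hx).1 hy).1
        rcases (isOne_mkFun.1 hyW).2 with h | ⟨M, b, hb, hyb⟩
        · exact absurd ((SetTree.mem_upTo hyl).1 (hFup y h))
            (not_le.2 (Order.lt_add_one_iff.2 hαβ))
        · have hsub : T.branching (A (N + 1)) x ⊆ T.branching (A (max M (N + 1))) x :=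
            SetTree.branching_mono (hAmono _ _ (le_max_right _ _)) x
          -- From stage `N + 1` on, the branching at `x` has its maximal size `κ x`, so an
          -- increasing finite set of successors can no longer grow.
          have heq := (Set.finite_of_encard_eq_coe hN).eq_of_subset_of_encard_le hsub
            (by rw [hN]; exact (hAP _).2.2.2 x α hx hαβ hα)
          rw [heq]
          exact ⟨hy, b, hAmono _ _ (le_max_left _ _) hb, hyb⟩
      · rintro ⟨hy, b, hb, hyb⟩
        have hyl := ((hT.mem_imm_iff hx).1 hy).1
        exact ⟨hy, isOne_mkFun.2 ⟨(SetTree.mem_upTo hyl).2 (Order.add_one_le_of_lt hα),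
          Or.inr ⟨N + 1, b, hb, hyb⟩⟩⟩
  · intro U hU
    obtain ⟨m, γ₀, hγ₀, hUP, hFU⟩ := hp.fulfills U hU
    refine ⟨m, γ₀, hγ₀.trans hβγ.le, hUP, fun t ht V hV Y hY => ?_⟩
    classical
    obtain ⟨n, -, hn⟩ := hAR (Sum.inr (m, ⟨U, hU⟩, ⟨Y, U, hU, m, γ₀, hγ₀, hUP, V, hV, hY⟩,
      t.subtype (· ∈ T.level γ))) 0
    obtain ⟨v, hv, hv'⟩ := hn ⟨γ₀, hγ₀, hUP⟩ hFU ⟨V, hV, hY⟩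
    refine ⟨v, hv, fun i => ⟨fun hvt => ?_, ?_⟩⟩
    · exact (hv' i).1 ⟨v i, ht _ hvt⟩ (Finset.mem_subtype.2 hvt) rfl
    · exact isOne_mkFun.2 ⟨(SetTree.mem_upTo (hAl _ _ (hv' i).2)).2 le_rfl,
        Or.inr ⟨n + 1, v i, (hv' i).2, Or.inl rfl⟩⟩
  · intro c hc
    refine isOne_mkFun.2 ⟨(SetTree.mem_upTo (hC c hc)).2 le_rfl, Or.inr ⟨0, c, ?_, Or.inl rfl⟩⟩
    rw [hA0]
    exact hc

end SplitTree

/-! ### Trees of tuples and the promises they generate -/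

namespace SplitTree

variable {T : SetTree.{u}} {S : Set ℕ}

theorem exists_bound_lt_omega_one {α : Type*} [Countable α] (f : α → Ordinal.{u})
    (hf : ∀ a, f a < ω₁) : ∃ θ < ω₁, ∀ a, f a ≤ θ :=
  ⟨iSup f, Ordinal.iSup_lt_omega_one hf, fun a => Ordinal.le_iSup f a⟩

theorem SetTree.IsOmega1Tree.countable_tuples (hT : T.IsOmega1Tree) (m : ℕ) (η : Ordinal.{u}) :
    {v : Fin m → ZFSet.{u} | ∀ i, v i ∈ T.level η}.Countable :=
  Set.countable_pi fun _ => hT.level_countable η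

/-- `B` is a family of tuples, one nonempty set of tuples for each level from `η₀` on, which is
closed under restrictions and consists of tuples above `x`. -/
structure IsTupleTree (T : SetTree.{u}) {m : ℕ} (x : Fin m → ZFSet.{u}) (η₀ : Ordinal.{u})
    (B : Ordinal.{u} → Set (Fin m → ZFSet.{u})) : Prop where
  inj : Function.Injective x
  base : ∀ i, x i ∈ T.level η₀
  mem : ∀ η, ∀ v ∈ B η, ∀ i, v i ∈ T.level η ∧ T.Le (x i) (v i)
  restr : ∀ ζ η, η₀ ≤ ζ → ζ ≤ η → ∀ v ∈ B η, ∀ w : Fin m → ZFSet.{u},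
    (∀ i, w i ∈ T.level ζ ∧ T.Le (w i) (v i)) → w ∈ B ζ
  nonempty : ∀ η, η₀ ≤ η → η < ω₁ → (B η).Nonempty

/-- A tuple tree in which each member has extensions in all higher levels. -/
structure IsFullTupleTree (T : SetTree.{u}) {m : ℕ} (x : Fin m → ZFSet.{u}) (η₀ : Ordinal.{u})
    (B : Ordinal.{u} → Set (Fin m → ZFSet.{u})) : Prop extends IsTupleTree T x η₀ B where
  extend : ∀ η η', η₀ ≤ η → η ≤ η' → η' < ω₁ → ∀ v ∈ B η, ∃ w ∈ B η', ∀ i, T.Le (v i) (w i)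

theorem SetTree.IsTree.exists_tuple_restr (hT : T.IsTree) {m : ℕ} {ζ η : Ordinal.{u}}
    (h : ζ ≤ η) {v : Fin m → ZFSet.{u}} (hv : ∀ i, v i ∈ T.level η) :
    ∃ w : Fin m → ZFSet.{u}, ∀ i, w i ∈ T.level ζ ∧ T.Le (w i) (v i) := by
  choose w hw using fun i => hT.exists_level_le (hv i) h
  exact ⟨w, hw⟩

/-- Every tuple tree includes a full tuple tree. -/
theorem IsTupleTree.exists_full (hT : T.IsOmega1Tree) {m : ℕ} {x : Fin m → ZFSet.{u}}
    {η₀ : Ordinal.{u}} {B : Ordinal.{u} → Set (Fin m → ZFSet.{u})} (hη₀ : η₀ < ω₁)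
    (hB : IsTupleTree T x η₀ B) :
    ∃ B' : Ordinal.{u} → Set (Fin m → ZFSet.{u}), IsFullTupleTree T x η₀ B' ∧
      ∀ η, B' η ⊆ B η := by
  have hT' := hT.isTree
  let B' : Ordinal.{u} → Set (Fin m → ZFSet.{u}) := fun η =>
    {v | v ∈ B η ∧ ∀ η', η ≤ η' → η' < ω₁ → ∃ w ∈ B η', ∀ i, T.Le (v i) (w i)}
  have hext : ∀ η η', η₀ ≤ η → η ≤ η' → η' < ω₁ → ∀ v ∈ B' η,
      ∃ w ∈ B' η', ∀ i, T.Le (v i) (w i) := by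
    intro η η' h0 hηη' hη' v hv
    by_contra! hcon
    -- If no extension of `v` on level `η'` survives, each of the countably many candidates `w` dies
    -- at some countable level. A member of `B` above `v` beyond all these levels restricts to a
    -- candidate that has not died.
    have hbad : ∀ w : {w : Fin m → ZFSet.{u} // ∀ i, w i ∈ T.level η'}, ∃ θ < ω₁, η' ≤ θ ∧
        (w.1 ∈ B η' → (∀ i, T.Le (v i) (w.1 i)) → ∀ u ∈ B θ, ∃ i, ¬ T.Le (w.1 i) (u i)) := by
      intro w
      by_cases hw : w.1 ∈ B η' ∧ ∀ i, T.Le (v i) (w.1 i)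
      · have h1 : w.1 ∉ B' η' := fun h => by
          obtain ⟨i, hi⟩ := hcon w.1 h
          exact hi (hw.2 i)
        have h2 : ¬ ∀ η'', η' ≤ η'' → η'' < ω₁ → ∃ u ∈ B η'', ∀ i, T.Le (w.1 i) (u i) :=
          fun h => h1 ⟨hw.1, h⟩
        push Not at h2
        obtain ⟨θ, h3, h4, h5⟩ := h2
        exact ⟨θ, h4, h3, fun _ _ => h5⟩
      · exact ⟨η', hη', le_rfl, fun h1 h2 => absurd ⟨h1, h2⟩ hw⟩
    choose f hf hf' hfB using hbad
    have : Countable {w : Fin m → ZFSet.{u} // ∀ i, w i ∈ T.level η'} :=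
      (hT.countable_tuples m η').to_subtype
    obtain ⟨θ, hθ, hfθ⟩ := exists_bound_lt_omega_one f hf
    obtain ⟨u, hu, hvu⟩ := hv.2 (max θ η') (hηη'.trans (le_max_right _ _)) (max_lt hθ hη')
    have hul := fun i => (hB.mem _ u hu i).1
    obtain ⟨w, hw⟩ := hT'.exists_tuple_restr (le_max_right θ η') hul
    have hwB := hB.restr η' _ (h0.trans hηη') (le_max_right _ _) u hu w hw
    have hvw : ∀ i, T.Le (v i) (w i) := fun i =>
      hT'.le_of_level_le (hul i).1 (hB.mem _ v hv.1 i).1 (hw i).1 (hvu i) (hw i).2 hηη'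
    let w' : {w : Fin m → ZFSet.{u} // ∀ i, w i ∈ T.level η'} := ⟨w, fun i => (hw i).1⟩
    have hle : f w' ≤ max θ η' := (hfθ w').trans (le_max_left _ _)
    obtain ⟨u', hu'⟩ := hT'.exists_tuple_restr hle hul
    have hu'B := hB.restr _ _ ((h0.trans hηη').trans (hf' w')) hle u hu u' hu'
    obtain ⟨i, hi⟩ := hfB w' hwB hvw u' hu'B
    exact hi (hT'.le_of_level_le (hul i).1 (hw i).1 (hu' i).1 (hw i).2 (hu' i).2 (hf' w'))
  have hx : x ∈ B' η₀ := by
    have : ∀ η, η₀ ≤ η → η < ω₁ → ∃ w ∈ B η, ∀ i, T.Le (x i) (w i) := by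
      intro η h1 h2
      obtain ⟨w, hw⟩ := hB.nonempty η h1 h2
      exact ⟨w, hw, fun i => (hB.mem η w hw i).2⟩
    refine ⟨?_, this⟩
    obtain ⟨w, hw, hxw⟩ := this η₀ le_rfl hη₀
    exact hB.restr η₀ η₀ le_rfl le_rfl w hw x fun i => ⟨hB.base i, hxw i⟩
  refine ⟨B', ⟨⟨hB.inj, hB.base, fun η v hv => hB.mem η v hv.1, ?_, ?_⟩, hext⟩,
    fun η v hv => hv.1⟩
  · intro ζ η h0 hζη v hv w hw
    refine ⟨hB.restr ζ η h0 hζη v hv.1 w hw, fun η' h1 h2 => ?_⟩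
    rcases le_total η η' with h | h
    · obtain ⟨u, hu, hvu⟩ := hv.2 η' h h2
      exact ⟨u, hu, fun i => hT'.le_trans (hw i).2 (hvu i)⟩
    · obtain ⟨u, hu⟩ := hT'.exists_tuple_restr h fun i => (hB.mem η v hv.1 i).1
      refine ⟨u, hB.restr η' η (h0.trans h1) h v hv.1 u hu, fun i => ?_⟩
      exact hT'.le_of_level_le (hB.mem η v hv.1 i).1.1 (hw i).1 (hu i).1 (hw i).2 (hu i).2 h1
  · intro η h1 h2
    obtain ⟨w, hw, -⟩ := hext η₀ η le_rfl h1 h2 x hx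
    exact ⟨w, hw⟩

namespace IsFullTupleTree

variable {m : ℕ} {x : Fin m → ZFSet.{u}} {η₀ : Ordinal.{u}}
  {B : Ordinal.{u} → Set (Fin m → ZFSet.{u})}

/-- If the `i`-th entries of extensions of `v` never differed on any level, they would form a chain,
and this chain together with everything below it would be a cofinal branch of `T`. -/
theorem exists_split_coord (hT : T.IsAronszajn) (hB : IsFullTupleTree T x η₀ B)
    {η : Ordinal.{u}} (h0 : η₀ ≤ η) (hη : η < ω₁) {v : Fin m → ZFSet.{u}} (hv : v ∈ B η)
    (i : Fin m) :
    ∃ η', η ≤ η' ∧ η' < ω₁ ∧ ∃ w ∈ B η', ∃ w' ∈ B η', (∀ j, T.Le (v j) (w j)) ∧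
      (∀ j, T.Le (v j) (w' j)) ∧ w i ≠ w' i := by
  have hT' := hT.isOmega1Tree.isTree
  by_contra! hcon
  have hlin : ∀ η₁ η₂, η ≤ η₁ → η₁ ≤ η₂ → η₂ < ω₁ → ∀ w ∈ B η₁, ∀ w' ∈ B η₂,
      (∀ j, T.Le (v j) (w j)) → (∀ j, T.Le (v j) (w' j)) → T.Le (w i) (w' i) := by
    intro η₁ η₂ h1 h2 h3 w hw w' hw' hvw hvw'
    have hl := fun j => (hB.mem η₂ w' hw' j).1
    obtain ⟨u, hu⟩ := hT'.exists_tuple_restr h2 hl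
    have huB := hB.restr η₁ η₂ (h0.trans h1) h2 w' hw' u hu
    rw [hcon η₁ h1 (h2.trans_lt h3) w hw u huB hvw fun j =>
      hT'.le_of_level_le (hl j).1 (hB.mem η v hv j).1 (hu j).1 (hvw' j) (hu j).2 h1]
    exact (hu i).2
  refine hT.no_branch ⟨{y | ∃ η', η ≤ η' ∧ η' < ω₁ ∧ ∃ w ∈ B η', (∀ j, T.Le (v j) (w j)) ∧
    y ∈ T.carrier ∧ T.Le y (w i)}, ?_, ?_, ?_⟩
  · rintro y ⟨-, -, -, -, -, -, h, -⟩
    exact h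
  · have key : ∀ {η₁ η₂ : Ordinal.{u}} {w w' : Fin m → ZFSet.{u}} {y z : ZFSet.{u}},
        η ≤ η₁ → η₁ ≤ η₂ → η₂ < ω₁ → w ∈ B η₁ → w' ∈ B η₂ → (∀ j, T.Le (v j) (w j)) →
        (∀ j, T.Le (v j) (w' j)) → T.Le y (w i) → T.Le z (w' i) → T.Le y z ∨ T.Le z y := by
      intro η₁ η₂ w w' y z h1 h2 h3 hw hw' hvw hvw' hy hz
      rcases hT'.comparable (hB.mem η₂ w' hw' i).1.1
        (hT'.le_trans hy (hlin η₁ η₂ h1 h2 h3 w hw w' hw' hvw hvw')) hz with h | h | h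
      · exact Or.inl h.le
      · exact Or.inl (Or.inl h)
      · exact Or.inr h.le
    rintro y ⟨η₁, h1, h2, w, hw, hvw, -, hy⟩ z ⟨η₂, h3, h4, w', hw', hvw', -, hz⟩
    rcases le_total η₁ η₂ with h | h
    · exact key h1 h h4 hw hw' hvw hvw' hy hz
    · exact (key h3 h h2 hw' hw hvw' hvw hz hy).symm
  · intro α hα
    obtain ⟨w, hw, hvw⟩ := hB.extend η (max α η) h0 (le_max_right _ _) (max_lt hα hη) v hv
    obtain ⟨y, hy, hyw⟩ := hT'.exists_level_le (hB.mem _ w hw i).1 (le_max_left α η)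
    exact ⟨y, ⟨_, le_max_right _ _, max_lt hα hη, w, hw, hvw, hy.1, hyw⟩, hy⟩

/-- To add a coordinate `i`, split the first tuple at `i` and extend the second one to the same
level. At least one half of the split differs from the second tuple at `i`, and differences already
obtained persist upwards. -/
theorem exists_split_finset (hT : T.IsAronszajn) (hB : IsFullTupleTree T x η₀ B)
    {η : Ordinal.{u}} (h0 : η₀ ≤ η) (hη : η < ω₁) {v : Fin m → ZFSet.{u}} (hv : v ∈ B η)
    (s : Finset (Fin m)) :
    ∃ η', η ≤ η' ∧ η' < ω₁ ∧ ∃ w ∈ B η', ∃ w' ∈ B η', (∀ j, T.Le (v j) (w j)) ∧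
      (∀ j, T.Le (v j) (w' j)) ∧ ∀ i ∈ s, w i ≠ w' i := by
  have hT' := hT.isOmega1Tree.isTree
  classical
  induction s using Finset.induction_on with
  | empty => exact ⟨η, le_rfl, hη, v, hv, v, hv, fun _ => Or.inl rfl, fun _ => Or.inl rfl, by simp⟩
  | insert i s _ ih =>
    obtain ⟨η₁, h1, h2, w, hw, w', hw', hvw, hvw', hne⟩ := ih
    obtain ⟨η₂, h3, h4, u, hu, u', hu', hwu, hwu', hne'⟩ :=
      hB.exists_split_coord hT (h0.trans h1) h2 hw i
    obtain ⟨u'', hu'', hwu''⟩ := hB.extend η₁ η₂ (h0.trans h1) h3 h4 w' hw'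
    have key : ∀ t : Fin m → ZFSet.{u}, t ∈ B η₂ → (∀ j, T.Le (w j) (t j)) → t i ≠ u'' i →
        ∀ j ∈ insert i s, t j ≠ u'' j := by
      intro t ht hwt hti j hj
      rcases Finset.mem_insert.1 hj with rfl | hj
      · exact hti
      · intro h
        refine hne j hj (hT'.eq_of_level_eq (hB.mem η₂ t ht j).1.1 (hB.mem η₁ w hw j).1
          (hB.mem η₁ w' hw' j).1 (hwt j) ?_)
        rw [h]
        exact hwu'' j
    by_cases h : u i = u'' i
    · exact ⟨η₂, h1.trans h3, h4, u', hu', u'', hu'',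
        fun j => hT'.le_trans (hvw j) (hwu' j), fun j => hT'.le_trans (hvw' j) (hwu'' j),
        key u' hu' hwu' fun h' => hne' (h.trans h'.symm)⟩
    · exact ⟨η₂, h1.trans h3, h4, u, hu, u'', hu'',
        fun j => hT'.le_trans (hvw j) (hwu j), fun j => hT'.le_trans (hvw' j) (hwu'' j),
        key u hu hwu h⟩

/-- Some level of a full tuple tree contains infinitely many pairwise disjoint tuples, whose
entries form a set which branches at most binarily. -/
theorem exists_disjoint_seq (hT : T.IsAronszajn) (hη₀ : η₀ < ω₁)
    (hB : IsFullTupleTree T x η₀ B) :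
    ∃ γ, η₀ < γ ∧ γ < ω₁ ∧ ∃ c : ℕ → Fin m → ZFSet.{u}, (∀ n, c n ∈ B γ) ∧
      (∀ a b i j, c a i = c b j → a = b) ∧
      ∀ z ξ, z ∈ T.level ξ → η₀ ≤ ξ → ξ < γ →
        (T.branching {y | ∃ n i, y = c n i} z).encard ≤ 2 := by
  have hT' := hT.isOmega1Tree.isTree
  let σ := {s : Ordinal.{u} × (Fin m → ZFSet.{u}) // η₀ ≤ s.1 ∧ s.1 < ω₁ ∧ s.2 ∈ B s.1}
  have hstep : ∀ s : σ, ∃ s' : σ, s.1.1 ≤ s'.1.1 ∧ (∀ j, T.Le (s.1.2 j) (s'.1.2 j)) ∧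
      ∃ w ∈ B s'.1.1, (∀ j, T.Le (s.1.2 j) (w j)) ∧ ∀ i, w i ≠ s'.1.2 i := by
    rintro ⟨⟨η, v⟩, h0, hη, hv⟩
    obtain ⟨η', h1, h2, w, hw, w', hw', hvw, hvw', hne⟩ :=
      hB.exists_split_finset hT h0 hη hv Finset.univ
    exact ⟨⟨⟨η', w'⟩, h0.trans h1, h2, hw'⟩, h1, hvw', w, hw, hvw,
      fun i => hne i (Finset.mem_univ i)⟩
  choose f hf1 hf2 g hg hg1 hg2 using hstep
  obtain ⟨x₀, hx₀⟩ := hB.nonempty η₀ le_rfl hη₀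
  -- The tuples form a comb: the `s n` are the trunk, `g (s n)` leaves the trunk in all coordinates
  -- simultaneously before `s (n + 1)`, and `c n` prolongs this tooth to a level `θ + 1` above the
  -- whole trunk.
  let s : ℕ → σ := fun n => Nat.rec ⟨⟨η₀, x₀⟩, le_rfl, hη₀, hx₀⟩ (fun _ a => f a) n
  have hs : ∀ n, s (n + 1) = f (s n) := fun n => rfl
  obtain ⟨θ, hθ, hsθ⟩ := exists_bound_lt_omega_one (fun n => (s n).1.1) fun n => (s n).2.2.1
  have hγ : θ + 1 < ω₁ := SetTree.add_one_lt_omega_one hθ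
  have hsγ : ∀ n, (s n).1.1 < θ + 1 := fun n => Order.lt_add_one_iff.2 (hsθ n)
  have hmono : ∀ n k, n ≤ k → (s n).1.1 ≤ (s k).1.1 ∧ ∀ j, T.Le ((s n).1.2 j) ((s k).1.2 j) := by
    intro n k hnk
    induction k, hnk using Nat.le_induction with
    | base => exact ⟨le_rfl, fun _ => Or.inl rfl⟩
    | succ k _ ih =>
      rw [hs]
      exact ⟨ih.1.trans (hf1 _), fun j => hT'.le_trans (ih.2 j) (hf2 _ j)⟩
  have hc : ∀ n, ∃ c ∈ B (θ + 1), ∀ i, T.Le (g (s n) i) (c i) := fun n =>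
    hB.extend _ _ ((s (n + 1)).2.1) (hsγ (n + 1)).le hγ (g (s n)) (hg (s n))
  choose c hcB hgc using hc
  have hcl : ∀ n i, c n i ∈ T.level (θ + 1) := fun n i => (hB.mem _ _ (hcB n) i).1
  have hsc : ∀ a b, a ≤ b → ∀ i, T.Le ((s a).1.2 i) (c b i) := fun a b hab i =>
    hT'.le_trans ((hmono a b hab).2 i) (hT'.le_trans (hg1 (s b) i) (hgc b i))
  -- the sequences separate at the level of the next splitting
  have hsl : ∀ n i, (s n).1.2 i ∈ T.level (s n).1.1 := fun n i => (hB.mem _ _ (s n).2.2.2 i).1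
  have hgl : ∀ n i, g (s n) i ∈ T.level (s (n + 1)).1.1 := fun n i =>
    (hB.mem _ _ (hg (s n)) i).1
  have hsep : ∀ a b, a < b → ∀ i, ∀ y ∈ T.level (s (a + 1)).1.1, T.Le y (c a i) →
      ¬ T.Le y (c b i) := by
    intro a b hab i y hy hya hyb
    have h1 := hT'.eq_of_level_eq (hcl a i).1 hy (hgl a i) hya (hgc a i)
    have h2 := hT'.eq_of_level_eq (hcl b i).1 hy (hsl (a + 1) i) hyb (hsc (a + 1) b hab i)
    exact hg2 (s a) i (h1.symm.trans h2)
  -- Different coordinates never interfere from level `η₀` on, since the entries of `x` are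
  -- distinct.
  have hcoord : ∀ a b i j y, T.Le (x i) y → y ∈ T.carrier → T.Le y (c a j) ∨ T.Le y (c b j) →
      i = j := by
    intro a b i j y hxy hy h
    rcases h with h | h
    · exact hB.inj (hT'.eq_of_level_eq (hcl a j).1 (hB.base i) (hB.base j) (hT'.le_trans hxy h)
        (hB.mem _ _ (hcB a) j).2)
    · exact hB.inj (hT'.eq_of_level_eq (hcl b j).1 (hB.base i) (hB.base j) (hT'.le_trans hxy h)
        (hB.mem _ _ (hcB b) j).2)
  refine ⟨θ + 1, (hsγ 0), hγ, c, hcB, ?_, ?_⟩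
  · have key : ∀ a b i j, a < b → c a i ≠ c b j := by
      intro a b i j hab h
      obtain rfl := hcoord a b i j (c a i) (hB.mem _ _ (hcB a) i).2 (hcl a i).1
        (Or.inr (Or.inl h))
      refine hsep a b hab i (g (s a) i) (hgl a i) (hgc a i) ?_
      rw [← h]
      exact hgc a i
    intro a b i j h
    rcases lt_trichotomy a b with hab | hab | hab
    · exact absurd h (key a b i j hab)
    · exact hab
    · exact absurd h.symm (key b a j i hab)
  · intro z ξ hz hξ hξγ
    by_cases hne : ∃ n i, T.Lt z (c n i)
    swap
    · have : T.branching {y | ∃ n i, y = c n i} z = ∅ := by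
        rw [Set.eq_empty_iff_forall_notMem]
        rintro y ⟨hy, _, ⟨n, i, rfl⟩, hyc⟩
        exact hne ⟨n, i, hT'.lt_of_lt_of_le hy.1 hyc⟩
      rw [this]
      simp
    classical
    obtain ⟨i, hi⟩ := Nat.find_spec hne
    -- Let `a` be the first tooth through `z`. The claim is that the only directions at `z` are that
    -- of tooth `a` and that of the trunk.
    have hmin : ∀ n j, T.Lt z (c n j) → Nat.find hne ≤ n := fun n j h => Nat.find_min' hne ⟨j, h⟩
    generalize Nat.find hne = a at hi hmin
    have hxz : T.Le (x i) z := by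
      exact hT'.le_of_level_le (hcl a i).1 (hB.base i) hz (hB.mem _ _ (hcB a) i).2 hi.le hξ
    have hi' : ∀ n j, T.Lt z (c n j) → i = j := fun n j h =>
      hcoord n n i j z hxz hz.1 (Or.inl h.le)
    have hl : ∀ {y}, y ∈ T.imm z → y ∈ T.level (ξ + 1) := fun hy => ((hT'.mem_imm_iff hz).1 hy).1
    obtain ⟨p, hp, hpc⟩ := hT'.exists_level_le (hcl a i) (Order.add_one_le_of_lt hξγ)
    by_cases hq : ∃ q ∈ T.imm z, q ≠ p ∧ ∃ b, T.Le q (c b i)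
    · obtain ⟨q, hq, hqp, b, hqb⟩ := hq
      have hab : a < b := by
        refine lt_of_le_of_ne (hmin b i (hT'.lt_of_lt_of_le hq.1 hqb)) ?_
        rintro rfl
        exact hqp (hT'.eq_of_level_eq (hcl _ i).1 (hl hq) hp hqb hpc)
      -- Tooth `a` and a later tooth have separated by the level of `s (a + 1)`, so `z` is below
      -- that level. All later teeth still follow the trunk there, hence all leave `z` through `q`.
      have hξa : ξ < (s (a + 1)).1.1 := by
        by_contra! hle
        obtain ⟨y, hy, hyz⟩ := hT'.exists_level_le hz hle
        exact hsep a b hab i y hy (hT'.le_trans hyz hi.le)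
          (hT'.le_trans hyz (hT'.lt_of_lt_of_le hq.1 hqb).le)
      refine _root_.le_trans (Set.encard_le_encard (t := {p, q}) ?_)
        ((Set.encard_insert_le _ _).trans (by rw [Set.encard_singleton, one_add_one_eq_two]))
      rintro y ⟨hy, _, ⟨d, j, rfl⟩, hyd⟩
      obtain rfl := hi' d j (hT'.lt_of_lt_of_le hy.1 hyd)
      have had := hmin d i (hT'.lt_of_lt_of_le hy.1 hyd)
      rcases had.eq_or_lt with rfl | had
      · exact Or.inl (hT'.eq_of_level_eq (hcl _ i).1 (hl hy) hp hyd hpc)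
      · right
        have h1 := hT'.le_of_level_le (hcl b i).1 (hl hq) (hsl (a + 1) i) hqb
          (hsc (a + 1) b hab i) (Order.add_one_le_of_lt hξa)
        have h2 := hT'.le_of_level_le (hcl d i).1 (hl hy) (hsl (a + 1) i) hyd
          (hsc (a + 1) d had i) (Order.add_one_le_of_lt hξa)
        exact hT'.eq_of_level_eq (hsl (a + 1) i).1 (hl hy) (hl hq) h2 h1
    · push Not at hq
      refine _root_.le_trans (Set.encard_le_encard (t := {p}) ?_)
        (_root_.le_trans (Set.encard_singleton p).le one_le_two)
      rintro y ⟨hy, _, ⟨d, j, rfl⟩, hyd⟩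
      obtain rfl := hi' d j (hT'.lt_of_lt_of_le hy.1 hyd)
      by_contra hyp
      exact hq y hy hyp d hyd

/-- A common entry of two extensions would have the same restriction to level `γ`, a common entry of
the original tuples. So disjointness on the base level passes to all higher levels. -/
theorem exists_extension_avoiding (hT : T.IsTree) {γ β : Ordinal.{u}}
    (hB : IsFullTupleTree T x η₀ B) (hγ : η₀ ≤ γ) {c : ℕ → Fin m → ZFSet.{u}}
    (hc : ∀ n, c n ∈ B γ) (hinj : ∀ a b i j, c a i = c b j → a = b) (hγβ : γ ≤ β) (hβ : β < ω₁) :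
    ∃ d : ℕ → Fin m → ZFSet.{u}, (∀ n, d n ∈ B β) ∧ (∀ n i, T.Le (c n i) (d n i)) ∧
      ∀ a b i j, d a i = d b j → a = b := by
  choose d hd hcd using fun n => hB.extend γ β hγ hγβ hβ (c n) (hc n)
  refine ⟨d, hd, hcd, fun a b i j h => hinj a b i j ?_⟩
  refine hT.eq_of_level_eq (hB.mem _ _ (hd a) i).1.1 (hB.mem _ _ (hc a) i).1
    (hB.mem _ _ (hc b) j).1 (hcd a i) ?_
  rw [h]
  exact hcd b j

end IsFullTupleTree

/-- Pigeonhole: each member of `t` can occur in only one of the infinitely many disjoint tuples. -/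
theorem exists_avoiding {m : ℕ} {d : ℕ → Fin m → ZFSet.{u}}
    (h : ∀ a b i j, d a i = d b j → a = b) (t : Finset ZFSet.{u}) : ∃ n, ∀ i, d n i ∉ t := by
  by_contra! hcon
  choose i hi using hcon
  have hinj : Function.Injective fun n => (⟨d n (i n), hi n⟩ : t) := fun a b hab =>
    h a b (i a) (i b) (congrArg Subtype.val hab)
  exact not_injective_infinite_finite _ hinj

section Promise

variable (T) {m : ℕ} (B : Ordinal.{u} → Set (Fin m → ZFSet.{u}))

/-- The set of the members of level `η` of a tuple tree. -/
noncomputable def tupleSet (η : Ordinal.{u}) : ZFSet.{u} :=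
  (ZFSet.prod (ω : Ordinal.{u}).toZFSet T.carrier).powerset.sep fun a => ∃ v ∈ B η, a = tuple v

/-- The generalized promise with base level `γ` given by the levels of a tuple tree. -/
noncomputable def treePromise (γ : Ordinal.{u}) : ZFSet.{u} :=
  ZFSet.range fun β : Set.Ico γ ω₁ =>
    ZFSet.pair β.1.toZFSet ({tupleSet T B β.1} : ZFSet.{u})

variable {T B}

theorem mem_tupleSet {x : Fin m → ZFSet.{u}} {η₀ : Ordinal.{u}} (hB : IsTupleTree T x η₀ B)
    {η : Ordinal.{u}} {a : ZFSet.{u}} : a ∈ tupleSet T B η ↔ ∃ v ∈ B η, a = tuple v := by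
  rw [tupleSet, ZFSet.mem_sep, and_iff_right_iff_imp]
  rintro ⟨v, hv, rfl⟩
  exact ZFSet.mem_powerset.2 (tuple_subset fun i => (hB.mem η v hv i).1.1)

theorem pair_mem_treePromise {γ β : Ordinal.{u}} {V : ZFSet.{u}} :
    ZFSet.pair β.toZFSet V ∈ treePromise T B γ ↔ γ ≤ β ∧ β < ω₁ ∧ V = {tupleSet T B β} := by
  rw [treePromise, ZFSet.mem_range]
  constructor
  · rintro ⟨δ, h⟩
    obtain ⟨h1, rfl⟩ := ZFSet.pair_inj.1 h
    rw [← Ordinal.toZFSet_injective h1]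
    exact ⟨δ.2.1, δ.2.2, rfl⟩
  · rintro ⟨h1, h2, rfl⟩
    exact ⟨⟨β, h1, h2⟩, rfl⟩

/-- Fullness makes every level the exact restriction of each higher one, which is coherence. The
disjoint tuples on level `γ`, lifted to all levels, make each level infinite and well-distributed.
-/
theorem isGenPromise_treePromise (hT : T.IsOmega1Tree) {x : Fin m → ZFSet.{u}}
    {η₀ γ : Ordinal.{u}} (hB : IsFullTupleTree T x η₀ B) (hm : 0 < m) (hγ : η₀ ≤ γ) (hγ₁ : γ < ω₁)
    {c : ℕ → Fin m → ZFSet.{u}} (hc : ∀ n, c n ∈ B γ)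
    (hinj : ∀ a b i j, c a i = c b j → a = b) :
    IsGenPromise T m γ (treePromise T B γ) where
  dim_pos := hm
  base_lt := hγ₁
  mem_pair := by
    intro z hz
    obtain ⟨β, rfl⟩ := ZFSet.mem_range.1 hz
    exact ⟨β.1, _, β.2.1, β.2.2, rfl⟩
  existsUnique := fun β h1 h2 =>
    ⟨_, pair_mem_treePromise.2 ⟨h1, h2, rfl⟩, fun V hV => (pair_mem_treePromise.1 hV).2.2⟩
  nonempty := by
    intro β V hV
    obtain ⟨-, -, rfl⟩ := pair_mem_treePromise.1 hV
    exact ZFSet.singleton_nonempty _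
  countable := by
    intro β V hV
    obtain ⟨-, -, rfl⟩ := pair_mem_treePromise.1 hV
    rw [ZFSet.coe_singleton]
    exact Set.countable_singleton _
  derived := by
    refine ⟨x, hB.inj, ⟨η₀, hB.base⟩, ?_⟩
    intro β V hV Y hY
    obtain ⟨h1, h2, rfl⟩ := pair_mem_treePromise.1 hV
    obtain rfl := ZFSet.mem_singleton.1 hY
    refine ⟨?_, ?_, ?_⟩
    · refine ((hT.countable_tuples m β).image tuple).mono fun a ha => ?_
      obtain ⟨v, hv, rfl⟩ := (mem_tupleSet hB.toIsTupleTree).1 ha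
      exact ⟨v, fun i => (hB.mem β v hv i).1, rfl⟩
    · obtain ⟨d, hd, -, hdinj⟩ := hB.exists_extension_avoiding hT.isTree hγ hc hinj h1 h2
      refine Set.infinite_of_injective_forall_mem (f := fun n => tuple (d n)) ?_
        fun n => (mem_tupleSet hB.toIsTupleTree).2 ⟨d n, hd n, rfl⟩
      intro a b hab
      exact hdinj a b ⟨0, hm⟩ ⟨0, hm⟩ (congrFun (tuple_injective hab) _)
    · intro a ha
      obtain ⟨v, hv, rfl⟩ := (mem_tupleSet hB.toIsTupleTree).1 ha
      exact ⟨v, rfl, hB.mem β v hv⟩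
  wellDistributed := by
    intro β V hV Y hY t _
    obtain ⟨h1, h2, rfl⟩ := pair_mem_treePromise.1 hV
    obtain rfl := ZFSet.mem_singleton.1 hY
    obtain ⟨d, hd, -, hdinj⟩ := hB.exists_extension_avoiding hT.isTree hγ hc hinj h1 h2
    obtain ⟨n, hn⟩ := exists_avoiding hdinj t
    exact ⟨d n, (mem_tupleSet hB.toIsTupleTree).2 ⟨d n, hd n, rfl⟩, hn⟩
  restr := by
    intro α β V W hαβ hV hW Y hY
    obtain ⟨h1, h2, rfl⟩ := pair_mem_treePromise.1 hV
    obtain ⟨h3, h4, rfl⟩ := pair_mem_treePromise.1 hW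
    obtain rfl := ZFSet.mem_singleton.1 hY
    refine ⟨_, ZFSet.mem_singleton.2 rfl, fun a => ?_⟩
    rw [mem_tupleSet hB.toIsTupleTree]
    constructor
    · rintro ⟨w, hw, rfl⟩
      obtain ⟨v, hv, hwv⟩ := hB.extend α β (hγ.trans h1) hαβ.le h4 w hw
      exact ⟨v, w, (mem_tupleSet hB.toIsTupleTree).2 ⟨v, hv, rfl⟩, rfl,
        fun i => ⟨(hB.mem α w hw i).1, hwv i⟩⟩
    · rintro ⟨v, w, hv, rfl, hvw⟩
      obtain ⟨v', hv', e⟩ := (mem_tupleSet hB.toIsTupleTree).1 hv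
      obtain rfl := tuple_injective e
      exact ⟨w, hB.restr α β (hγ.trans h1) hαβ.le v hv' w hvw, rfl⟩

end Promise

/-- If a condition takes the value `1` at the root of a full tuple tree, then it can be extended so
that all further extensions take the value `1` at some member of the tuple tree at their top
levels. -/
theorem IsCond.exists_extension_promise (hTS : IsSuitable T S) {F Γ : ZFSet.{u}} {m : ℕ}
    {x : Fin m → ZFSet.{u}} {η₀ : Ordinal.{u}} {B : Ordinal.{u} → Set (Fin m → ZFSet.{u})}
    (hp : IsCond T S F Γ η₀) (hB : IsFullTupleTree T x η₀ B) (hm : 0 < m)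
    (hx : ∀ i, IsOne F (x i)) :
    ∃ G Δ γ, IsCond T S G Δ γ ∧ F ⊆ G ∧ Γ ⊆ Δ ∧ ∀ G' Δ' γ', IsCond T S G' Δ' γ' → G ⊆ G' →
      Δ ⊆ Δ' → ∃ v ∈ B γ', ∀ i, IsOne G' (v i) := by
  have hT := hTS.isTree
  have hη₀ := hp.isSubtreeFun.top_lt
  obtain ⟨γ, hγ, hγ₁, c, hc, hinj, hbr⟩ := hB.exists_disjoint_seq hTS.aronszajn hη₀
  have hbelow : T.below η₀ {y | ∃ n i, y = c n i} ⊆ Set.range x := by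
    rintro y ⟨hy, _, ⟨n, i, rfl⟩, hyc⟩
    exact ⟨i, hT.eq_of_level_eq (hB.mem _ _ (hc n) i).1.1 (hB.base i) hy
      (hB.mem _ _ (hc n) i).2 hyc⟩
  obtain ⟨k₀, hk₀⟩ := hTS.nonempty
  -- A promise may be added only when it is fulfilled, so the function is first made 1 on the whole
  -- comb. This is an infinite set, but its restriction to level `η₀` lies in the finite range of
  -- `x`, and binary branching is compatible with any `k₀` in `S`.
  obtain ⟨G, hG, hFG, hGc⟩ := hp.exists_extension hTS hγ hγ₁ (C := {y | ∃ n i, y = c n i})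
    (by rintro _ ⟨n, i, rfl⟩; exact (hB.mem _ _ (hc n) i).1)
    ((Set.finite_range x).subset hbelow)
    (by
      intro y hy
      obtain ⟨i, rfl⟩ := hbelow hy
      exact hx i)
    (fun z ξ hz h1 h2 => ⟨k₀, hk₀, (hbr z ξ hz h1 h2).trans
      (by exact_mod_cast hTS.two_le k₀ hk₀)⟩)
  have hU := isGenPromise_treePromise hTS.isOmega1Tree hB hm hγ.le hγ₁ hc hinj
  have hGU : Fulfills T G γ m (treePromise T B γ) := by
    intro t _ V hV Y hY
    obtain ⟨-, -, rfl⟩ := pair_mem_treePromise.1 hV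
    obtain rfl := ZFSet.mem_singleton.1 hY
    obtain ⟨n, hn⟩ := exists_avoiding hinj t
    exact ⟨c n, (mem_tupleSet hB.toIsTupleTree).2 ⟨c n, hc n, rfl⟩,
      fun i => ⟨hn i, hGc _ ⟨n, i, rfl⟩⟩⟩
  refine ⟨G, insert (treePromise T B γ) Γ, γ, ⟨hG.isSplittingFun, ?_, ?_⟩, hFG,
    fun z hz => ZFSet.mem_insert_of_mem _ hz, ?_⟩
  · rw [ZFSet.coe_insert]
    exact hG.countable.insert _
  · intro U hU'
    rcases ZFSet.mem_insert_iff.1 hU' with rfl | hU'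
    · exact ⟨m, γ, le_rfl, hU, hGU⟩
    · exact hG.fulfills U hU'
  · intro G' Δ' γ' hq hGG' hΔ
    -- Every later condition contains the promise and so fulfils it at its own top level; the empty
    -- set suffices as the set to avoid.
    obtain ⟨m', γ₀, hγ₀, hU', hF'⟩ := hq.fulfills _ (hΔ (ZFSet.mem_insert _ _))
    have hle : γ ≤ γ' := top_le_of_subset hTS.isOmega1Tree hG.isSubtreeFun hq.isSubtreeFun hGG'
    obtain ⟨v, hv, hv'⟩ := hF' ∅ (by simp) _
      (pair_mem_treePromise.2 ⟨hle, hq.isSubtreeFun.top_lt, rfl⟩) _ (ZFSet.mem_singleton.2 rfl)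
    obtain ⟨w, hw, e⟩ := (mem_tupleSet hB.toIsTupleTree).1 hv
    obtain rfl := dim_eq_of_tuple_eq e
    obtain rfl := tuple_injective e
    exact ⟨v, hw, fun i => (hv' i).2⟩

end SplitTree

/-! ### Admitted sets, bad sets and countable parts of dense sets -/

namespace SplitTree

variable {T : SetTree.{u}} {S : Set ℕ}

/-- Some condition below `q` takes the value `1` on `b`. -/
def Admits (T : SetTree.{u}) (S : Set ℕ) (q : ZFSet.{u}) (b : Set ZFSet.{u}) : Prop :=
  ∃ G Δ, (forcing T S).Le (ZFSet.pair G Δ) q ∧ ∀ z ∈ b, IsOne G z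

theorem IsSubtreeFun.isOne_of_le {F x y : ZFSet.{u}} {β : Ordinal.{u}} (hF : IsSubtreeFun T F β)
    (h : T.Le y x) (hx : IsOne F x) : IsOne F y := by
  rcases h with rfl | h
  · exact hx
  · exact hF.downward _ _ h hx

theorem Admits.of_le (hT : T.IsOmega1Tree) {F Γ : ZFSet.{u}} {β : Ordinal.{u}}
    (hp : IsCond T S F Γ β) {b b' : Set ZFSet.{u}} (h : Admits T S (ZFSet.pair F Γ) b)
    (hb : ∀ y ∈ b', ∃ z ∈ b, T.Le y z) : Admits T S (ZFSet.pair F Γ) b' := by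
  obtain ⟨G, Δ, hle, hG⟩ := h
  obtain ⟨G', Δ', γ, e, hq, -⟩ := exists_of_le hT hp hle
  obtain ⟨rfl, rfl⟩ := ZFSet.pair_inj.1 e
  refine ⟨G, Δ, hle, fun y hy => ?_⟩
  obtain ⟨z, hz, hyz⟩ := hb y hy
  exact hq.isSubtreeFun.isOne_of_le hyz (hG z hz)

/-- The branching of a set admitted by a condition is compatible with `S`. -/
theorem Admits.branching (hTS : IsSuitable T S) {F Γ : ZFSet.{u}} {β η : Ordinal.{u}}
    (hp : IsCond T S F Γ β) {b : Set ZFSet.{u}} (hb : ∀ z ∈ b, z ∈ T.level η)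
    (h : Admits T S (ZFSet.pair F Γ) b) :
    (∀ y ∈ T.below β b, IsOne F y) ∧
      ∀ z ξ, z ∈ T.level ξ → ξ < η → ∃ k ∈ S, (T.branching b z).encard ≤ k := by
  have hT := hTS.isTree
  obtain ⟨G, Δ, hle, hG⟩ := h
  obtain ⟨G', Δ', γ, e, hq, hFG, -, -⟩ := exists_of_le hTS.isOmega1Tree hp hle
  obtain ⟨rfl, rfl⟩ := ZFSet.pair_inj.1 e
  constructor
  · rintro y ⟨hy, z, hz, hyz⟩
    exact (isOne_iff_of_subset hp.isFunc hq.isFunc hFG ((SetTree.mem_upTo hy).2 le_rfl)).2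
      (hq.isSubtreeFun.isOne_of_le hyz (hG z hz))
  · intro z ξ hz hξη
    rcases (T.branching b z).eq_empty_or_nonempty with he | ⟨y, hy, a, ha, hya⟩
    · obtain ⟨k, hk⟩ := hTS.nonempty
      exact ⟨k, hk, by simp [he]⟩
    · have hηγ : η ≤ γ := (SetTree.mem_upTo (hb a ha)).1 ((hG a ha).mem_of_isFunc hq.isFunc)
      have hGz : IsOne G z := hq.isSubtreeFun.isOne_of_le
        (hT.lt_of_lt_of_le hy.1 hya).le (hG a ha)
      obtain ⟨k, hk, hk'⟩ := hq.isSplittingFun.splitting ξ (hξη.trans_le hηγ) z hz hGz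
      refine ⟨k, hk, hk' ▸ Set.encard_le_encard ?_⟩
      rintro y' ⟨hy', a', ha', hya'⟩
      exact ⟨hy', hq.isSubtreeFun.isOne_of_le hya' (hG a' ha')⟩

/-- A finite set on a level with compatible branching can be added without new promises. -/
theorem IsCond.exists_extension_finite (hTS : IsSuitable T S) {F Γ : ZFSet.{u}}
    {β η : Ordinal.{u}} (hp : IsCond T S F Γ β) (hβη : β ≤ η) (hη : η < ω₁) {b : Set ZFSet.{u}}
    (hfin : b.Finite) (hb : ∀ z ∈ b, z ∈ T.level η) (hone : ∀ y ∈ T.below β b, IsOne F y)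
    (hadm : ∀ z ξ, z ∈ T.level ξ → β ≤ ξ → ξ < η → ∃ k ∈ S, (T.branching b z).encard ≤ k) :
    ∃ G, IsCond T S G Γ η ∧ F ⊆ G ∧ ∀ z ∈ b, IsOne G z := by
  rcases hβη.eq_or_lt with rfl | hlt
  · exact ⟨F, hp, fun _ h => h, fun z hz => hone z ⟨hb z hz, z, hz, Or.inl rfl⟩⟩
  · exact hp.exists_extension hTS hlt hη hb
      (hTS.isTree.finite_below (fun z hz => (hb z hz).1) hfin) hone hadm

theorem IsCond.exists_extension_top (hTS : IsSuitable T S) {F Γ : ZFSet.{u}} {β η : Ordinal.{u}}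
    (hp : IsCond T S F Γ β) (hβη : β ≤ η) (hη : η < ω₁) : ∃ G, IsCond T S G Γ η ∧ F ⊆ G := by
  obtain ⟨k, hk⟩ := hTS.nonempty
  obtain ⟨G, h1, h2, -⟩ := hp.exists_extension_finite hTS hβη hη Set.finite_empty (by simp)
    (by rintro y ⟨-, a, ha, -⟩; exact absurd ha (Set.notMem_empty a))
    (fun z ξ _ _ _ => ⟨k, hk, by
      have : T.branching ∅ z = ∅ := by
        rw [Set.eq_empty_iff_forall_notMem]
        rintro y ⟨-, a, ha, -⟩
        exact ha
      simp [this]⟩)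
  exact ⟨G, h1, h2⟩

namespace SetTree

theorem IsTree.below_below (hT : T.IsTree) {ξ ζ η : Ordinal.{u}} (h₁ : ξ ≤ ζ) (h₂ : ζ ≤ η)
    {b : Set ZFSet.{u}} (hb : ∀ z ∈ b, z ∈ T.level η) :
    T.below ξ (T.below ζ b) = T.below ξ b := by
  ext y
  constructor
  · rintro ⟨hy, u, ⟨-, z, hz, huz⟩, hyu⟩
    exact ⟨hy, z, hz, hT.le_trans hyu huz⟩
  · rintro ⟨hy, z, hz, hyz⟩
    obtain ⟨u, hu, huz⟩ := hT.exists_level_le (hb z hz) h₂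
    exact ⟨hy, u, ⟨hu, z, hz, huz⟩, hT.le_of_level_le (hb z hz).1 hy hu hyz huz h₁⟩

theorem IsTree.below_eq_image (hT : T.IsTree) {ζ η : Ordinal.{u}} (h : ζ ≤ η)
    {b : Set ZFSet.{u}} (hb : ∀ z ∈ b, z ∈ T.level η) :
    ∃ f : ZFSet.{u} → ZFSet.{u}, (∀ z ∈ b, f z ∈ T.level ζ ∧ T.Le (f z) z) ∧
      T.below ζ b = f '' b := by
  choose! f hf hfz using fun z (hz : z ∈ b) => hT.exists_level_le (hb z hz) h
  refine ⟨f, fun z hz => ⟨hf z hz, hfz z hz⟩, ?_⟩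
  ext y
  constructor
  · rintro ⟨hy, z, hz, hyz⟩
    exact ⟨z, hz, hT.eq_of_level_eq (hb z hz).1 (hf z hz) hy (hfz z hz) hyz⟩
  · rintro ⟨z, hz, rfl⟩
    exact ⟨hf z hz, z, hz, hfz z hz⟩

end SetTree

/-- `b` is a finite subset of level `η` admitted by `(F, Γ)`, but not by a restriction of a member
of `D` below `(F, Γ)` with top level at most `η`. -/
structure IsBad (T : SetTree.{u}) (S : Set ℕ) (F Γ D : ZFSet.{u}) (η : Ordinal.{u})
    (b : Set ZFSet.{u}) : Prop where
  finite : b.Finite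
  level : ∀ z ∈ b, z ∈ T.level η
  admits : Admits T S (ZFSet.pair F Γ) b
  bad : ∀ G Δ ζ, ZFSet.pair G Δ ∈ D → IsCond T S G Δ ζ → F ⊆ G → Γ ⊆ Δ → ζ ≤ η →
    ∃ y ∈ T.below ζ b, ¬ IsOne G y

/-- A condition with top level at most `ζ` only sees restrictions to levels at most `ζ`, and these
are the same for `b` and its restriction. Hence the bad sets form a tree under restriction. -/
theorem IsBad.below (hT : T.IsOmega1Tree) {F Γ D : ZFSet.{u}} {β ζ η : Ordinal.{u}}
    (hp : IsCond T S F Γ β) {b : Set ZFSet.{u}} (h : IsBad T S F Γ D η b) (hζ : ζ ≤ η) :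
    IsBad T S F Γ D ζ (T.below ζ b) where
  finite := hT.isTree.finite_below (fun z hz => (h.level z hz).1) h.finite
  level := fun z hz => hz.1
  admits := h.admits.of_le hT hp fun y hy => hy.2
  bad := by
    intro G Δ ξ h1 h2 h3 h4 h5
    rw [hT.isTree.below_below h5 hζ h.level]
    exact h.bad G Δ ξ h1 h2 h3 h4 (h5.trans hζ)

theorem IsBad.ncard_below_le (hT : T.IsTree) {F Γ D : ZFSet.{u}} {ζ η : Ordinal.{u}}
    {b : Set ZFSet.{u}} (h : IsBad T S F Γ D η b) (hζ : ζ ≤ η) :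
    (T.below ζ b).ncard ≤ b.ncard := by
  obtain ⟨f, -, hf⟩ := hT.below_eq_image hζ h.level
  rw [hf]
  exact Set.ncard_image_le h.finite

/-- If there are bad sets on all levels, then there are bad sets on all levels above some finite
set `x`, with exactly one element above each element of `x`. -/
theorem exists_uniform_bad (hT : T.IsOmega1Tree) {F Γ D : ZFSet.{u}} {β : Ordinal.{u}}
    (hp : IsCond T S F Γ β) (h : ∀ η, β ≤ η → η < ω₁ → ∃ b, IsBad T S F Γ D η b) :
    ∃ η₀, β ≤ η₀ ∧ η₀ < ω₁ ∧ ∃ x, IsBad T S F Γ D η₀ x ∧ ∀ η, η₀ ≤ η → η < ω₁ →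
      ∃ b, IsBad T S F Γ D η b ∧ T.below η₀ b = x ∧
        ∀ z ∈ b, ∀ z' ∈ b, ∀ y ∈ T.level η₀, T.Le y z → T.Le y z' → z = z' := by
  have hT' := hT.isTree
  have hβ := hp.isSubtreeFun.top_lt
  -- Otherwise each `m` fails at some level `f m`. A bad set `b` above all these levels restricts to
  -- level `f (b.ncard)` without growing, a contradiction.
  have hm : ∃ m : ℕ, ∀ η, β ≤ η → η < ω₁ → ∃ b, IsBad T S F Γ D η b ∧ b.ncard ≤ m := by
    by_contra! hcon
    choose f hf1 hf2 hf using hcon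
    obtain ⟨θ, hθ, hfθ⟩ := exists_bound_lt_omega_one f hf2
    obtain ⟨b, hb⟩ := h (max θ β) (le_max_right _ _) (max_lt hθ hβ)
    have hle := (hfθ b.ncard).trans (le_max_left θ β)
    exact absurd (hb.ncard_below_le hT' hle) (not_le.2 (hf b.ncard _ (hb.below hT hp hle)))
  classical
  -- For the minimal `m` there is a level `η₀` where no bad set has fewer than `m` elements. So
  -- restricting a bad set of size at most `m` to level `η₀` is injective.
  obtain ⟨m, hm, hmin⟩ : ∃ m : ℕ, (∀ η, β ≤ η → η < ω₁ →
      ∃ b, IsBad T S F Γ D η b ∧ b.ncard ≤ m) ∧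
      ∃ η₀, β ≤ η₀ ∧ η₀ < ω₁ ∧ ∀ b, IsBad T S F Γ D η₀ b → m ≤ b.ncard := by
    refine ⟨Nat.find hm, Nat.find_spec hm, ?_⟩
    rcases Nat.eq_zero_or_pos (Nat.find hm) with h0 | h0
    · exact ⟨β, le_rfl, hβ, fun b _ => by omega⟩
    · have := Nat.find_min hm (Nat.sub_lt h0 one_pos)
      push Not at this
      obtain ⟨η₀, h1, h2, h3⟩ := this
      exact ⟨η₀, h1, h2, fun b hb => by have := h3 b hb; omega⟩
  obtain ⟨η₀, hβη₀, hη₀, hmin⟩ := hmin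
  -- Level `η₀` has only countably many finite subsets, so one of them is the restriction of such
  -- bad sets from every higher level.
  have hx : ∃ x, ∀ η, η₀ ≤ η → η < ω₁ →
      ∃ b, IsBad T S F Γ D η b ∧ T.below η₀ b = x ∧ b.ncard ≤ m := by
    by_contra! hcon
    choose f hf1 hf2 hf using hcon
    have : Countable {t : Set ZFSet.{u} | t.Finite ∧ t ⊆ T.level η₀} :=
      (Set.countable_ofPred_finite_subset (hT.level_countable η₀)).to_subtype
    obtain ⟨θ, hθ, hfθ⟩ := exists_bound_lt_omega_one
      (fun t : {t : Set ZFSet.{u} | t.Finite ∧ t ⊆ T.level η₀} => f t.1) fun t => hf2 t.1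
    obtain ⟨b, hb, hbm⟩ := hm (max θ η₀) (hβη₀.trans (le_max_right _ _)) (max_lt hθ hη₀)
    have hb₀ := hb.below hT hp (le_max_right θ η₀)
    have hle : f (T.below η₀ b) ≤ max θ η₀ :=
      (hfθ ⟨T.below η₀ b, hb₀.finite, hb₀.level⟩).trans (le_max_left _ _)
    exact absurd (hb.ncard_below_le hT' hle) (not_le.2 (hbm.trans_lt (hf _ _ (hb.below hT hp hle)
      (hT'.below_below (hf1 _) hle hb.level))))
  obtain ⟨x, hx⟩ := hx
  have hxbad : IsBad T S F Γ D η₀ x := by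
    obtain ⟨b, hb, rfl, -⟩ := hx η₀ le_rfl hη₀
    exact hb.below hT hp le_rfl
  refine ⟨η₀, hβη₀, hη₀, x, hxbad, fun η h1 h2 => ?_⟩
  obtain ⟨b, hb, hbx, hbm⟩ := hx η h1 h2
  refine ⟨b, hb, hbx, ?_⟩
  obtain ⟨f, hf, hfb⟩ := hT'.below_eq_image h1 hb.level
  have hinj : Set.InjOn f b := by
    refine Set.injOn_of_ncard_image_eq (le_antisymm (Set.ncard_image_le hb.finite) ?_) hb.finite
    rw [← hfb, hbx]
    exact hbm.trans (hmin x hxbad)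
  intro z hz z' hz' y hy hyz hyz'
  refine hinj hz hz' ?_
  rw [← hT'.eq_of_level_eq (hb.level z hz).1 hy (hf z hz).1 hyz (hf z hz).2,
    ← hT'.eq_of_level_eq (hb.level z' hz').1 hy (hf z' hz').1 hyz' (hf z' hz').2]

/-- On some level there are no bad sets. -/
theorem exists_level_forall_not_isBad (hTS : IsSuitable T S) {F Γ D : ZFSet.{u}}
    {β : Ordinal.{u}} (hp : IsCond T S F Γ β) (hD : (forcing T S).IsDense D) :
    ∃ η, β ≤ η ∧ η < ω₁ ∧ ∀ b, ¬ IsBad T S F Γ D η b := by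
  have hT := hTS.isTree
  have hT₁ := hTS.isOmega1Tree
  by_contra! hcon
  obtain ⟨η₀, hβη₀, hη₀, x, hx, hxb⟩ := exists_uniform_bad hT₁ hp hcon
  have := hx.finite.to_subtype
  obtain ⟨n, ⟨e⟩⟩ := Finite.exists_equiv_fin x
  let xv : Fin n → ZFSet.{u} := fun i => (e.symm i).1
  have hxv : ∀ i, xv i ∈ x := fun i => (e.symm i).2
  have hxv' : ∀ y ∈ x, ∃ i, xv i = y := fun y hy => ⟨e ⟨y, hy⟩, by simp [xv]⟩
  let B : Ordinal.{u} → Set (Fin n → ZFSet.{u}) := fun η =>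
    {v | (∀ i, v i ∈ T.level η ∧ T.Le (xv i) (v i)) ∧ IsBad T S F Γ D η (Set.range v)}
  have hB : IsTupleTree T xv η₀ B := by
    refine ⟨fun i j h => e.symm.injective (Subtype.ext h), fun i => hx.level _ (hxv i),
      fun η v hv => hv.1, ?_, ?_⟩
    · intro ζ η h1 h2 v hv w hw
      refine ⟨fun i => ⟨(hw i).1, hT.le_of_level_le (hv.1 i).1.1 (hx.level _ (hxv i)) (hw i).1
        (hv.1 i).2 (hw i).2 h1⟩, ?_⟩
      have : Set.range w = T.below ζ (Set.range v) := by
        ext y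
        constructor
        · rintro ⟨i, rfl⟩
          exact ⟨(hw i).1, v i, ⟨i, rfl⟩, (hw i).2⟩
        · rintro ⟨hy, _, ⟨i, rfl⟩, hyv⟩
          exact ⟨i, hT.eq_of_level_eq (hv.1 i).1.1 (hw i).1 hy (hw i).2 hyv⟩
      rw [this]
      exact hv.2.below hT₁ hp h2
    · intro η h1 h2
      obtain ⟨b, hb, hbx, hinj⟩ := hxb η h1 h2
      have : ∀ i, ∃ z ∈ b, T.Le (xv i) z := fun i => by
        have := hxv i
        rw [← hbx] at this
        exact this.2
      choose v hvb hxv₁ using this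
      have hrange : Set.range v = b := by
        ext z
        constructor
        · rintro ⟨i, rfl⟩
          exact hvb i
        · intro hz
          obtain ⟨y, hy, hyz⟩ := hT.exists_level_le (hb.level z hz) h1
          obtain ⟨i, rfl⟩ := hxv' y (by rw [← hbx]; exact ⟨hy, z, hz, hyz⟩)
          exact ⟨i, hinj _ (hvb i) z hz _ hy (hxv₁ i) hyz⟩
      exact ⟨v, fun i => ⟨hb.level _ (hvb i), hxv₁ i⟩, by rwa [hrange]⟩
  rcases Nat.eq_zero_or_pos n with rfl | hn
  -- With `x` empty, badness at a high enough level would require `q` to fail at an element below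
  -- the empty set.
  · obtain ⟨q, hqD, hq⟩ := hD.2 _ hp.mem
    obtain ⟨G, Δ, γ, rfl, hG, hFG, hΓ, hβγ⟩ := exists_of_le hT₁ hp hq
    obtain ⟨v, hv⟩ := hB.nonempty (max γ η₀) (le_max_right _ _)
      (max_lt hG.isSubtreeFun.top_lt hη₀)
    obtain ⟨y, ⟨-, _, ⟨i, rfl⟩, -⟩, -⟩ := hv.2.bad G Δ γ hqD hG hFG hΓ (le_max_left _ _)
    exact i.elim0
  -- Since `x` is admitted, the condition can be made 1 on `x`, and then the full tuple tree can be
  -- promised. The member of `D` found below is 1 on a bad tuple of its own top level.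
  · obtain ⟨B', hB', hBB'⟩ := hB.exists_full hT₁ hη₀
    obtain ⟨h1, h2⟩ := hx.admits.branching hTS hp hx.level
    obtain ⟨G, hG, hFG, hGx⟩ := hp.exists_extension_finite hTS hβη₀ hη₀ hx.finite hx.level h1
      fun z ξ hz _ => h2 z ξ hz
    obtain ⟨G₁, Δ₁, γ₁, hG₁, hGG₁, hΓ₁, hprom⟩ := hG.exists_extension_promise hTS hB' hn
      fun i => hGx _ (hxv i)
    obtain ⟨q, hqD, hq⟩ := hD.2 _ hG₁.mem
    obtain ⟨G₂, Δ₂, γ₂, rfl, hG₂, hGG₂, hΓ₂, -⟩ := exists_of_le hT₁ hG₁ hq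
    obtain ⟨v, hv, hv₁⟩ := hprom G₂ Δ₂ γ₂ hG₂ hGG₂ hΓ₂
    have hv' := hBB' _ hv
    obtain ⟨y, ⟨hy, _, ⟨i, rfl⟩, hyv⟩, hne⟩ := hv'.2.bad G₂ Δ₂ γ₂ hqD hG₂
      (fun z hz => hGG₂ (hGG₁ (hFG hz))) (fun z hz => hΓ₂ (hΓ₁ hz)) le_rfl
    exact hne (hG₂.isSubtreeFun.isOne_of_le hyv (hv₁ i))

/-- For each condition `p` and each dense set `D`, there is a countable subset of `D` below `p`
such that each finite set admitted by `p` is admitted by some member of this countable set. -/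
theorem exists_countable_admits (hTS : IsSuitable T S) {F Γ D : ZFSet.{u}}
    {β : Ordinal.{u}} (hp : IsCond T S F Γ β) (hD : (forcing T S).IsDense D) :
    ∃ E : Set ZFSet.{u}, E.Countable ∧
      (∀ q ∈ E, q ∈ D ∧ (forcing T S).Le q (ZFSet.pair F Γ)) ∧
      ∀ b : Set ZFSet.{u}, b.Finite → Admits T S (ZFSet.pair F Γ) b → ∃ q ∈ E, Admits T S q b := by
  have hT := hTS.isTree
  have hT₁ := hTS.isOmega1Tree
  obtain ⟨η, hβη, hη, hgood⟩ := exists_level_forall_not_isBad hTS hp hD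
  -- On a level `η` without bad sets, an admitted finite `b` has a witness in `D` with top level at
  -- most `η` that is 1 on the restriction of `b`. There are countably many such `b`, and the chosen
  -- witnesses form `E`.
  have key : ∀ b, ∃ G Δ ζ, (b.Finite ∧ b ⊆ T.level η) → Admits T S (ZFSet.pair F Γ) b →
      ZFSet.pair G Δ ∈ D ∧ IsCond T S G Δ ζ ∧ F ⊆ G ∧ Γ ⊆ Δ ∧ ζ ≤ η ∧
        ∀ y ∈ T.below ζ b, IsOne G y := by
    intro b
    by_contra! hcon
    obtain ⟨h1, h2, -⟩ := hcon ∅ ∅ 0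
    refine hgood b ⟨h1.1, h1.2, h2, fun G Δ ζ h3 h4 h5 h6 h7 => ?_⟩
    exact (hcon G Δ ζ).2.2 h3 h4 h5 h6 h7
  choose G Δ ζ hG using key
  let 𝓑 : Set (Set ZFSet.{u}) :=
    {b | (b.Finite ∧ b ⊆ T.level η) ∧ Admits T S (ZFSet.pair F Γ) b}
  refine ⟨(fun b => ZFSet.pair (G b) (Δ b)) '' 𝓑, ?_, ?_, ?_⟩
  · refine Set.Countable.image (Set.Countable.mono ?_
      (Set.countable_ofPred_finite_subset (hT₁.level_countable η))) _
    exact fun b hb => hb.1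
  · rintro _ ⟨b, ⟨hb, hb'⟩, rfl⟩
    obtain ⟨h1, h2, h3, h4, -, -⟩ := hG b hb hb'
    exact ⟨h1, h2.pair_le hp h3 h4⟩
  · intro b hb hbp
    obtain ⟨R, Ξ, hle, hR⟩ := id hbp
    obtain ⟨_, _, ρ, e, hq, hFR, hΓR, hβρ⟩ := exists_of_le hT₁ hp hle
    obtain ⟨rfl, rfl⟩ := ZFSet.pair_inj.1 e
    -- An arbitrary `b` may have elements on many levels. It is lifted to level `max ρ η` inside an
    -- extension of its witness `R`; the restriction of the lift to `η` selects the member of `E`,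
    -- which can then be extended to be 1 on the lift, because the branching of the lift is
    -- compatible with `S`.
    have hθ : max ρ η < ω₁ := max_lt hq.isSubtreeFun.top_lt hη
    obtain ⟨R', hq', hRR'⟩ := hq.exists_extension_top hTS (le_max_left ρ η) hθ
    have hup : ∀ z ∈ b, ∃ z' ∈ T.level (max ρ η), T.Le z z' ∧ IsOne R' z' := by
      intro z hz
      have hz' : IsOne R' z := hRR' (hR z hz)
      obtain ⟨-, α, hα, hzα⟩ := ZFSet.mem_sep.1 (hz'.mem_of_isFunc hq'.isFunc)
      rcases hα.eq_or_lt with rfl | hα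
      · exact ⟨z, hzα, Or.inl rfl, hz'⟩
      · obtain ⟨y, hy, hzy, hy'⟩ := hq'.isSubtreeFun.extend α hα z hzα hz'
        exact ⟨y, hy, hzy.le, hy'⟩
    choose! f hfl hfz hf1 using hup
    have hfp : Admits T S (ZFSet.pair F Γ) (f '' b) := by
      refine ⟨R', Ξ, hq'.pair_le hp (fun z hz => hRR' (hFR hz)) hΓR, ?_⟩
      rintro _ ⟨z, hz, rfl⟩
      exact hf1 z hz
    have hfl' : ∀ z ∈ f '' b, z ∈ T.level (max ρ η) := by
      rintro _ ⟨z, hz, rfl⟩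
      exact hfl z hz
    have hfin : (T.below η (f '' b)).Finite ∧ T.below η (f '' b) ⊆ T.level η :=
      ⟨hT.finite_below (fun z hz => (hfl' z hz).1) (hb.image f), fun y hy => hy.1⟩
    have hadm : Admits T S (ZFSet.pair F Γ) (T.below η (f '' b)) :=
      hfp.of_le hT₁ hp fun y hy => hy.2
    refine ⟨_, ⟨T.below η (f '' b), ⟨hfin, hadm⟩, rfl⟩, ?_⟩
    obtain ⟨h1, h2, h3, h4, h5, h6⟩ := hG _ hfin hadm
    rw [hT.below_below h5 (le_max_right ρ η) hfl'] at h6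
    obtain ⟨G', hG', hGG', hG'b⟩ := h2.exists_extension_finite hTS (h5.trans (le_max_right ρ η)) hθ
      (hb.image f) hfl' h6 fun z ξ hz _ => (hfp.branching hTS hp hfl').2 z ξ hz
    refine Admits.of_le hT₁ h2 (b := f '' b) ⟨G', _, hG'.pair_le h2 hGG' (fun _ h => h), hG'b⟩ ?_
    exact fun z hz => ⟨f z, ⟨z, hz, rfl⟩, hfz z hz⟩

end SplitTree

/-! ### Definability over `H(κ)` and elementary substructures -/

namespace SplitTree

variable {κ : Cardinal.{u}}

theorem H.mem_trans {x y : ZFSet.{u}} (hx : x ∈ H κ) (hy : y ∈ x) : y ∈ H κ := by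
  obtain ⟨t, h1, h2, h3⟩ := hx
  exact ⟨t, h1, h1.subset_of_mem (h2 hy), h3⟩

theorem H.subset {x y : ZFSet.{u}} (hx : x ∈ H κ) (hy : y ⊆ x) : y ∈ H κ := by
  obtain ⟨t, h1, h2, h3⟩ := hx
  exact ⟨t, h1, fun z hz => h2 (hy hz), h3⟩

/-- By regularity, the union of fewer than `κ` transitive sets of size less than `κ` still has size
less than `κ`. -/
theorem H.of_card_lt (hκ : κ.IsRegular) {X : ZFSet.{u}} (hX : ∀ x ∈ X, x ∈ H κ)
    (hc : X.card < κ) : X ∈ H κ := by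
  let e : Shrink.{u} X → X := (equivShrink X).symm
  have ht : ∀ i, ∃ t : ZFSet.{u}, t.IsTransitive ∧ (e i).1 ⊆ t ∧ t.card < κ :=
    fun i => hX _ (e i).2
  choose t ht1 ht2 ht3 using ht
  refine ⟨X ∪ ZFSet.iUnion t, ?_, fun z hz => ZFSet.mem_union.2 (Or.inl hz), ?_⟩
  · intro y hy z hz
    refine ZFSet.mem_union.2 (Or.inr (ZFSet.mem_iUnion.2 ?_))
    rcases ZFSet.mem_union.1 hy with hy | hy
    · refine ⟨equivShrink X ⟨y, hy⟩, ht2 _ ?_⟩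
      simpa [e] using hz
    · obtain ⟨i, hi⟩ := ZFSet.mem_iUnion.1 hy
      exact ⟨i, (ht1 i).subset_of_mem hi hz⟩
  · refine ZFSet.card_union_le.trans_lt (Cardinal.add_lt_of_lt hκ.aleph0_le hc ?_)
    have h := ZFSet.lift_card_iUnion_le_sum_card (f := t)
    rw [Cardinal.lift_id] at h
    exact h.trans_lt (Cardinal.sum_lt_of_isRegular hκ hc ht3)

theorem H.of_countable (hκ : κ.IsRegular) (hκ' : ℵ₀ < κ) {X : ZFSet.{u}}
    (hX : ∀ x ∈ X, x ∈ H κ) (hc : (X : Set ZFSet.{u}).Countable) : X ∈ H κ := by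
  refine H.of_card_lt hκ hX (lt_of_le_of_lt ?_ hκ')
  rw [← Cardinal.lift_le_aleph0, ← ZFSet.cardinalMk_coe_sort, Cardinal.mk_le_aleph0_iff]
  exact hc.to_subtype

theorem H.pair (hκ : κ.IsRegular) (hκ' : ℵ₀ < κ) {x y : ZFSet.{u}} (hx : x ∈ H κ)
    (hy : y ∈ H κ) : ZFSet.pair x y ∈ H κ := by
  refine H.of_countable hκ hκ' (fun z hz => ?_) ?_
  · have hz' : z = {x} ∨ z = {x, y} := by simpa [ZFSet.pair] using hz
    rcases hz' with rfl | rfl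
    · refine H.of_countable hκ hκ' (fun w hw => ?_) ?_
      · rwa [ZFSet.mem_singleton.1 hw]
      · rw [ZFSet.coe_singleton]
        exact Set.countable_singleton _
    · refine H.of_countable hκ hκ' (fun w hw => ?_) ?_
      · rcases ZFSet.mem_pair.1 hw with rfl | rfl
        · exact hx
        · exact hy
      · rw [ZFSet.coe_insert, ZFSet.coe_singleton]
        exact (Set.countable_singleton _).insert _
  · rw [ZFSet.coe_pair]
    exact (Set.countable_singleton _).insert _

theorem H.left_mem_of_pair {x y : ZFSet.{u}} (h : ZFSet.pair x y ∈ H κ) : x ∈ H κ :=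
  H.mem_trans (H.mem_trans h (show ({x} : ZFSet.{u}) ∈ ZFSet.pair x y by simp [ZFSet.pair]))
    (ZFSet.mem_singleton.2 rfl)

theorem H.right_mem_of_pair {x y : ZFSet.{u}} (h : ZFSet.pair x y ∈ H κ) : y ∈ H κ :=
  H.mem_trans (H.mem_trans h (show ({x, y} : ZFSet.{u}) ∈ ZFSet.pair x y by simp [ZFSet.pair]))
    (ZFSet.mem_pair.2 (Or.inr rfl))

/-- A relation on `H(κ)` is definable if it is given by a first-order formula. -/
def IsDef {α : Type} (P : (α → H κ) → Prop) : Prop :=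
  ∃ φ : setLanguage.Formula α, ∀ v, φ.Realize v ↔ P v

namespace IsDef

variable {α : Type}

theorem congr {P Q : (α → H κ) → Prop} (h : IsDef P) (hPQ : ∀ v, P v ↔ Q v) : IsDef Q := by
  obtain ⟨φ, hφ⟩ := h
  exact ⟨φ, fun v => (hφ v).trans (hPQ v)⟩

theorem mem (i j : α) : IsDef fun v : α → H κ => (v i).1 ∈ (v j).1 := by
  let R : setLanguage.Relations 2 := SetRel.mem
  exact ⟨R.formula₂ (Language.Term.var i) (Language.Term.var j),
    fun v => Language.Formula.realize_rel₂.trans Iff.rfl⟩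

theorem eq (i j : α) : IsDef fun v : α → H κ => v i = v j :=
  ⟨Language.Term.equal (Language.Term.var i) (Language.Term.var j), fun v => by simp⟩

theorem and {P Q : (α → H κ) → Prop} (hP : IsDef P) (hQ : IsDef Q) :
    IsDef fun v => P v ∧ Q v := by
  obtain ⟨φ, hφ⟩ := hP
  obtain ⟨ψ, hψ⟩ := hQ
  exact ⟨φ ⊓ ψ, fun v => by rw [Language.Formula.realize_inf, hφ, hψ]⟩

theorem not {P : (α → H κ) → Prop} (hP : IsDef P) : IsDef fun v => ¬ P v := by
  obtain ⟨φ, hφ⟩ := hP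
  exact ⟨φ.not, fun v => by rw [Language.Formula.realize_not, hφ]⟩

theorem or {P Q : (α → H κ) → Prop} (hP : IsDef P) (hQ : IsDef Q) :
    IsDef fun v => P v ∨ Q v := by
  obtain ⟨φ, hφ⟩ := hP
  obtain ⟨ψ, hψ⟩ := hQ
  exact ⟨φ ⊔ ψ, fun v => by rw [Language.Formula.realize_sup, hφ, hψ]⟩

theorem imp {P Q : (α → H κ) → Prop} (hP : IsDef P) (hQ : IsDef Q) :
    IsDef fun v => P v → Q v :=
  (hP.not.or hQ).congr fun _ => imp_iff_not_or.symm

theorem iff {P Q : (α → H κ) → Prop} (hP : IsDef P) (hQ : IsDef Q) :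
    IsDef fun v => P v ↔ Q v :=
  ((hP.imp hQ).and (hQ.imp hP)).congr fun _ => iff_iff_implies_and_implies.symm

theorem forall_fin {n : ℕ} {P : Fin n → (α → H κ) → Prop} (hP : ∀ i, IsDef (P i)) :
    IsDef fun v => ∀ i, P i v := by
  choose φ hφ using hP
  exact ⟨Language.Formula.iInf φ, fun v => by
    rw [Language.Formula.realize_iInf]
    exact forall_congr' fun i => hφ i v⟩

theorem all_tuple {n : ℕ} {P : (α → H κ) → (Fin n → H κ) → Prop}
    (h : IsDef fun w : α ⊕ Fin n → H κ => P (fun a => w (Sum.inl a)) fun i => w (Sum.inr i)) :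
    IsDef fun v => ∀ u, P v u := by
  obtain ⟨φ, hφ⟩ := h
  refine ⟨φ.iAlls (Fin n), fun v => ?_⟩
  rw [Language.Formula.realize_iAlls]
  exact forall_congr' fun u => hφ _

theorem ex {P : (α → H κ) → H κ → Prop}
    (h : IsDef fun w : α ⊕ Unit → H κ => P (fun a => w (Sum.inl a)) (w (Sum.inr ()))) :
    IsDef fun v => ∃ x, P v x := by
  obtain ⟨φ, hφ⟩ := h
  refine ⟨φ.iExs Unit, fun v => ?_⟩
  rw [Language.Formula.realize_iExs]
  constructor
  · rintro ⟨u, hu⟩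
    exact ⟨u (), (hφ _).1 hu⟩
  · rintro ⟨x, hx⟩
    exact ⟨fun _ => x, (hφ _).2 hx⟩

theorem all {P : (α → H κ) → H κ → Prop}
    (h : IsDef fun w : α ⊕ Unit → H κ => P (fun a => w (Sum.inl a)) (w (Sum.inr ()))) :
    IsDef fun v => ∀ x, P v x :=
  (ex (P := fun v x => ¬ P v x) h.not).not.congr fun v => by push Not; rfl

/-- Here and below, transitivity of `H(κ)` makes the notion absolute: a quantifier over `H(κ)` sees
all members of `v i`. -/
theorem eq_empty (i : α) : IsDef fun v : α → H κ => (v i).1 = ∅ :=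
  (all (P := fun v x => x.1 ∉ (v i).1) (not (mem (Sum.inr ()) (Sum.inl i)))).congr fun v => by
    rw [ZFSet.eq_empty]
    exact ⟨fun h y hy => h ⟨y, H.mem_trans (v i).2 hy⟩ hy, fun h y => h y.1⟩

theorem eq_singleton (i j : α) : IsDef fun v : α → H κ => (v i).1 = {(v j).1} :=
  (all (P := fun v x => x.1 ∈ (v i).1 ↔ x = v j)
    (iff (mem (Sum.inr ()) (Sum.inl i)) (eq (Sum.inr ()) (Sum.inl j)))).congr fun v => by
    constructor
    · intro h
      ext y
      rw [ZFSet.mem_singleton]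
      constructor
      · intro hy
        exact congrArg Subtype.val ((h ⟨y, H.mem_trans (v i).2 hy⟩).1 hy)
      · rintro rfl
        exact (h (v j)).2 rfl
    · intro h x
      rw [h, ZFSet.mem_singleton, Subtype.ext_iff]

theorem eq_upair (i j k : α) : IsDef fun v : α → H κ => (v i).1 = {(v j).1, (v k).1} :=
  (all (P := fun v x => x.1 ∈ (v i).1 ↔ x = v j ∨ x = v k)
    (iff (mem (Sum.inr ()) (Sum.inl i)) (or (eq (Sum.inr ()) (Sum.inl j))
    (eq (Sum.inr ()) (Sum.inl k))))).congr fun v => by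
    constructor
    · intro h
      ext y
      rw [ZFSet.mem_pair]
      constructor
      · intro hy
        exact ((h ⟨y, H.mem_trans (v i).2 hy⟩).1 hy).imp (congrArg Subtype.val)
          (congrArg Subtype.val)
      · rintro (rfl | rfl)
        · exact (h (v j)).2 (Or.inl rfl)
        · exact (h (v k)).2 (Or.inr rfl)
    · intro h x
      rw [h, ZFSet.mem_pair, Subtype.ext_iff, Subtype.ext_iff]

theorem eq_pair (i j k : α) : IsDef fun v : α → H κ => (v i).1 = ZFSet.pair (v j).1 (v k).1 :=
  (ex (P := fun v s => ∃ t : H κ, (s.1 = {(v j).1} ∧ t.1 = {(v j).1, (v k).1}) ∧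
      (v i).1 = {s.1, t.1})
    (ex (and (and (eq_singleton (Sum.inl (Sum.inr ())) (Sum.inl (Sum.inl j)))
    (eq_upair (Sum.inr ()) (Sum.inl (Sum.inl j)) (Sum.inl (Sum.inl k))))
    (eq_upair (Sum.inl (Sum.inl i)) (Sum.inl (Sum.inr ())) (Sum.inr ()))))).congr fun v => by
    constructor
    · rintro ⟨s, t, ⟨hs, ht⟩, h⟩
      rw [h, hs, ht]
      rfl
    · intro h
      have hv := (v i).2
      rw [h] at hv
      exact ⟨⟨{(v j).1}, H.mem_trans hv (by simp [ZFSet.pair])⟩,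
        ⟨{(v j).1, (v k).1}, H.mem_trans hv (by simp [ZFSet.pair])⟩, ⟨rfl, rfl⟩, h⟩

theorem pair_mem (i j k : α) : IsDef fun v : α → H κ => ZFSet.pair (v i).1 (v j).1 ∈ (v k).1 :=
  (ex (P := fun v w => w.1 ∈ (v k).1 ∧ w.1 = ZFSet.pair (v i).1 (v j).1)
    (and (mem (Sum.inr ()) (Sum.inl k))
    (eq_pair (Sum.inr ()) (Sum.inl i) (Sum.inl j)))).congr fun v => by
    constructor
    · rintro ⟨w, h1, h2⟩
      rwa [← h2]
    · intro h
      exact ⟨⟨_, H.mem_trans (v k).2 h⟩, h, rfl⟩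

theorem eq_one (i : α) : IsDef fun v : α → H κ => (v i).1 = (1 : Ordinal.{u}).toZFSet :=
  (ex (P := fun v e => e.1 = ∅ ∧ (v i).1 = {e.1})
    (and (eq_empty (Sum.inr ())) (eq_singleton (Sum.inl i) (Sum.inr ())))).congr fun v => by
    have h1 : (1 : Ordinal.{u}).toZFSet = {∅} := by
      rw [← zero_add (1 : Ordinal.{u}), Ordinal.toZFSet_add_one, Ordinal.toZFSet_zero]
      rfl
    rw [h1]
    constructor
    · rintro ⟨e, he, h⟩
      rw [h, he]
    · intro h
      have hv := (v i).2
      rw [h] at hv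
      exact ⟨⟨∅, H.mem_trans hv (ZFSet.mem_singleton.2 rfl)⟩, rfl, h⟩

theorem isOne (i j : α) : IsDef fun v : α → H κ => IsOne (v i).1 (v j).1 :=
  (ex (P := fun v o => o.1 = (1 : Ordinal.{u}).toZFSet ∧ ZFSet.pair (v j).1 o.1 ∈ (v i).1)
    (and (eq_one (Sum.inr ())) (pair_mem (Sum.inl j) (Sum.inr ()) (Sum.inl i)))).congr
    fun v => by
    constructor
    · rintro ⟨o, h1, h2⟩
      rwa [IsOne, ← h1]
    · intro h
      exact ⟨⟨_, H.right_mem_of_pair (H.mem_trans (v i).2 h)⟩, rfl, h⟩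

end IsDef

namespace ElemSub

variable {N N' : ElemSub κ} {α : Type}

/-- Elementarity: a definable property with parameters in `N` which holds of some member of `H(κ)`
holds of some member of `N`. -/
theorem exists_of_isDef {P : (α → H κ) → H κ → Prop}
    (h : IsDef fun w : α ⊕ Unit → H κ => P (fun a => w (Sum.inl a)) (w (Sum.inr ())))
    (v : α → N) (hx : ∃ x, P (fun a => (v a).1) x) : ∃ x : N, P (fun a => (v a).1) x.1 := by
  obtain ⟨φ, hφ⟩ := h
  obtain ⟨x, hx⟩ := hx
  have h1 : (φ.iExs Unit).Realize (N.subtype ∘ v) := by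
    rw [Language.Formula.realize_iExs]
    exact ⟨fun _ => x, (hφ _).2 hx⟩
  rw [N.subtype.map_formula, Language.Formula.realize_iExs] at h1
  obtain ⟨u, hu⟩ := h1
  rw [← N.subtype.map_formula, hφ] at hu
  exact ⟨u (), hu⟩

/-- Isomorphisms of elementary substructures preserve definable properties. -/
theorem iso_iff {P : (α → H κ) → Prop} (hP : IsDef P) (h : N ≃[setLanguage] N') (v : α → N) :
    P (fun a => (v a).1) ↔ P fun a => (h (v a)).1 := by
  obtain ⟨φ, hφ⟩ := hP
  have h1 : φ.Realize (N.subtype ∘ v) ↔ φ.Realize (N'.subtype ∘ (h ∘ v)) := by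
    rw [N.subtype.map_formula, N'.subtype.map_formula,
      Language.StrongHomClass.realize_formula]
  rw [hφ, hφ] at h1
  exact h1

end ElemSub

/-- `E` is enumerated by starting with `e` and iterating the partial function `f`. -/
def IsEnum (f e E : H κ) : Prop :=
  e.1 ∈ E.1 ∧
  (∀ x y z : H κ, ZFSet.pair x.1 y.1 ∈ f.1 → ZFSet.pair x.1 z.1 ∈ f.1 → y = z) ∧
  ∀ X : H κ, e.1 ∈ X.1 →
    (∀ x y : H κ, x.1 ∈ X.1 → y.1 ∈ E.1 → ZFSet.pair x.1 y.1 ∈ f.1 → y.1 ∈ X.1) →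
    ∀ x : H κ, x.1 ∈ E.1 → x.1 ∈ X.1

theorem IsDef.isEnum {α : Type} (i j k : α) :
    IsDef fun v : α → H κ => IsEnum (v i) (v j) (v k) := by
  refine (IsDef.mem _ _).and (IsDef.and ?_ ?_)
  · exact .all (.all (.all (.imp (.pair_mem (Sum.inl (Sum.inl (Sum.inr ()))) (Sum.inl (Sum.inr ()))
      (Sum.inl (Sum.inl (Sum.inl i)))) (.imp (.pair_mem (Sum.inl (Sum.inl (Sum.inr ()))) (Sum.inr ())
      (Sum.inl (Sum.inl (Sum.inl i)))) (.eq (Sum.inl (Sum.inr ())) (Sum.inr ()))))))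
  · refine .all (.imp (.mem (Sum.inl j) (Sum.inr ())) (.imp ?_ ?_))
    · exact .all (.all (.imp (.mem (Sum.inl (Sum.inr ())) (Sum.inl (Sum.inl (Sum.inr ()))))
        (.imp (.mem (Sum.inr ()) (Sum.inl (Sum.inl (Sum.inl k))))
        (.imp (.pair_mem (Sum.inl (Sum.inr ())) (Sum.inr ()) (Sum.inl (Sum.inl (Sum.inl i))))
        (.mem (Sum.inr ()) (Sum.inl (Sum.inl (Sum.inr ()))))))))
    · exact .all (.imp (.mem (Sum.inr ()) (Sum.inl (Sum.inl k))) (.mem (Sum.inr ()) (Sum.inl (Sum.inr ()))))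

/-- Given an injection `i` of `E` into the natural numbers, `e` has the least value and `f` maps
each element to the one with the next larger value. -/
theorem exists_isEnum (hκ : κ.IsRegular) (hκ' : ℵ₀ < κ) (E : H κ)
    (hE : (E.1 : Set ZFSet.{u}).Countable) (hne : E.1.Nonempty) : ∃ f e, IsEnum f e E := by
  obtain ⟨i, hi⟩ := Set.countable_iff_exists_injOn.1 hE
  obtain ⟨e, he, hemin⟩ : ∃ e ∈ E.1, ∀ x ∈ E.1, i e ≤ i x := by
    classical
    have hex : ∃ n, ∃ x ∈ E.1, i x = n := by
      obtain ⟨x, hx⟩ := hne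
      exact ⟨i x, x, hx, rfl⟩
    obtain ⟨e, he, hei⟩ := Nat.find_spec hex
    exact ⟨e, he, fun x hx => hei ▸ Nat.find_min' hex ⟨x, hx, rfl⟩⟩
  let f : ZFSet.{u} := (ZFSet.prod E.1 E.1).sep fun w => ∃ x ∈ E.1, ∃ y ∈ E.1,
    w = ZFSet.pair x y ∧ i x < i y ∧ ∀ z ∈ E.1, i x < i z → i y ≤ i z
  have hf : ∀ {x y}, ZFSet.pair x y ∈ f ↔ x ∈ E.1 ∧ y ∈ E.1 ∧ i x < i y ∧
      ∀ z ∈ E.1, i x < i z → i y ≤ i z := by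
    intro x y
    constructor
    · intro h
      obtain ⟨-, x', hx', y', hy', e, h⟩ := ZFSet.mem_sep.1 h
      obtain ⟨rfl, rfl⟩ := ZFSet.pair_inj.1 e
      exact ⟨hx', hy', h⟩
    · rintro ⟨hx, hy, h⟩
      exact ZFSet.mem_sep.2 ⟨ZFSet.pair_mem_prod.2 ⟨hx, hy⟩, x, hx, y, hy, rfl, h⟩
  have hfH : f ∈ H κ := by
    refine H.of_countable hκ hκ' (fun w hw => ?_) ?_
    · obtain ⟨-, x, hx, y, hy, rfl, -⟩ := ZFSet.mem_sep.1 hw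
      exact H.pair hκ hκ' (H.mem_trans E.2 hx) (H.mem_trans E.2 hy)
    · refine ((hE.prod hE).image fun a => ZFSet.pair a.1 a.2).mono fun w hw => ?_
      obtain ⟨-, x, hx, y, hy, rfl, -⟩ := ZFSet.mem_sep.1 hw
      exact ⟨(x, y), ⟨hx, hy⟩, rfl⟩
  refine ⟨⟨f, hfH⟩, ⟨e, H.mem_trans E.2 he⟩, he, ?_, ?_⟩
  · intro x y z hy hz
    obtain ⟨-, hyE, h1, h2⟩ := hf.1 hy
    obtain ⟨-, hzE, h3, h4⟩ := hf.1 hz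
    exact Subtype.ext (hi hyE hzE (le_antisymm (h2 _ hzE h3) (h4 _ hyE h1)))
  · intro X heX hX
    have key : ∀ n, ∀ x ∈ E.1, i x = n → x ∈ X.1 := by
      intro n
      induction n using Nat.strong_induction_on with
      | _ n ih =>
        rintro x hx rfl
        rcases (hemin x hx).eq_or_lt with h | h
        · rwa [← hi he hx h]
        · have hfin : {z | z ∈ E.1 ∧ i z < i x}.Finite :=
            Set.Finite.of_finite_image ((Set.finite_Iio (i x)).subset
              (by rintro _ ⟨z, hz, rfl⟩; exact hz.2)) (hi.mono fun z hz => hz.1)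
          obtain ⟨z, ⟨hz, hzx⟩, hmax⟩ := Set.exists_max_image _ i hfin ⟨e, he, h⟩
          refine hX ⟨z, H.mem_trans E.2 hz⟩ ⟨x, H.mem_trans E.2 hx⟩ (ih _ hzx z hz rfl) hx
            (hf.2 ⟨hz, hx, hzx, fun w hw hzw => ?_⟩)
          by_contra! hlt
          exact absurd (hmax w ⟨hw, hlt⟩) (not_le.2 hzw)
    exact fun x hx => key _ x.1 hx rfl

namespace ElemSub

variable {N : ElemSub κ}

/-- The members of an enumerated member of `N` belong to `N`. -/
theorem mem_of_isEnum {f e : H κ} {E : N} (h : IsEnum f e E.1) {x : ZFSet.{u}} (hx : x ∈ E.1.1) :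
    ∃ y : N, y.1.1 = x := by
  obtain ⟨f', e', hfe⟩ : ∃ f' e' : N, IsEnum f'.1 e'.1 E.1 := by
    obtain ⟨f', e, hf'⟩ := exists_of_isDef
      (P := fun (v : Unit → H κ) f => ∃ e, IsEnum f e (v ()))
      (.ex (.isEnum (Sum.inl (Sum.inr ())) (Sum.inr ()) (Sum.inl (Sum.inl ())))) (fun _ => E) ⟨f, e, h⟩
    obtain ⟨e', he'⟩ := exists_of_isDef
      (P := fun (v : Fin 2 → H κ) e => IsEnum (v 0) e (v 1))
      (.isEnum (Sum.inl 0) (Sum.inr ()) (Sum.inl 1)) ![f', E] ⟨e, hf'⟩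
    exact ⟨f', e', he'⟩
  obtain ⟨h1, h2, h3⟩ := hfe
  -- `X` is the trace of `N` on `E`. It need not be in `N`, but as a subset of `E` it is in `H(κ)`,
  -- over which the induction clause of `IsEnum` ranges.
  let X : ZFSet.{u} := E.1.1.sep fun x => ∃ y : N, y.1.1 = x
  have hX : X ∈ H κ := H.subset E.1.2 ZFSet.sep_subset
  suffices hxX : x ∈ X from (ZFSet.mem_sep.1 hxX).2
  refine h3 ⟨X, hX⟩ (show e'.1.1 ∈ X from ZFSet.mem_sep.2 ⟨h1, e', rfl⟩) ?_
    ⟨x, H.mem_trans E.1.2 hx⟩ hx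
  intro x y hx hy hxy
  obtain ⟨-, x', hx'⟩ := ZFSet.mem_sep.1 (show x.1 ∈ X from hx)
  obtain ⟨y', hy'⟩ := exists_of_isDef
    (P := fun (v : Fin 2 → H κ) y => ZFSet.pair (v 0).1 y.1 ∈ (v 1).1)
    (.pair_mem (Sum.inl 0) (Sum.inr ()) (Sum.inl 1)) ![x', f'] ⟨y, by
      change ZFSet.pair x'.1.1 y.1 ∈ f'.1.1
      rwa [hx']⟩
  have hy'' : ZFSet.pair x.1 y'.1.1 ∈ f'.1.1 := by
    have h4 : ZFSet.pair x'.1.1 y'.1.1 ∈ f'.1.1 := hy'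
    rwa [hx'] at h4
  exact show y.1 ∈ X from ZFSet.mem_sep.2 ⟨hy, y', congrArg Subtype.val (h2 x y'.1 y hy'' hxy)⟩

theorem mem_of_countable (hκ : κ.IsRegular) (hκ' : ℵ₀ < κ) {E : N}
    (hE : (E.1.1 : Set ZFSet.{u}).Countable) {x : ZFSet.{u}} (hx : x ∈ E.1.1) :
    ∃ y : N, y.1.1 = x := by
  obtain ⟨f, e, h⟩ := exists_isEnum hκ hκ' E.1 hE ⟨x, hx⟩
  exact mem_of_isEnum h hx

theorem exists_pair (p : N) {a b : ZFSet.{u}} (h : p.1.1 = ZFSet.pair a b) :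
    ∃ a' b' : N, a'.1.1 = a ∧ b'.1.1 = b := by
  have hp := p.1.2
  rw [h] at hp
  obtain ⟨a', b', hab⟩ := exists_of_isDef
    (P := fun (v : Unit → H κ) a => ∃ b : H κ, (v ()).1 = ZFSet.pair a.1 b.1)
    (.ex (.eq_pair (Sum.inl (Sum.inl ())) (Sum.inl (Sum.inr ())) (Sum.inr ()))) (fun _ => p)
    ⟨⟨a, H.left_mem_of_pair hp⟩, ⟨b, H.right_mem_of_pair hp⟩, h⟩
  obtain ⟨b'', hab'⟩ := exists_of_isDef
    (P := fun (v : Fin 2 → H κ) b => (v 0).1 = ZFSet.pair (v 1).1 b.1)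
    (.eq_pair (Sum.inl 0) (Sum.inl 1) (Sum.inr ())) ![p, a'] ⟨b', hab⟩
  have h' : p.1.1 = ZFSet.pair a'.1.1 b''.1.1 := hab'
  rw [h] at h'
  obtain ⟨h1, h2⟩ := ZFSet.pair_inj.1 h'
  exact ⟨a', b'', h1.symm, h2.symm⟩

end ElemSub

end SplitTree

/-! ### Conditions with a limit top level -/

namespace SplitTree

variable {T : SetTree.{u}} {S : Set ℕ}

/-- Above each element with value `1` there is an element of a given level which can be added to
an admitted set. -/
theorem Admits.exists_insert (hTS : IsSuitable T S) {F Γ : ZFSet.{u}} {β δ ξ : Ordinal.{u}}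
    (hp : IsCond T S F Γ β) (hδ : δ < ω₁) {A : Set ZFSet.{u}}
    (h : Admits T S (ZFSet.pair F Γ) A) {z : ZFSet.{u}} (hz : z ∈ T.level ξ) (hξ : ξ < δ)
    (hFz : IsOne F z) :
    ∃ a ∈ T.level δ, T.Lt z a ∧ Admits T S (ZFSet.pair F Γ) (insert a A) := by
  have hT := hTS.isTree
  obtain ⟨G, Δ, hle, hG⟩ := h
  obtain ⟨_, _, ρ, e, hq, hFG, hΓ, -⟩ := exists_of_le hTS.isOmega1Tree hp hle
  obtain ⟨rfl, rfl⟩ := ZFSet.pair_inj.1 e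
  obtain ⟨G', hG', hGG'⟩ := hq.exists_extension_top hTS (le_max_left ρ δ)
    (max_lt hq.isSubtreeFun.top_lt hδ)
  obtain ⟨y, hy, hzy, hy1⟩ := hG'.isSubtreeFun.extend ξ (hξ.trans_le (le_max_right ρ δ)) z hz
    (hGG' (hFG hFz))
  obtain ⟨a, ha, hay⟩ := hT.exists_level_le hy (le_max_right ρ δ)
  refine ⟨a, ha, hT.lt_of_level_lt hy.1 hz ha hzy.le hay hξ, G', Δ,
    hG'.pair_le hp (fun z hz => hGG' (hFG hz)) hΓ, ?_⟩
  rintro b (rfl | hb)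
  · exact hG'.isSubtreeFun.isOne_of_le hay hy1
  · exact hGG' (hG b hb)

/-- A tuple from a fulfilled promise can be added to an admitted set. -/
theorem Admits.exists_union_tuple (hTS : IsSuitable T S) {F Γ U V Y : ZFSet.{u}}
    {β δ γ : Ordinal.{u}} {m : ℕ} (hp : IsCond T S F Γ β) (hβ : β < δ) (hδ : δ < ω₁)
    {A t : Set ZFSet.{u}} (hA : A.Finite) (hAδ : ∀ z ∈ A, z ∈ T.level δ) (ht : t.Finite)
    (htδ : ∀ z ∈ t, z ∈ T.level δ) (h : Admits T S (ZFSet.pair F Γ) A)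
    (hU : IsGenPromise T m γ U) (hγ : γ ≤ β) (hF : Fulfills T F β m U)
    (hV : ZFSet.pair δ.toZFSet V ∈ U) (hY : Y ∈ V) :
    ∃ v : Fin m → ZFSet.{u}, tuple v ∈ Y ∧ (∀ i, v i ∈ T.level δ ∧ v i ∉ t) ∧
      Admits T S (ZFSet.pair F Γ) (A ∪ Set.range v) := by
  have hT := hTS.isTree
  obtain ⟨v, w, hv, hvδ, hw, hinj⟩ := exists_tuple_above hT hU hγ hF hβ hV hY
    (s := T.below β A ∪ T.below β t)
    ((hT.finite_below (fun z hz => (hAδ z hz).1) hA).union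
      (hT.finite_below (fun z hz => (htδ z hz).1) ht))
    (by rintro z (hz | hz) <;> exact hz.1)
  have hwv : ∀ i, ∀ y ∈ T.level β, T.Le y (v i) → y = w i := fun i y hy hyv =>
    hT.eq_of_level_eq (hvδ i).1 hy (hw i).1 hyv (hw i).2.1
  -- The witness that `A` is admitted serves only to show that its branching is compatible. The
  -- condition extended below is `(F, Γ)` itself, since it is `F` that is known to fulfil `U`, which
  -- need not belong to `Γ`.
  obtain ⟨h1, h2⟩ := h.branching hTS hp hAδ
  refine ⟨v, hv, fun i => ⟨hvδ i, fun hi => (hw i).2.2.2 (Or.inr ⟨(hw i).1, v i, hi,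
    (hw i).2.1⟩)⟩, ?_⟩
  obtain ⟨G, hG, hFG, hGb⟩ := hp.exists_extension_finite hTS hβ.le hδ
    (hA.union (Set.finite_range v))
    (by
      rintro z (hz | ⟨i, rfl⟩)
      · exact hAδ z hz
      · exact hvδ i)
    (by
      rintro y ⟨hy, z, hz | ⟨i, rfl⟩, hyz⟩
      · exact h1 y ⟨hy, z, hz, hyz⟩
      · rw [hwv i y hy hyz]
        exact (hw i).2.2.1)
    (fun z ξ hz hβξ hξ => by
      obtain ⟨k, hk, hk'⟩ := h2 z ξ hz hξ
      refine ⟨k, hk, hT.encard_branching_union_le ?_ ?_ ?_ hz hβξ ?_ hk'⟩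
      · rintro _ ⟨i, rfl⟩
        exact (hvδ i).1
      · rintro y ⟨hy, _, ⟨i, rfl⟩, hyz⟩ hyA
        rw [hwv i y hy hyz] at hyA
        exact (hw i).2.2.2 (Or.inl hyA)
      · rintro _ ⟨i, rfl⟩ _ ⟨j, rfl⟩ y hy hyi hyj
        rw [hinj ((hwv i y hy hyi).symm.trans (hwv j y hy hyj))]
      · exact_mod_cast one_le_two.trans (hTS.two_le k hk))
  exact ⟨G, Γ, hG.pair_le hp hFG (fun _ h => h), hGb⟩

/-- An approximation of a condition with top level `δ`: two conditions with the same function, and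
a set of elements of level `δ`. -/
structure Approx where
  F : ZFSet.{u}
  Γ : ZFSet.{u}
  Γ' : ZFSet.{u}
  β : Ordinal.{u}
  A : Set ZFSet.{u}

/-- The requirements on an approximation. -/
structure Approx.Good (T : SetTree.{u}) (S : Set ℕ) (M : ZFSet.{u} → ZFSet.{u} → ZFSet.{u} → Prop)
    (δ : Ordinal.{u}) (s : Approx.{u}) : Prop where
  mem : M s.F s.Γ s.Γ'
  cond : IsCond T S s.F s.Γ s.β
  cond' : IsCond T S s.F s.Γ' s.β
  lt : s.β < δ
  finite : s.A.Finite
  level : ∀ a ∈ s.A, a ∈ T.level δ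
  admits : Admits T S (ZFSet.pair s.F s.Γ) s.A

/-- The order of approximations. -/
structure Approx.Below (s s' : Approx.{u}) : Prop where
  F : s.F ⊆ s'.F
  Γ : s.Γ ⊆ s'.Γ
  Γ' : s.Γ' ⊆ s'.Γ'
  A : s.A ⊆ s'.A

theorem Approx.Good.fulfills {M : ZFSet.{u} → ZFSet.{u} → ZFSet.{u} → Prop} {δ : Ordinal.{u}}
    {s : Approx.{u}} (h : s.Good T S M δ) {U : ZFSet.{u}} (hU : U ∈ s.Γ ∨ U ∈ s.Γ') :
    ∃ (m : ℕ) (γ : Ordinal.{u}), γ ≤ s.β ∧ IsGenPromise T m γ U ∧ Fulfills T s.F s.β m U := by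
  rcases hU with hU | hU
  · exact h.cond.fulfills U hU
  · exact h.cond'.fulfills U hU

/-- The limit of a sequence of approximations is a condition. -/
theorem exists_isCond_of_seq (hTS : IsSuitable T S)
    {M : ZFSet.{u} → ZFSet.{u} → ZFSet.{u} → Prop} {δ : Ordinal.{u}} (hδ : δ < ω₁)
    (hδ' : ∀ ξ < δ, ξ + 1 < δ) {s : ℕ → Approx.{u}} (hs : ∀ n, (s n).Good T S M δ)
    (hmono : ∀ n m, n ≤ m → (s n).Below (s m)) (htop : ∀ ξ < δ, ∃ n, ξ ≤ (s n).β)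
    (hext : ∀ n z, ∀ ξ < δ, z ∈ T.level ξ → IsOne (s n).F z → ∃ m, ∃ a ∈ (s m).A, T.Lt z a)
    (hprom : ∀ n U V Y, ∀ t : Finset ZFSet.{u}, (U ∈ (s n).Γ ∨ U ∈ (s n).Γ') →
      ZFSet.pair δ.toZFSet V ∈ U → Y ∈ V → (∀ z ∈ t, z ∈ T.level δ) →
      ∀ m γ, γ ≤ (s n).β → IsGenPromise T m γ U →
      ∃ k, ∃ v : Fin m → ZFSet.{u}, tuple v ∈ Y ∧ ∀ i, v i ∈ (s k).A ∧ v i ∉ t) :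
    ∃ H Ξ, IsCond T S H Ξ δ ∧ ∀ n, (s n).F ⊆ H ∧ (s n).Γ ⊆ Ξ ∧ (s n).Γ' ⊆ Ξ := by
  have hT := hTS.isTree
  have hT₁ := hTS.isOmega1Tree
  let W : Set ZFSet.{u} := {x | ∃ n, IsOne (s n).F x ∨ x ∈ (s n).A}
  have hβmono : ∀ n m, n ≤ m → (s n).β ≤ (s m).β := fun n m h =>
    top_le_of_subset hT₁ (hs n).cond.isSubtreeFun (hs m).cond.isSubtreeFun (hmono n m h).F
  have hstab : ∀ n m x ξ, x ∈ T.level ξ → ξ ≤ (s n).β → IsOne (s m).F x → IsOne (s n).F x := by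
    intro n m x ξ hx hξ h
    rcases le_total m n with hmn | hmn
    · exact (hmono m n hmn).F h
    · exact (isOne_iff_of_subset (hs n).cond.isFunc (hs m).cond.isFunc (hmono n m hmn).F
        ((SetTree.mem_upTo hx).2 hξ)).2 h
  have hWlt : ∀ n x ξ, x ∈ T.level ξ → ξ ≤ (s n).β → (x ∈ W ↔ IsOne (s n).F x) := by
    intro n x ξ hx hξ
    refine ⟨?_, fun h => ⟨n, Or.inl h⟩⟩
    rintro ⟨m, h | h⟩
    · exact hstab n m x ξ hx hξ h
    · exact absurd (hξ.trans_lt (hs n).lt) (SetTree.level_unique ((hs m).level x h) hx ▸ lt_irrefl _)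
  have hWtop : ∀ x ∈ T.level δ, x ∈ W → ∃ n, x ∈ (s n).A := by
    rintro x hx ⟨n, h | h⟩
    · exact absurd ((SetTree.mem_upTo hx).1 (h.mem_of_isFunc (hs n).cond.isFunc))
        (not_le.2 (hs n).lt)
    · exact ⟨n, h⟩
  let H : ZFSet.{u} := mkFun T δ W
  have hH : ∀ {x ξ}, x ∈ T.level ξ → ξ ≤ δ → (IsOne H x ↔ x ∈ W) := fun hx hξ => by
    rw [isOne_mkFun, SetTree.mem_upTo hx]
    exact and_iff_right hξ
  have hHn : ∀ {n x ξ}, x ∈ T.level ξ → ξ ≤ (s n).β → (IsOne H x ↔ IsOne (s n).F x) :=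
    fun {n x ξ} hx hξ => (hH hx (hξ.trans (hs n).lt.le)).trans (hWlt n x ξ hx hξ)
  have hlevel : ∀ {x}, IsOne H x → ∃ ξ ≤ δ, x ∈ T.level ξ := fun hx =>
    (ZFSet.mem_sep.1 (isOne_mkFun.1 hx).1).2
  have hsub : ∀ n, (s n).F ⊆ H := fun n =>
    subset_mkFun (hs n).cond.isFunc (hs n).lt.le fun x hx => by
      obtain ⟨-, ξ, hξ, hx⟩ := ZFSet.mem_sep.1 hx
      exact (hWlt n x ξ hx hξ).symm
  -- At a stage whose top level has passed `ξ`, the set containing `x` is still admitted, so the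
  -- function of that stage is already 1 at `y`.
  have hbelow : ∀ n x ξ y, x ∈ (s n).A → ξ < δ → y ∈ T.level ξ → T.Lt y x → IsOne H y := by
    intro n x ξ y hx hξ hy hyx
    obtain ⟨k, hk⟩ := htop ξ hξ
    have hk' : ξ ≤ (s (max n k)).β := hk.trans (hβmono _ _ (le_max_right n k))
    obtain ⟨G, Δ, hle, hG⟩ := (hs (max n k)).admits
    obtain ⟨_, _, ρ, e, hq, hFG, -, -⟩ := exists_of_le hT₁ (hs _).cond hle
    obtain ⟨rfl, rfl⟩ := ZFSet.pair_inj.1 e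
    exact (hHn hy hk').2 ((isOne_iff_of_subset (hs _).cond.isFunc hq.isFunc hFG
      ((SetTree.mem_upTo hy).2 hk')).2
      (hq.isSubtreeFun.downward _ _ hyx (hG x ((hmono _ _ (le_max_left n k)).A hx))))
  let Ξ : ZFSet.{u} := ZFSet.iUnion fun n => (s n).Γ ∪ (s n).Γ'
  have hΞ : ∀ {U}, U ∈ Ξ ↔ ∃ n, U ∈ (s n).Γ ∨ U ∈ (s n).Γ' := fun {U} => by
    simp [Ξ]
  refine ⟨H, Ξ, ⟨⟨⟨hδ, isFunc_mkFun δ W, ?_, ?_, ?_⟩, ?_⟩, ?_, ?_⟩, fun n => ⟨hsub n,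
    fun U hU => hΞ.2 ⟨n, Or.inl hU⟩, fun U hU => hΞ.2 ⟨n, Or.inr hU⟩⟩⟩
  · exact fun x hx => hsub 0 ((hs 0).cond.isSubtreeFun.root x hx)
  · intro x y hyx hx
    obtain ⟨ξ, hξ, hxξ⟩ := hlevel hx
    obtain ⟨ζ, hζ, hy⟩ := hT.exists_level_of_lt hxξ hyx
    rcases hξ.eq_or_lt with rfl | hξ
    · obtain ⟨n, hn⟩ := hWtop x hxξ ((hH hxξ le_rfl).1 hx)
      exact hbelow n x ζ y hn hζ hy hyx
    · obtain ⟨n, hn⟩ := htop ξ hξ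
      exact hsub n ((hs n).cond.isSubtreeFun.downward _ _ hyx ((hHn hxξ hn).1 hx))
  · intro α hα x hx hx1
    obtain ⟨n, hn⟩ := htop α hα
    obtain ⟨m, a, ha, hxa⟩ := hext n x α hα hx ((hHn hx hn).1 hx1)
    have haδ := (hs m).level a ha
    exact ⟨a, haδ, hxa, (hH haδ le_rfl).2 ⟨m, Or.inr ha⟩⟩
  · intro α hα x hx hx1
    -- As `δ` is closed under successors, some stage decides all immediate successors of `x`, and
    -- splitting is inherited from it.
    obtain ⟨n, hn⟩ := htop (α + 1) (hδ' α hα)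
    have hαn : α < (s n).β := (Order.lt_add_one_iff.2 le_rfl).trans_le hn
    obtain ⟨k, hk, hk'⟩ := (hs n).cond.isSplittingFun.splitting α hαn x hx ((hHn hx hαn.le).1 hx1)
    refine ⟨k, hk, hk' ▸ congrArg Set.encard ?_⟩
    ext y
    exact and_congr_right fun hy => hHn ((hT.mem_imm_iff hx).1 hy).1 hn
  · have : (Ξ : Set ZFSet.{u}) = ⋃ n, ((s n).Γ ∪ (s n).Γ' : Set ZFSet.{u}) := by
      ext U
      exact hΞ.trans (by simp)
    rw [this]
    exact Set.countable_iUnion fun n => (hs n).cond.countable.union (hs n).cond'.countable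
  · intro U hU
    obtain ⟨n, hn⟩ := hΞ.1 hU
    obtain ⟨m, γ, hγ, hUm, -⟩ := (hs n).fulfills hn
    refine ⟨m, γ, hγ.trans (hs n).lt.le, hUm, fun t ht V hV Y hY => ?_⟩
    obtain ⟨k, v, hv, hvk⟩ := hprom n U V Y t hn hV hY ht m γ hγ hUm
    exact ⟨v, hv, fun i => ⟨(hvk i).2, (hH ((hs k).level _ (hvk i).1) le_rfl).2
      ⟨k, Or.inr (hvk i).1⟩⟩⟩

/-- A condition with top level `δ` which is below a sequence of pairs of conditions which meets
countably many dense sets. -/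
theorem exists_isCond_of_dense (hTS : IsSuitable T S)
    {M : ZFSet.{u} → ZFSet.{u} → ZFSet.{u} → Prop} {δ : Ordinal.{u}} (hδ : δ < ω₁)
    (hδ' : ∀ ξ < δ, ξ + 1 < δ)
    (hM : ∀ F Γ Γ', M F Γ Γ' → ∃ β < δ, IsCond T S F Γ β ∧ IsCond T S F Γ' β)
    (hcount : {U | ∃ F Γ Γ', M F Γ Γ' ∧ (U ∈ Γ ∨ U ∈ Γ')}.Countable)
    {ι : Type*} [Countable ι] (D : ι → Set ZFSet.{u})
    (htop : ∀ ξ < δ, ∃ i, ∀ F Γ β, ZFSet.pair F Γ ∈ D i → IsCond T S F Γ β → ξ ≤ β)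
    (hD : ∀ i F Γ Γ' b, M F Γ Γ' → b.Finite → Admits T S (ZFSet.pair F Γ) b →
      ∃ G Δ Δ', M G Δ Δ' ∧ F ⊆ G ∧ Γ ⊆ Δ ∧ Γ' ⊆ Δ' ∧ ZFSet.pair G Δ ∈ D i ∧
        Admits T S (ZFSet.pair G Δ) b)
    {F₁ Γ₁ Γ₁' : ZFSet.{u}} (h₀ : M F₁ Γ₁ Γ₁') :
    ∃ H Ξ, IsCond T S H Ξ δ ∧ F₁ ⊆ H ∧ Γ₁ ⊆ Ξ ∧ Γ₁' ⊆ Ξ ∧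
      ∀ i, ∃ F Γ Γ', M F Γ Γ' ∧ ZFSet.pair F Γ ∈ D i ∧ F ⊆ H ∧ Γ ⊆ Ξ ∧ Γ' ⊆ Ξ := by
  have hT := hTS.isTree
  have hT₁ := hTS.isOmega1Tree
  let 𝒰 : Set ZFSet.{u} := {U | ∃ F Γ Γ', M F Γ Γ' ∧ (U ∈ Γ ∨ U ∈ Γ')}
  have h𝒰 : ∀ U ∈ 𝒰, ∃ (m : ℕ) (γ : Ordinal.{u}), γ < δ ∧ IsGenPromise T m γ U := by
    rintro U ⟨F, Γ, Γ', h, hU⟩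
    obtain ⟨β, hβ, h1, h2⟩ := hM F Γ Γ' h
    rcases hU with hU | hU
    · obtain ⟨m, γ, hγ, h, -⟩ := h1.fulfills U hU
      exact ⟨m, γ, hγ.trans_lt hβ, h⟩
    · obtain ⟨m, γ, hγ, h, -⟩ := h2.fulfills U hU
      exact ⟨m, γ, hγ.trans_lt hβ, h⟩
  let 𝒴 : Set ZFSet.{u} := ⋃ U ∈ 𝒰, ⋃ V ∈ {V | ZFSet.pair δ.toZFSet V ∈ U}, (V : Set ZFSet.{u})
  have h𝒴 : 𝒴.Countable := by
    refine hcount.biUnion fun U hU => ?_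
    obtain ⟨m, γ, hγ, h⟩ := h𝒰 U hU
    refine Set.Countable.biUnion (Set.Subsingleton.countable ?_) fun V hV => h.countable δ V hV
    exact fun V hV V' hV' => (h.existsUnique δ hγ.le hδ).unique hV hV'
  have : Countable 𝒴 := h𝒴.to_subtype
  have : Countable (T.upTo δ : Set ZFSet.{u}) := (hT₁.countable_upTo hδ).to_subtype
  have : Countable {t : Set ZFSet.{u} | t.Finite ∧ t ⊆ T.level δ} :=
    (Set.countable_ofPred_finite_subset (hT₁.level_countable δ)).to_subtype
  -- The tasks: enter `D i` while keeping `A` admitted, put an element of level `δ` above `z`, or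
  -- add a tuple of `Y` outside `t`. They recur because their premises may become true only at late
  -- stages.
  let R : ι ⊕ (T.upTo δ : Set ZFSet.{u}) ⊕ 𝒴 × {t : Set ZFSet.{u} | t.Finite ∧ t ⊆ T.level δ} →
      Approx.{u} → Approx.{u} → Prop := fun i s s' =>
    match i with
    | .inl i => ZFSet.pair s'.F s'.Γ ∈ D i
    | .inr (.inl z) => ∀ ξ < δ, z.1 ∈ T.level ξ → IsOne s.F z.1 → ∃ a ∈ s'.A, T.Lt z.1 a
    | .inr (.inr (Y, t)) => ∀ U V m γ, U ∈ s.Γ ∨ U ∈ s.Γ' → ZFSet.pair δ.toZFSet V ∈ U →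
        Y.1 ∈ V → IsGenPromise T m γ U →
        ∃ v : Fin m → ZFSet.{u}, tuple v ∈ Y.1 ∧ ∀ i, v i ∈ s'.A ∧ v i ∉ t.1
  obtain ⟨β₀, hβ₀, hc, hc'⟩ := hM _ _ _ h₀
  obtain ⟨s, hs₀, hs, hmono, hR⟩ := exists_seq_forall_exists_ge (Approx.Good T S M δ)
    Approx.Below (fun s => ⟨fun _ h => h, fun _ h => h, fun _ h => h, fun _ h => h⟩)
    (fun a b c h1 h2 => ⟨fun _ h => h2.F (h1.F h), fun _ h => h2.Γ (h1.Γ h),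
      fun _ h => h2.Γ' (h1.Γ' h), fun _ h => h2.A (h1.A h)⟩)
    R ⟨F₁, Γ₁, Γ₁', β₀, ∅⟩
    ⟨h₀, hc, hc', hβ₀, Set.finite_empty, by simp, F₁, Γ₁, hc.pair_le hc (fun _ h => h)
      (fun _ h => h), by simp⟩
    (by
      rintro (i | z | ⟨Y, t⟩) s hs
      · obtain ⟨G, Δ, Δ', h1, h2, h3, h4, h5, h6⟩ :=
          hD i _ _ _ s.A hs.mem hs.finite hs.admits
        obtain ⟨β, hβ, h7, h8⟩ := hM _ _ _ h1
        exact ⟨⟨G, Δ, Δ', β, s.A⟩, ⟨h1, h7, h8, hβ, hs.finite, hs.level, h6⟩,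
          ⟨h2, h3, h4, fun _ h => h⟩, h5⟩
      · by_cases hz : ∃ ξ < δ, z.1 ∈ T.level ξ ∧ IsOne s.F z.1
        · obtain ⟨ξ, hξ, hzξ, hz1⟩ := hz
          obtain ⟨a, ha, hza, h⟩ := hs.admits.exists_insert hTS hs.cond hδ hzξ hξ hz1
          refine ⟨⟨s.F, s.Γ, s.Γ', s.β, insert a s.A⟩,
            ⟨hs.mem, hs.cond, hs.cond', hs.lt, hs.finite.insert a, ?_, h⟩,
            ⟨fun _ h => h, fun _ h => h, fun _ h => h, Set.subset_insert a s.A⟩,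
            fun _ _ _ _ => ⟨a, Set.mem_insert a s.A, hza⟩⟩
          rintro b (rfl | hb)
          · exact ha
          · exact hs.level b hb
        · exact ⟨s, hs, ⟨fun _ h => h, fun _ h => h, fun _ h => h, fun _ h => h⟩,
            fun ξ h1 h2 h3 => absurd ⟨ξ, h1, h2, h3⟩ hz⟩
      · by_cases hU : ∃ U V, (U ∈ s.Γ ∨ U ∈ s.Γ') ∧ ZFSet.pair δ.toZFSet V ∈ U ∧ Y.1 ∈ V
        · obtain ⟨U, V, hU, hV, hY⟩ := hU
          obtain ⟨m, γ, hγ, hP, hF⟩ := hs.fulfills hU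
          obtain ⟨v, hv, hvδ, hadm⟩ := hs.admits.exists_union_tuple hTS hs.cond hs.lt hδ hs.finite
            hs.level t.2.1 (fun z hz => t.2.2 hz) hP hγ hF hV hY
          -- The task names only `Y`, not the promise containing it; any tuple in `Y` shows that all
          -- such promises have the same dimension.
          have htuple : ∀ {n : ℕ} {γ' : Ordinal.{u}} {U' V' : ZFSet.{u}},
              ZFSet.pair δ.toZFSet V' ∈ U' → Y.1 ∈ V' → IsGenPromise T n γ' U' → m = n := by
            intro n γ' U' V' hV' hY' hP'
            obtain ⟨x, -, -, hx⟩ := hP'.derived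
            obtain ⟨w, hw, -⟩ := (hx δ V' hV' Y.1 hY').2.2 _ hv
            exact dim_eq_of_tuple_eq hw
          refine ⟨⟨s.F, s.Γ, s.Γ', s.β, s.A ∪ Set.range v⟩, ⟨hs.mem, hs.cond, hs.cond', hs.lt,
            hs.finite.union (Set.finite_range v), ?_, hadm⟩,
            ⟨fun _ h => h, fun _ h => h, fun _ h => h, Set.subset_union_left⟩, ?_⟩
          · rintro z (hz | ⟨i, rfl⟩)
            · exact hs.level z hz
            · exact (hvδ i).1
          · intro U' V' n γ' _ hV' hY' hP'
            obtain rfl := htuple hV' hY' hP'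
            exact ⟨v, hv, fun i => ⟨Or.inr ⟨i, rfl⟩, (hvδ i).2⟩⟩
        · exact ⟨s, hs, ⟨fun _ h => h, fun _ h => h, fun _ h => h, fun _ h => h⟩,
            fun U V m γ h1 h2 h3 => absurd ⟨U, V, h1, h2, h3⟩ hU⟩)
  obtain ⟨H, Ξ, hH, hsH⟩ := exists_isCond_of_seq hTS hδ hδ' hs hmono
    (fun ξ hξ => by
      obtain ⟨i, hi⟩ := htop ξ hξ
      obtain ⟨n, -, hn⟩ := hR (.inl i) 0
      exact ⟨n + 1, hi _ _ _ hn (hs (n + 1)).cond⟩)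
    (fun n z ξ hξ hz hz1 => by
      obtain ⟨m, hm, h⟩ := hR (.inr (.inl ⟨z, (SetTree.mem_upTo hz).2 hξ.le⟩)) n
      exact ⟨m + 1, h ξ hξ hz ((hmono n m hm).F hz1)⟩)
    (fun n U V Y t hU hV hY ht m γ hγ hP => by
      obtain ⟨k, hk, h⟩ := hR (.inr (.inr (⟨Y, Set.mem_biUnion
        (show U ∈ 𝒰 from ⟨_, _, _, (hs n).mem, hU⟩) (Set.mem_biUnion
        (show V ∈ {V | ZFSet.pair δ.toZFSet V ∈ U} from hV) hY)⟩,
        ⟨t, t.finite_toSet, fun z hz => ht z hz⟩))) n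
      exact ⟨k + 1, h U V m γ (hU.imp (fun h => (hmono n k hk).Γ h) fun h => (hmono n k hk).Γ' h)
        hV hY hP⟩)
  refine ⟨H, Ξ, hH, ?_, ?_, ?_, fun i => ?_⟩
  · have := (hsH 0).1
    rwa [hs₀] at this
  · have := (hsH 0).2.1
    rwa [hs₀] at this
  · have := (hsH 0).2.2
    rwa [hs₀] at this
  · obtain ⟨n, -, hn⟩ := hR (.inl i) 0
    exact ⟨_, _, _, (hs (n + 1)).mem, hn, hsH (n + 1)⟩

end SplitTree

/-! ### Reflection to countable submodels, with the tree seen only through the poset -/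

namespace SplitTree

variable {κ : Cardinal.{u}} {T : SetTree.{u}} {S : Set ℕ}

/-- Some member of `r` witnesses that a condition below `q` takes the value `1` on `b`. -/
def AdmitsIn {m : ℕ} (r q : H κ) (b : Fin m → H κ) : Prop :=
  ∃ s G Δ : H κ, s.1 = ZFSet.pair G.1 Δ.1 ∧ ZFSet.pair s.1 q.1 ∈ r.1 ∧ ∀ i, IsOne G.1 (b i).1

/-- The first coordinate of `q` is defined at `z`. -/
def DomAt (q z : H κ) : Prop :=
  ∃ F Γ i : H κ, q.1 = ZFSet.pair F.1 Γ.1 ∧ ZFSet.pair z.1 i.1 ∈ F.1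

/-- The first coordinate of `q` has the value `1` at `z`. -/
def OneAt (q z : H κ) : Prop :=
  ∃ F Γ : H κ, q.1 = ZFSet.pair F.1 Γ.1 ∧ IsOne F.1 z.1

/-- Two conditions are compatible with respect to the order `r`. -/
def CompatIn (r p q : H κ) : Prop :=
  ∃ s : H κ, ZFSet.pair s.1 p.1 ∈ r.1 ∧ ZFSet.pair s.1 q.1 ∈ r.1

/-- `D` is a dense subset of the poset with underlying set `c` and order `r`. -/
def DenseIn (c r D : H κ) : Prop :=
  (∀ p : H κ, p.1 ∈ D.1 → p.1 ∈ c.1) ∧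
    ∀ p : H κ, p.1 ∈ c.1 → ∃ d : H κ, d.1 ∈ D.1 ∧ ZFSet.pair d.1 p.1 ∈ r.1

namespace IsDef

variable {α β : Type}

theorem comp {P : (α → H κ) → Prop} (h : IsDef P) (g : α → β) :
    IsDef fun v : β → H κ => P fun a => v (g a) := by
  obtain ⟨φ, hφ⟩ := h
  exact ⟨φ.relabel g, fun v => by rw [Language.Formula.realize_relabel]; exact hφ _⟩

theorem admitsIn {m : ℕ} (i j : α) (k : Fin m → α) :
    IsDef fun v : α → H κ => AdmitsIn (v i) (v j) fun l => v (k l) :=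
  .ex (.ex (.ex (.and (.eq_pair (Sum.inl (Sum.inl (Sum.inr ()))) (Sum.inl (Sum.inr ()))
    (Sum.inr ())) (.and (.pair_mem (Sum.inl (Sum.inl (Sum.inr ())))
    (Sum.inl (Sum.inl (Sum.inl j))) (Sum.inl (Sum.inl (Sum.inl i))))
    (.forall_fin fun l => .isOne (Sum.inl (Sum.inr ())) (Sum.inl (Sum.inl (Sum.inl (k l)))))))))

theorem domAt (i j : α) : IsDef fun v : α → H κ => DomAt (v i) (v j) :=
  .ex (.ex (.ex (.and (.eq_pair (Sum.inl (Sum.inl (Sum.inl i))) (Sum.inl (Sum.inl (Sum.inr ())))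
    (Sum.inl (Sum.inr ()))) (.pair_mem (Sum.inl (Sum.inl (Sum.inl j))) (Sum.inr ())
    (Sum.inl (Sum.inl (Sum.inr ())))))))

theorem oneAt (i j : α) : IsDef fun v : α → H κ => OneAt (v i) (v j) :=
  .ex (.ex (.and (.eq_pair (Sum.inl (Sum.inl i)) (Sum.inl (Sum.inr ())) (Sum.inr ()))
    (.isOne (Sum.inl (Sum.inr ())) (Sum.inl (Sum.inl j)))))

theorem compatIn (i j k : α) : IsDef fun v : α → H κ => CompatIn (v i) (v j) (v k) :=
  .ex (.and (.pair_mem (Sum.inr ()) (Sum.inl j) (Sum.inl i))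
    (.pair_mem (Sum.inr ()) (Sum.inl k) (Sum.inl i)))

theorem denseIn (i j k : α) : IsDef fun v : α → H κ => DenseIn (v i) (v j) (v k) :=
  .and (.all (.imp (.mem (Sum.inr ()) (Sum.inl k)) (.mem (Sum.inr ()) (Sum.inl i))))
    (.all (.imp (.mem (Sum.inr ()) (Sum.inl i)) (.ex (.and
      (.mem (Sum.inr ()) (Sum.inl (Sum.inl k)))
      (.pair_mem (Sum.inr ()) (Sum.inl (Sum.inr ())) (Sum.inl (Sum.inl j)))))))

end IsDef

/-- The witnesses lie in the transitive closure of the order, so restricting the quantifiers to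
`H(κ)` loses nothing. -/
theorem admitsIn_iff {m : ℕ} {r q : H κ} (hr : r.1 = (forcing T S).rel) {b : Fin m → H κ} :
    AdmitsIn r q b ↔ Admits T S q.1 (Set.range fun i => (b i).1) := by
  constructor
  · rintro ⟨s, G, Δ, hs, hsq, h⟩
    rw [hs, hr] at hsq
    refine ⟨G.1, Δ.1, hsq, ?_⟩
    rintro _ ⟨i, rfl⟩
    exact h i
  · rintro ⟨G, Δ, hle, h⟩
    have hle' : ZFSet.pair (ZFSet.pair G Δ) q.1 ∈ r.1 := hr ▸ hle
    have hH := H.left_mem_of_pair (H.mem_trans r.2 hle')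
    exact ⟨⟨_, hH⟩, ⟨G, H.left_mem_of_pair hH⟩, ⟨Δ, H.right_mem_of_pair hH⟩, rfl, hle',
      fun i => h _ ⟨i, rfl⟩⟩

theorem domAt_iff {q z : H κ} {F Γ : ZFSet.{u}} {β : Ordinal.{u}} (hq : q.1 = ZFSet.pair F Γ)
    (h : IsCond T S F Γ β) : DomAt q z ↔ z.1 ∈ T.upTo β := by
  constructor
  · rintro ⟨F', Γ', i, e, hz⟩
    obtain ⟨h1, -⟩ := ZFSet.pair_inj.1 (hq.symm.trans e)
    rw [← h1] at hz
    exact (ZFSet.pair_mem_prod.1 (h.isFunc.1 hz)).1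
  · intro hz
    obtain ⟨i, hi, -⟩ := h.isFunc.2 _ hz
    have hH := q.2
    rw [hq] at hH
    exact ⟨⟨F, H.left_mem_of_pair hH⟩, ⟨Γ, H.right_mem_of_pair hH⟩,
      ⟨i, H.right_mem_of_pair (H.mem_trans (H.left_mem_of_pair hH) hi)⟩, hq, hi⟩

theorem oneAt_iff {q z : H κ} {F Γ : ZFSet.{u}} (hq : q.1 = ZFSet.pair F Γ) :
    OneAt q z ↔ IsOne F z.1 := by
  constructor
  · rintro ⟨F', Γ', e, hz⟩
    obtain ⟨h1, -⟩ := ZFSet.pair_inj.1 (hq.symm.trans e)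
    rwa [← h1] at hz
  · intro hz
    have hH := q.2
    rw [hq] at hH
    exact ⟨⟨F, H.left_mem_of_pair hH⟩, ⟨Γ, H.right_mem_of_pair hH⟩, hq, hz⟩

theorem compatIn_iff {Q : ForcingPoset.{u}} {r p q : H κ} (hr : r.1 = Q.rel) :
    CompatIn r p q ↔ ∃ s, Q.Le s p.1 ∧ Q.Le s q.1 := by
  constructor
  · rintro ⟨s, h1, h2⟩
    rw [hr] at h1 h2
    exact ⟨s.1, h1, h2⟩
  · rintro ⟨s, h1, h2⟩
    have h1' : ZFSet.pair s p.1 ∈ r.1 := hr ▸ h1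
    have h2' : ZFSet.pair s q.1 ∈ r.1 := hr ▸ h2
    exact ⟨⟨s, H.left_mem_of_pair (H.mem_trans r.2 h1')⟩, h1', h2'⟩

theorem denseIn_iff {Q : ForcingPoset.{u}} {c r D : H κ} (hc : c.1 = Q.carrier)
    (hr : r.1 = Q.rel) : DenseIn c r D ↔ Q.IsDense D.1 := by
  rw [DenseIn, hc, hr]
  constructor
  · rintro ⟨h1, h2⟩
    refine ⟨fun x hx => h1 ⟨x, H.mem_trans D.2 hx⟩ hx, fun p hp => ?_⟩
    obtain ⟨d, hd, hdp⟩ := h2 ⟨p, H.mem_trans c.2 (hc ▸ hp)⟩ hp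
    exact ⟨d.1, hd, hdp⟩
  · rintro ⟨h1, h2⟩
    refine ⟨fun p hp => h1 hp, fun p hp => ?_⟩
    obtain ⟨d, hd, hdp⟩ := h2 p.1 hp
    exact ⟨⟨d, H.mem_trans D.2 hd⟩, hd, hdp⟩

theorem IsCond.countable_fun (hT : T.IsOmega1Tree) {F Γ : ZFSet.{u}} {β : Ordinal.{u}}
    (h : IsCond T S F Γ β) : (F : Set ZFSet.{u}).Countable := by
  refine (((hT.countable_upTo h.isSubtreeFun.top_lt).prod (Set.toFinite
    {(0 : Ordinal.{u}).toZFSet, (1 : Ordinal.{u}).toZFSet}).countable).image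
    fun a => ZFSet.pair a.1 a.2).mono fun w hw => ?_
  obtain ⟨x, hx, i, hi, rfl⟩ := ZFSet.mem_prod.1 (h.isFunc.1 hw)
  exact ⟨(x, i), ⟨hx, eq_zero_or_one_of_mem_two hi⟩, rfl⟩

/-- The function of a condition is determined by the set where it has the value `1`. -/
theorem IsCond.subset_of_isOne_imp {F Γ F' Γ' : ZFSet.{u}} {β : Ordinal.{u}}
    (h : IsCond T S F Γ β) (h' : IsCond T S F' Γ' β)
    (hone : ∀ x ∈ T.upTo β, IsOne F x ↔ IsOne F' x) : F ⊆ F' := by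
  intro w hw
  obtain ⟨x, hx, i, hi, rfl⟩ := ZFSet.mem_prod.1 (h.isFunc.1 hw)
  rcases eq_zero_or_one_of_mem_two hi with rfl | rfl
  · obtain ⟨j, hj, -⟩ := h'.isFunc.2 x hx
    rcases eq_zero_or_one_of_mem_two (ZFSet.pair_mem_prod.1 (h'.isFunc.1 hj)).2 with rfl | rfl
    · exact hj
    · exact absurd ((h.isFunc.2 x hx).unique hw ((hone x hx).2 hj)) zero_ne_one_toZFSet
  · exact (hone x hx).1 hw

theorem mem_H_of_admits {r p : H κ} (hr : r.1 = (forcing T S).rel) {b : Set ZFSet.{u}}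
    (h : Admits T S p.1 b) {z : ZFSet.{u}} (hz : z ∈ b) : z ∈ H κ := by
  obtain ⟨G, Δ, hle, hG⟩ := h
  have hle' : ZFSet.pair (ZFSet.pair G Δ) p.1 ∈ r.1 := hr ▸ hle
  exact H.left_mem_of_pair (H.mem_trans (H.left_mem_of_pair (H.left_mem_of_pair
    (H.mem_trans r.2 hle'))) (hG z hz))

namespace ElemSub

variable {N N' : ElemSub κ}

/-- A definable subset of `c` is in `H(κ)`, and its definition has parameters in `N`; so
elementarity puts it in `N`. -/
theorem exists_sep {α : Type} {P : (α → H κ) → H κ → Prop}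
    (hP : IsDef fun w : α ⊕ Unit → H κ => P (fun a => w (Sum.inl a)) (w (Sum.inr ())))
    (v : α → N) (c : N) :
    ∃ X : N, ∀ q : H κ, q.1 ∈ X.1.1 ↔ q.1 ∈ c.1.1 ∧ P (fun a => (v a).1) q := by
  let Y : ZFSet.{u} := c.1.1.sep fun q => ∃ hq : q ∈ H κ, P (fun a => (v a).1) ⟨q, hq⟩
  have hY : ∀ q : H κ, q.1 ∈ Y ↔ q.1 ∈ c.1.1 ∧ P (fun a => (v a).1) q := fun q =>
    ZFSet.mem_sep.trans (and_congr_right fun _ => ⟨fun h => h.2, fun h => ⟨q.2, h⟩⟩)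
  exact exists_of_isDef (P := fun (w : α ⊕ Unit → H κ) X => ∀ q : H κ,
    q.1 ∈ X.1 ↔ q.1 ∈ (w (Sum.inr ())).1 ∧ P (fun a => w (Sum.inl a)) q)
    (.all (.iff (.mem (Sum.inr ()) (Sum.inl (Sum.inr ())))
      (.and (.mem (Sum.inr ()) (Sum.inl (Sum.inl (Sum.inr ()))))
        (hP.comp (Sum.elim (fun a => Sum.inl (Sum.inl (Sum.inl a))) fun _ => Sum.inr ())))))
    (Sum.elim v fun _ => c) ⟨⟨Y, H.subset c.1.2 ZFSet.sep_subset⟩, hY⟩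

/-- The set `b` need not be in `N`, so elementarity is applied to a statement about all tuples of
length `m`, the size of `b`: some enumerated part of `D` below `p` serves every admitted `m`-tuple.
Such a part found in `N` has all its members in `N`, and it serves `b` too. -/
theorem exists_mem_of_admits (hTS : IsSuitable T S) (hκ : κ.IsRegular) (hκ' : ℵ₀ < κ)
    {r D p : N} (hr : r.1.1 = (forcing T S).rel) (hD : (forcing T S).IsDense D.1.1)
    (hp : p.1.1 ∈ conditions T S) {b : Set ZFSet.{u}} (hb : b.Finite)
    (h : Admits T S p.1.1 b) :
    ∃ q : N, q.1.1 ∈ D.1.1 ∧ (forcing T S).Le q.1.1 p.1.1 ∧ Admits T S q.1.1 b := by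
  have := hb.to_subtype
  obtain ⟨m, ⟨e⟩⟩ := Finite.exists_equiv_fin b
  let v : Fin m → H κ := fun i => ⟨(e.symm i).1, mem_H_of_admits hr h (e.symm i).2⟩
  have hv : (Set.range fun i => (v i).1) = b := by
    ext z
    constructor
    · rintro ⟨i, rfl⟩
      exact (e.symm i).2
    · intro hz
      exact ⟨e ⟨z, hz⟩, by simp [v]⟩
  obtain ⟨F, Γ, β, hpF, hF⟩ := mem_conditions_iff.1 hp
  obtain ⟨E, hE, hED, hEb⟩ := exists_countable_admits hTS hF hD
  rw [← hpF] at hED hEb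
  let E' : ZFSet.{u} := D.1.1.sep (· ∈ E)
  have hE' : ∀ {q}, q ∈ E' ↔ q ∈ E := fun {q} =>
    ZFSet.mem_sep.trans (and_iff_right_of_imp fun hq => (hED q hq).1)
  have hE'H : E' ∈ H κ := H.subset D.1.2 ZFSet.sep_subset
  have hE'c : (E' : Set ZFSet.{u}).Countable := hE.mono fun q hq => hE'.1 hq
  have hE'ne : E'.Nonempty := by
    obtain ⟨q, hq, -⟩ := hEb b hb h
    exact ⟨q, hE'.2 hq⟩
  have hE'D : ∀ q : H κ, q.1 ∈ E' → q.1 ∈ D.1.1 ∧ ZFSet.pair q.1 p.1.1 ∈ r.1.1 := by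
    intro q hq
    obtain ⟨h1, h2⟩ := hED q.1 (hE'.1 hq)
    exact ⟨h1, hr ▸ h2⟩
  have hE'b : ∀ b : Fin m → H κ, AdmitsIn r.1 p.1 b →
      ∃ q : H κ, q.1 ∈ E' ∧ AdmitsIn r.1 q b := by
    intro b' hb'
    obtain ⟨q, hq, hqb⟩ := hEb _ (Set.finite_range _) ((admitsIn_iff hr).1 hb')
    have hqE : q ∈ E' := hE'.2 hq
    exact ⟨⟨q, H.mem_trans hE'H hqE⟩, hqE, (admitsIn_iff hr).2 hqb⟩
  obtain ⟨X, ⟨f, e₀, hX⟩, hXD, hXb⟩ := exists_of_isDef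
    (P := fun (w : Fin 3 → H κ) X => (∃ f e, IsEnum f e X) ∧
      (∀ q : H κ, q.1 ∈ X.1 → q.1 ∈ (w 0).1 ∧ ZFSet.pair q.1 (w 1).1 ∈ (w 2).1) ∧
      ∀ b : Fin m → H κ, AdmitsIn (w 2) (w 1) b → ∃ q : H κ, q.1 ∈ X.1 ∧ AdmitsIn (w 2) q b)
    (.and (.ex (.ex (.isEnum (Sum.inl (Sum.inr ())) (Sum.inr ()) (Sum.inl (Sum.inl (Sum.inr ()))))))
      (.and (.all (.imp (.mem (Sum.inr ()) (Sum.inl (Sum.inr ())))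
        (.and (.mem (Sum.inr ()) (Sum.inl (Sum.inl 0)))
          (.pair_mem (Sum.inr ()) (Sum.inl (Sum.inl 1)) (Sum.inl (Sum.inl 2))))))
      (.all_tuple (.imp (.admitsIn (Sum.inl (Sum.inl 2)) (Sum.inl (Sum.inl 1)) Sum.inr)
        (.ex (.and (.mem (Sum.inr ()) (Sum.inl (Sum.inl (Sum.inr ()))))
          (.admitsIn (Sum.inl (Sum.inl (Sum.inl 2))) (Sum.inr ()) fun l =>
            Sum.inl (Sum.inr l))))))))
    ![D, p, r] ⟨⟨E', hE'H⟩, exists_isEnum hκ hκ' ⟨E', hE'H⟩ hE'c hE'ne, hE'D, hE'b⟩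
  obtain ⟨q, hq, hqv⟩ := hXb v ((admitsIn_iff hr).2 (by rwa [hv]))
  obtain ⟨q', hq'⟩ := mem_of_isEnum hX hq
  obtain ⟨h1, h2⟩ := hXD q hq
  have hqv' := (admitsIn_iff (T := T) (S := S) hr).1 hqv
  rw [hv] at hqv'
  refine ⟨q', ?_, ?_, ?_⟩
  · rw [hq']
    exact h1
  · rw [hq', ForcingPoset.Le, ← hr]
    exact h2
  · rwa [hq']

theorem mem_sets_of_mem_upTo (hTS : IsSuitable T S) (hκ : κ.IsRegular) (hκ' : ℵ₀ < κ)
    {p : N} {F Γ : ZFSet.{u}} {β : Ordinal.{u}} (hp : p.1.1 = ZFSet.pair F Γ)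
    (h : IsCond T S F Γ β) {x : ZFSet.{u}} (hx : x ∈ T.upTo β) : x ∈ N.sets := by
  obtain ⟨F', Γ', rfl, -⟩ := exists_pair p hp
  obtain ⟨i, hi, -⟩ := h.isFunc.2 x hx
  obtain ⟨w, hw⟩ := mem_of_countable hκ hκ' (h.countable_fun hTS.isOmega1Tree) hi
  obtain ⟨x', -, hx', -⟩ := exists_pair w hw
  exact ⟨x', hx'⟩

theorem mem_sets_of_mem_promises (hκ : κ.IsRegular) (hκ' : ℵ₀ < κ)
    {p : N} {F Γ : ZFSet.{u}} {β : Ordinal.{u}} (hp : p.1.1 = ZFSet.pair F Γ)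
    (h : IsCond T S F Γ β) {U : ZFSet.{u}} (hU : U ∈ Γ) : U ∈ N.sets := by
  obtain ⟨F', Γ', -, rfl⟩ := exists_pair p hp
  exact mem_of_countable hκ hκ' h.countable hU

/-- The dense set consists of the conditions whose function is defined at `z`. -/
theorem exists_isDense_level (hTS : IsSuitable T S) {c z : N} (hc : c.1.1 = conditions T S)
    {ξ : Ordinal.{u}} (hz : z.1.1 ∈ T.level ξ) :
    ∃ D : N, (forcing T S).IsDense D.1.1 ∧
      ∀ F Γ β, ZFSet.pair F Γ ∈ D.1.1 → IsCond T S F Γ β → ξ ≤ β := by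
  obtain ⟨D, hD⟩ := exists_sep (P := fun (w : Unit → H κ) q => DomAt q (w ()))
    (.domAt (Sum.inr ()) (Sum.inl ())) (fun _ => z) c
  have hDc : ∀ q ∈ D.1.1, q ∈ conditions T S := fun q hq =>
    hc ▸ ((hD ⟨q, H.mem_trans D.1.2 hq⟩).1 hq).1
  refine ⟨D, ⟨hDc, fun p hp => ?_⟩, fun F Γ β hF h => ?_⟩
  · obtain ⟨F, Γ, β, rfl, h⟩ := mem_conditions_iff.1 hp
    obtain ⟨G, hG, hFG⟩ := h.exists_extension_top hTS (le_max_left β ξ)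
      (max_lt h.isSubtreeFun.top_lt (hTS.isOmega1Tree.lt_omega_one hz))
    have hGc : ZFSet.pair G Γ ∈ c.1.1 := hc ▸ hG.mem
    exact ⟨_, (hD ⟨_, H.mem_trans c.1.2 hGc⟩).2 ⟨hGc, (domAt_iff rfl hG).2
      ((SetTree.mem_upTo hz).2 (le_max_right β ξ))⟩, hG.pair_le h hFG fun _ h => h⟩
  · exact (SetTree.mem_upTo hz).1 ((domAt_iff rfl h).1 ((hD ⟨_, H.mem_trans D.1.2 hF⟩).1 hF).2)

/-- Some condition is defined at an element outside the domain of `p`; by elementarity such an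
element exists in `N`. Hence the heights of the tree elements in `N` have no maximum. -/
theorem exists_level_gt (hTS : IsSuitable T S) {c p : N} (hc : c.1.1 = conditions T S)
    {F Γ : ZFSet.{u}} {β : Ordinal.{u}} (hp : p.1.1 = ZFSet.pair F Γ) (h : IsCond T S F Γ β) :
    ∃ z : N, ∃ ξ > β, z.1.1 ∈ T.level ξ := by
  have hβ := SetTree.add_one_lt_omega_one h.isSubtreeFun.top_lt
  have hβ' : β < β + 1 := Order.lt_add_one_iff.2 le_rfl
  obtain ⟨x, hx⟩ := (hTS.isOmega1Tree.level_nonempty_iff _).2 hβ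
  obtain ⟨G, hG, -⟩ := h.exists_extension_top hTS hβ'.le hβ
  have hGc : ZFSet.pair G Γ ∈ c.1.1 := hc ▸ hG.mem
  have hGH := H.mem_trans c.1.2 hGc
  have hxG := (SetTree.mem_upTo hx).2 le_rfl
  obtain ⟨i, hi, -⟩ := hG.isFunc.2 x hxG
  have hxH : x ∈ H κ := H.left_mem_of_pair (H.mem_trans (H.left_mem_of_pair hGH) hi)
  obtain ⟨z, ⟨q, hqc, hq⟩, hz⟩ := exists_of_isDef
    (P := fun (w : Fin 2 → H κ) z => (∃ q : H κ, q.1 ∈ (w 0).1 ∧ DomAt q z) ∧ ¬ DomAt (w 1) z)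
    (.and (.ex (.and (.mem (Sum.inr ()) (Sum.inl (Sum.inl 0)))
      (.domAt (Sum.inr ()) (Sum.inl (Sum.inr ()))))) (.not (.domAt (Sum.inl 1) (Sum.inr ()))))
    ![c, p] ⟨⟨x, hxH⟩, ⟨⟨_, hGH⟩, hGc, (domAt_iff rfl hG).2 hxG⟩, fun hx' =>
      absurd ((SetTree.mem_upTo hx).1 ((domAt_iff hp h).1 hx')) (not_le.2 hβ')⟩
  have hqc' : q.1 ∈ c.1.1 := hqc
  rw [hc] at hqc'
  obtain ⟨F', Γ', β', hqF, hF'⟩ := mem_conditions_iff.1 hqc'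
  obtain ⟨-, ξ, -, hzξ⟩ := ZFSet.mem_sep.1 ((domAt_iff hqF hF').1 hq)
  refine ⟨z, ξ, ?_, hzξ⟩
  by_contra! hξ
  exact hz ((domAt_iff hp h).2 ((SetTree.mem_upTo hzξ).2 hξ))

/-- The members of the tree in a countable elementary substructure form an initial segment. -/
theorem exists_height (hTS : IsSuitable T S) (hκ : κ.IsRegular) (hκ' : ℵ₀ < κ)
    (hN : N.sets.Countable) {c r p : N} (hc : c.1.1 = conditions T S)
    (hr : r.1.1 = (forcing T S).rel) (hp : p.1.1 ∈ conditions T S) :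
    ∃ δ < ω₁, (∀ ξ, ∀ x ∈ T.level ξ, x ∈ N.sets ↔ ξ < δ) ∧ ∀ ξ < δ, ξ + 1 < δ := by
  have hT := hTS.isTree
  have hT₁ := hTS.isOmega1Tree
  -- A tree element in `N` is in the domain of some condition in `N`. That domain is a full initial
  -- part of the tree, and it is included in `N` because the function is countable.
  have hcond : ∀ ξ, ∀ x ∈ T.level ξ, x ∈ N.sets →
      ∃ q : N, ∃ F Γ β, q.1.1 = ZFSet.pair F Γ ∧ IsCond T S F Γ β ∧ ξ ≤ β := by
    rintro ξ x hx ⟨z, rfl⟩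
    obtain ⟨D, hD, hD'⟩ := exists_isDense_level hTS hc hx
    obtain ⟨F₁, Γ₁, β₁, hpF, h₁⟩ := mem_conditions_iff.1 hp
    obtain ⟨q, hq, hqp, -⟩ := exists_mem_of_admits hTS hκ hκ' hr hD hp Set.finite_empty
      ⟨F₁, Γ₁, hpF ▸ h₁.pair_le h₁ (fun _ h => h) (fun _ h => h), by simp⟩
    obtain ⟨F, Γ, β, hqF, h⟩ := mem_conditions_iff.1 (forcing_le_iff.1 hqp).1
    exact ⟨q, F, Γ, β, hqF, h, hD' F Γ β (hqF ▸ hq) h⟩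
  have hdown : ∀ ξ, ∀ x ∈ T.level ξ, x ∈ N.sets → ∀ ζ ≤ ξ, ∀ y ∈ T.level ζ, y ∈ N.sets := by
    intro ξ x hx hxN ζ hζ y hy
    obtain ⟨q, F, Γ, β, hqF, h, hξ⟩ := hcond ξ x hx hxN
    exact mem_sets_of_mem_upTo hTS hκ hκ' hqF h ((SetTree.mem_upTo hy).2 (hζ.trans hξ))
  -- `L` is the set of levels missed by `N`; its least member is `δ`, which is countable because `N`
  -- is.
  let L : Set Ordinal.{u} := {ξ | ∀ x ∈ T.level ξ, x ∉ N.sets}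
  have hL : ∃ ξ ∈ L, ξ < ω₁ := by
    have := hN.to_subtype
    have hf : ∀ x : N.sets, ∃ θ < ω₁, ∀ ξ, x.1 ∈ T.level ξ → ξ ≤ θ := by
      intro x
      by_cases hx : ∃ ξ, x.1 ∈ T.level ξ
      · obtain ⟨ξ, hξ⟩ := hx
        exact ⟨ξ, hT₁.lt_omega_one hξ, fun ζ hζ => (SetTree.level_unique hζ hξ).le⟩
      · exact ⟨0, Ordinal.omega_pos 1, fun ξ hξ => absurd ⟨ξ, hξ⟩ hx⟩
    choose f hf hf' using hf
    obtain ⟨θ, hθ, hfθ⟩ := exists_bound_lt_omega_one f hf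
    refine ⟨θ + 1, fun x hx hxN => ?_, SetTree.add_one_lt_omega_one hθ⟩
    exact absurd ((hf' ⟨x, hxN⟩ _ hx).trans (hfθ ⟨x, hxN⟩))
      (not_le.2 (Order.lt_add_one_iff.2 le_rfl))
  obtain ⟨ξ₁, hξ₁, hξ₁'⟩ := hL
  have hmem : sInf L ∈ L := csInf_mem ⟨ξ₁, hξ₁⟩
  have hδ : sInf L < ω₁ := (csInf_le' hξ₁).trans_lt hξ₁'
  have hiff : ∀ ξ, ∀ x ∈ T.level ξ, x ∈ N.sets ↔ ξ < sInf L := by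
    intro ξ x hx
    constructor
    · intro hxN
      by_contra! hle
      obtain ⟨y, hy, -⟩ := hT.exists_level_le hx hle
      exact hmem y hy (hdown ξ x hx hxN _ hle y hy)
    · intro hξ
      have hξL : ξ ∉ L := notMem_of_lt_csInf' hξ
      simp only [L, Set.mem_ofPred_eq, not_forall, not_not] at hξL
      obtain ⟨y, hy, hyN⟩ := hξL
      exact hdown ξ y hy hyN ξ le_rfl x hx
  refine ⟨sInf L, hδ, hiff, fun ξ hξ => ?_⟩
  obtain ⟨x, hx⟩ := (hT₁.level_nonempty_iff ξ).2 (hξ.trans hδ)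
  obtain ⟨q, F, Γ, β, hqF, h, hξβ⟩ := hcond ξ x hx ((hiff ξ x hx).2 hξ)
  obtain ⟨z, ζ, hζ, hz⟩ := exists_level_gt hTS hc hqF h
  exact (Order.add_one_le_of_lt (hξβ.trans_lt hζ)).trans_lt ((hiff ζ _ hz).1 ⟨z, rfl⟩)

/-- An isomorphism which fixes the members of the tree does not change the function of a
condition. -/
theorem fst_iso_eq (hTS : IsSuitable T S) {δ : Ordinal.{u}}
    (hδ : ∀ ξ, ∀ x ∈ T.level ξ, x ∈ N.sets ↔ ξ < δ) (h : N ≃[setLanguage] N')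
    (hfix : ∀ ξ, ∀ x : N, x.1.1 ∈ T.level ξ → (h x).1.1 = x.1.1)
    {c p : N} (hc : c.1.1 = conditions T S) {F Γ F' Γ' : ZFSet.{u}} {β β' : Ordinal.{u}}
    (hp : p.1.1 = ZFSet.pair F Γ) (hF : IsCond T S F Γ β)
    (hp' : (h p).1.1 = ZFSet.pair F' Γ') (hF' : IsCond T S F' Γ' β') : F = F' := by
  have hT₁ := hTS.isOmega1Tree
  have hdom : ∀ ξ, ∀ x : N, x.1.1 ∈ T.level ξ → (ξ ≤ β ↔ ξ ≤ β') := by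
    intro ξ x hx
    have h1 : DomAt p.1 x.1 ↔ DomAt (h p).1 (h x).1 :=
      iso_iff (P := fun v : Fin 2 → H κ => DomAt (v 0) (v 1)) (.domAt 0 1) h ![p, x]
    rwa [domAt_iff hp hF, domAt_iff hp' hF', hfix ξ x hx, SetTree.mem_upTo hx,
      SetTree.mem_upTo hx] at h1
  have hone : ∀ ξ, ∀ x : N, x.1.1 ∈ T.level ξ → (IsOne F x.1.1 ↔ IsOne F' x.1.1) := by
    intro ξ x hx
    have h1 : OneAt p.1 x.1 ↔ OneAt (h p).1 (h x).1 :=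
      iso_iff (P := fun v : Fin 2 → H κ => OneAt (v 0) (v 1)) (.oneAt 0 1) h ![p, x]
    rwa [oneAt_iff hp, oneAt_iff hp', hfix ξ x hx] at h1
  -- The fixed element `z` is outside the domain of `p`, hence outside that of `h(p)`. So both top
  -- levels are below `ζ`, and both domains consist of elements of `N` fixed by `h`.
  obtain ⟨z, ζ, hζ, hz⟩ := exists_level_gt hTS hc hp hF
  have hζδ : ζ < δ := (hδ ζ _ hz).1 ⟨z, rfl⟩
  have hζ' : β' < ζ := by
    by_contra! hle
    exact absurd ((hdom ζ z hz).2 hle) (not_le.2 hζ)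
  have hN : ∀ ξ < ζ, ∀ x ∈ T.level ξ, ∃ y : N, y.1.1 = x := fun ξ hξ x hx =>
    (hδ ξ x hx).2 (hξ.trans hζδ)
  have hβ : β = β' := by
    obtain ⟨x, hx⟩ := (hT₁.level_nonempty_iff β).2 hF.isSubtreeFun.top_lt
    obtain ⟨y, hy⟩ := (hT₁.level_nonempty_iff β').2 hF'.isSubtreeFun.top_lt
    obtain ⟨x, rfl⟩ := hN β hζ x hx
    obtain ⟨y, rfl⟩ := hN β' hζ' y hy
    exact le_antisymm ((hdom β x hx).1 le_rfl) ((hdom β' y hy).2 le_rfl)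
  subst hβ
  have hone' : ∀ x ∈ T.upTo β, IsOne F x ↔ IsOne F' x := by
    intro x hx
    obtain ⟨-, ξ, hξ, hx⟩ := ZFSet.mem_sep.1 hx
    obtain ⟨y, rfl⟩ := hN ξ (hξ.trans_lt hζ) x hx
    exact hone ξ y hx
  exact subset_antisymm (hF.subset_of_isOne_imp hF' hone')
    (hF'.subset_of_isOne_imp hF fun x hx => (hone' x hx).symm)

end ElemSub

end SplitTree

/-! ### Verification of the properness isomorphism condition -/

namespace SplitTree

variable {T : SetTree.{u}} {S : Set ℕ}

theorem IsCond.top_unique (hT : T.IsOmega1Tree) {F Γ Γ' : ZFSet.{u}} {β β' : Ordinal.{u}}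
    (h : IsCond T S F Γ β) (h' : IsCond T S F Γ' β') : β = β' :=
  le_antisymm (top_le_of_subset hT h.isSubtreeFun h'.isSubtreeFun fun _ h => h)
    (top_le_of_subset hT h'.isSubtreeFun h.isSubtreeFun fun _ h => h)

theorem forcing_hasOmega2PIC (hTS : IsSuitable T S) : HasOmega2PIC (forcing T S) := by
  intro κ hκ hκ₂ hQ α β _ _ N N' hN hN' hQN hQN' _ _ _ _ h hfix _ p hp
  have hT₁ := hTS.isOmega1Tree
  have hκ' : ℵ₀ < κ := (Cardinal.aleph0_le_aleph 2).trans_lt hκ₂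
  obtain ⟨Q, hQ⟩ := hQN
  obtain ⟨Q', hQ'⟩ := hQN'
  obtain ⟨c, r, hc, hr⟩ := ElemSub.exists_pair Q hQ
  obtain ⟨c', r', hc', hr'⟩ := ElemSub.exists_pair Q' hQ'
  have hhc : (h c).1.1 = (forcing T S).carrier := by rw [hfix c c' (hc.trans hc'.symm), hc]
  have hhr : (h r).1.1 = (forcing T S).rel := by rw [hfix r r' (hr.trans hr'.symm), hr]
  have hcarrier : ∀ q : N, q.1.1 ∈ conditions T S ↔ (h q).1.1 ∈ conditions T S := by
    intro q
    have h1 : q.1.1 ∈ c.1.1 ↔ (h q).1.1 ∈ (h c).1.1 :=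
      ElemSub.iso_iff (P := fun v : Fin 2 → H κ => (v 0).1 ∈ (v 1).1) (.mem 0 1) h ![q, c]
    rwa [hc, hhc] at h1
  have hle : ∀ q s : N, (forcing T S).Le q.1.1 s.1.1 ↔ (forcing T S).Le (h q).1.1 (h s).1.1 := by
    intro q s
    have h1 : ZFSet.pair q.1.1 s.1.1 ∈ r.1.1 ↔ ZFSet.pair (h q).1.1 (h s).1.1 ∈ (h r).1.1 :=
      ElemSub.iso_iff (P := fun v : Fin 3 → H κ => ZFSet.pair (v 0).1 (v 1).1 ∈ (v 2).1)
        (.pair_mem 0 1 2) h ![q, s, r]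
    rwa [hr, hhr] at h1
  have hcompat : ∀ q s : N, (∃ w, (forcing T S).Le w q.1.1 ∧ (forcing T S).Le w s.1.1) ↔
      ∃ w, (forcing T S).Le w (h q).1.1 ∧ (forcing T S).Le w (h s).1.1 := by
    intro q s
    have h1 : CompatIn r.1 q.1 s.1 ↔ CompatIn (h r).1 (h q).1 (h s).1 :=
      ElemSub.iso_iff (P := fun v : Fin 3 → H κ => CompatIn (v 0) (v 1) (v 2))
        (.compatIn 0 1 2) h ![r, q, s]
    rwa [compatIn_iff hr, compatIn_iff hhr] at h1
  have hdense : ∀ D : N, (forcing T S).IsDense D.1.1 ↔ (forcing T S).IsDense (h D).1.1 := by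
    intro D
    have h1 : DenseIn c.1 r.1 D.1 ↔ DenseIn (h c).1 (h r).1 (h D).1 :=
      ElemSub.iso_iff (P := fun v : Fin 3 → H κ => DenseIn (v 0) (v 1) (v 2))
        (.denseIn 0 1 2) h ![c, r, D]
    rwa [denseIn_iff hc hr, denseIn_iff hhc hhr] at h1
  obtain ⟨δ, hδ, hδN, hδlim⟩ := ElemSub.exists_height hTS hκ hκ' hN hc hr hp
  obtain ⟨δ', -, hδN', -⟩ := ElemSub.exists_height hTS hκ hκ' hN' hhc hhr ((hcarrier p).1 hp)
  have hfst : ∀ (q : N) {F Γ F' Γ' : ZFSet.{u}} {η η' : Ordinal.{u}}, q.1.1 = ZFSet.pair F Γ →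
      IsCond T S F Γ η → (h q).1.1 = ZFSet.pair F' Γ' → IsCond T S F' Γ' η' → F = F' := by
    intro q F Γ F' Γ' η η' h1 h2 h3 h4
    -- The tree elements of the model with the smaller height belong to both models, so they are
    -- fixed by `h`; if that model is `N'`, the argument runs through `h.symm`.
    rcases le_total δ δ' with hle | hle
    · refine ElemSub.fst_iso_eq hTS hδN h (fun ξ x hx => ?_) hc h1 h2 h3 h4
      obtain ⟨y, hy⟩ := (hδN' ξ _ hx).2 (((hδN ξ _ hx).1 ⟨x, rfl⟩).trans_le hle)
      exact hfix x y hy.symm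
    · refine (ElemSub.fst_iso_eq hTS hδN' h.symm (fun ξ x hx => ?_) hhc h3 h4
        (by rw [h.symm_apply_apply]; exact h1) h2).symm
      obtain ⟨y, hy⟩ := (hδN ξ _ hx).2 (((hδN' ξ _ hx).1 ⟨x, rfl⟩).trans_le hle)
      have h5 : h y = x := Subtype.ext (Subtype.ext ((hfix y x hy).trans hy))
      rw [← h5, h.symm_apply_apply, h5, hy]
  -- `M F Γ Γ'` says that `(F, Γ)` is a condition in `N` with image `(F, Γ')`. The construction
  -- follows `N`, and the promises in `Γ'` are fulfilled alongside.
  let M : ZFSet.{u} → ZFSet.{u} → ZFSet.{u} → Prop := fun F Γ Γ' =>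
    ∃ q : N, q.1.1 ∈ conditions T S ∧ q.1.1 = ZFSet.pair F Γ ∧ (h q).1.1 = ZFSet.pair F Γ'
  have hM : ∀ q : N, q.1.1 ∈ conditions T S → ∃ F Γ Γ', q.1.1 = ZFSet.pair F Γ ∧
      (h q).1.1 = ZFSet.pair F Γ' ∧ M F Γ Γ' := by
    intro q hq
    obtain ⟨F, Γ, η, h1, h2⟩ := mem_conditions_iff.1 hq
    obtain ⟨F', Γ', η', h3, h4⟩ := mem_conditions_iff.1 ((hcarrier q).1 hq)
    obtain rfl := hfst q h1 h2 h3 h4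
    exact ⟨F, Γ, Γ', h1, h3, q, hq, h1, h3⟩
  have hMcond : ∀ F Γ Γ', M F Γ Γ' → ∃ η < δ, IsCond T S F Γ η ∧ IsCond T S F Γ' η := by
    rintro F Γ Γ' ⟨q, hq, h1, h3⟩
    obtain ⟨F₁, Γ₁, η, h1', h2⟩ := mem_conditions_iff.1 hq
    obtain ⟨F₂, Γ₂, η', h3', h4⟩ := mem_conditions_iff.1 ((hcarrier q).1 hq)
    obtain ⟨rfl, rfl⟩ := ZFSet.pair_inj.1 (h1.symm.trans h1')
    obtain ⟨rfl, rfl⟩ := ZFSet.pair_inj.1 (h3.symm.trans h3')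
    obtain rfl := h2.top_unique hT₁ h4
    obtain ⟨x, hx⟩ := (hT₁.level_nonempty_iff η).2 h2.isSubtreeFun.top_lt
    exact ⟨η, (hδN η x hx).1 (ElemSub.mem_sets_of_mem_upTo hTS hκ hκ' h1 h2
      ((SetTree.mem_upTo hx).2 le_rfl)), h2, h4⟩
  have hcount : {U | ∃ F Γ Γ', M F Γ Γ' ∧ (U ∈ Γ ∨ U ∈ Γ')}.Countable := by
    refine (hN.union hN').mono ?_
    rintro U ⟨F, Γ, Γ', hFM, hU⟩
    obtain ⟨η, -, h1, h2⟩ := hMcond F Γ Γ' hFM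
    obtain ⟨q, -, h3, h4⟩ := hFM
    rcases hU with hU | hU
    · exact Or.inl (ElemSub.mem_sets_of_mem_promises hκ hκ' h3 h1 hU)
    · exact Or.inr (ElemSub.mem_sets_of_mem_promises hκ hκ' h4 h2 hU)
  have hNc : Countable N := by
    have := hN.to_subtype
    exact Function.Injective.countable (f := fun x : N => (⟨x.1.1, x, rfl⟩ : N.sets))
      fun x y hxy => Subtype.ext (Subtype.ext (Subtype.mk.inj hxy))
  obtain ⟨F₁, Γ₁, Γ₁', hpF, hhpF, hpM⟩ := hM p hp
  obtain ⟨G, Ξ, hG, hF₁, hΓ₁, hΓ₁', hGD⟩ := exists_isCond_of_dense hTS hδ hδlim hMcond hcount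
    (fun D : {D : N // (forcing T S).IsDense D.1.1} => (D.1.1.1 : Set ZFSet.{u}))
    (fun ξ hξ => by
      obtain ⟨x, hx⟩ := (hT₁.level_nonempty_iff ξ).2 (hξ.trans hδ)
      obtain ⟨z, rfl⟩ := (hδN ξ x hx).2 hξ
      obtain ⟨D, hD, hD'⟩ := ElemSub.exists_isDense_level hTS hc hx
      exact ⟨⟨D, hD⟩, hD'⟩)
    (fun D F Γ Γ' b hFM hb hadm => by
      obtain ⟨q, hq, hqF, hhqF⟩ := hFM
      obtain ⟨s, hsD, hsq, hsb⟩ := ElemSub.exists_mem_of_admits hTS hκ hκ' hr D.2 hq hb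
        (hqF ▸ hadm)
      obtain ⟨G, Δ, Δ', hsG, hhsG, hsM⟩ := hM s (D.2.1 hsD)
      have h1 := (forcing_le_iff.1 hsq).2.2
      have h2 := (forcing_le_iff.1 ((hle s q).1 hsq)).2.2
      rw [hsG, hqF] at h1
      rw [hhsG, hhqF] at h2
      obtain ⟨h3, h4⟩ := extends_pair_iff.1 h1
      exact ⟨G, Δ, Δ', hsM, h3, h4, (extends_pair_iff.1 h2).2, hsG ▸ hsD, hsG ▸ hsb⟩)
    hpM
  have hbelow : ∀ F Γ Γ', M F Γ Γ' → F ⊆ G → Γ ⊆ Ξ → Γ' ⊆ Ξ →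
      (forcing T S).Le (ZFSet.pair G Ξ) (ZFSet.pair F Γ) ∧
        (forcing T S).Le (ZFSet.pair G Ξ) (ZFSet.pair F Γ') := by
    intro F Γ Γ' hFM h1 h2 h3
    obtain ⟨η, -, h4, h5⟩ := hMcond F Γ Γ' hFM
    exact ⟨hG.pair_le h4 h1 h2, hG.pair_le h5 h1 h3⟩
  have hmeet : ∀ D : N, (forcing T S).IsDense D.1.1 → ∃ q : N, q.1.1 ∈ D.1.1 ∧
      (forcing T S).Le (ZFSet.pair G Ξ) q.1.1 ∧ (forcing T S).Le (ZFSet.pair G Ξ) (h q).1.1 := by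
    intro D hD
    obtain ⟨F, Γ, Γ', hFM, hFD, h1, h2, h3⟩ := hGD ⟨D, hD⟩
    obtain ⟨h4, h5⟩ := hbelow F Γ Γ' hFM h1 h2 h3
    obtain ⟨q, -, hq, hhq⟩ := hFM
    exact ⟨q, hq ▸ hFD, hq ▸ h4, hhq ▸ h5⟩
  obtain ⟨h1, h2⟩ := hbelow _ _ _ hpM hF₁ hΓ₁ hΓ₁'
  refine ⟨ZFSet.pair G Ξ, hpF ▸ h1, hhpF ▸ h2, ?_, ?_, fun w hw s hs => ?_⟩
  · rintro _ ⟨D, rfl⟩ hD s hs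
    obtain ⟨q, hqD, hq, -⟩ := hmeet D hD
    exact ⟨q.1.1, hqD, ⟨q, rfl⟩, s, (forcing T S).refl s (forcing_le_iff.1 hs).1,
      (forcing T S).trans _ _ _ hs hq⟩
  · rintro _ ⟨D, rfl⟩ hD s hs
    -- Genericity over `N'` is transferred: entering the preimage of `D` at `q` means entering `D`
    -- at `h q`, and the limit is below `h q` as well.
    have hD' : (forcing T S).IsDense (h.symm D).1.1 := by
      rw [hdense, h.apply_symm_apply]
      exact hD
    obtain ⟨q, hqD, -, hq⟩ := hmeet _ hD'
    have hqD' : (h q).1.1 ∈ D.1.1 := by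
      have h3 : q.1.1 ∈ (h.symm D).1.1 ↔ (h q).1.1 ∈ (h (h.symm D)).1.1 :=
        ElemSub.iso_iff (P := fun v : Fin 2 → H κ => (v 0).1 ∈ (v 1).1) (.mem 0 1) h
          ![q, h.symm D]
      rw [h.apply_symm_apply] at h3
      exact h3.1 hqD
    exact ⟨_, hqD', ⟨h q, rfl⟩, s, (forcing T S).refl s (forcing_le_iff.1 hs).1,
      (forcing T S).trans _ _ _ hs hq⟩
  -- `D` is the dense set of conditions deciding `w`: below `w` or incompatible with it.
  · obtain ⟨D, hD⟩ := ElemSub.exists_sep (P := fun (v : Fin 2 → H κ) q =>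
        ZFSet.pair q.1 (v 0).1 ∈ (v 1).1 ∨ ¬ CompatIn (v 1) q (v 0))
      (.or (.pair_mem (Sum.inr ()) (Sum.inl 0) (Sum.inl 1))
        (.not (.compatIn (Sum.inl 1) (Sum.inr ()) (Sum.inl 0)))) ![w, r] c
    have hDw : ∀ q : H κ, q.1 ∈ D.1.1 ↔ q.1 ∈ conditions T S ∧
        ((forcing T S).Le q.1 w.1.1 ∨
          ¬ ∃ v, (forcing T S).Le v q.1 ∧ (forcing T S).Le v w.1.1) := by
      intro q
      have h3 : q.1 ∈ D.1.1 ↔ q.1 ∈ c.1.1 ∧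
        (ZFSet.pair q.1 w.1.1 ∈ r.1.1 ∨ ¬ CompatIn r.1 q w.1) := hD q
      rwa [compatIn_iff hr, hc, hr] at h3
    have hcH : ∀ q ∈ conditions T S, q ∈ H κ := fun q hq =>
      H.mem_trans c.1.2 (show q ∈ c.1.1 by rw [hc]; exact hq)
    have hDdense : (forcing T S).IsDense D.1.1 := by
      refine ⟨fun q hq => ((hDw ⟨q, H.mem_trans D.1.2 hq⟩).1 hq).1, fun q hq => ?_⟩
      by_cases hqw : ∃ v, (forcing T S).Le v q ∧ (forcing T S).Le v w.1.1
      · obtain ⟨v, hvq, hvw⟩ := hqw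
        have hv := (forcing_le_iff.1 hvq).1
        exact ⟨v, (hDw ⟨v, hcH v hv⟩).2 ⟨hv, Or.inl hvw⟩, hvq⟩
      · exact ⟨q, (hDw ⟨q, hcH q hq⟩).2 ⟨hq, Or.inr hqw⟩, (forcing T S).refl q hq⟩
    obtain ⟨q, hqD, hq, hhq⟩ := hmeet D hDdense
    -- The given condition itself serves. It is below both `q` and `h q`, and as `h` preserves order
    -- and compatibility, these decide `w` and `h w` in the same way.
    refine ⟨s, (forcing T S).refl s (forcing_le_iff.1 hs).1, ?_⟩
    have hsq := (forcing T S).trans _ _ _ hs hq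
    have hshq := (forcing T S).trans _ _ _ hs hhq
    rcases ((hDw q.1).1 hqD).2 with hqw | hqw
    · exact ⟨fun _ => (forcing T S).trans _ _ _ hshq ((hle q w).1 hqw),
        fun _ => (forcing T S).trans _ _ _ hsq hqw⟩
    · exact ⟨fun hsw => absurd ⟨s, hsq, hsw⟩ hqw,
        fun hsw => absurd ((hcompat q w).2 ⟨s, hshq, hsw⟩) hqw⟩

end SplitTree

theorem proposition10p4 (T : SplitTree.SetTree.{u}) (S : Set ℕ)
    (hT : T.IsAronszajn) (hnormal : T.IsNormal)
    (hS : S.Nonempty) (hS2 : ∀ n ∈ S, 2 ≤ n)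
    (hsplit : ∀ x ∈ T.carrier, (⨆ n ∈ S, (n : ℕ∞)) ≤ (T.imm x).encard) :
    SplitTree.HasOmega2PIC (SplitTree.forcing T S) :=
  SplitTree.forcing_hasOmega2PIC ⟨hT, hnormal, hS, hS2, fun x hx k hk =>
    (le_iSup₂ (f := fun (n : ℕ) (_ : n ∈ S) => (n : ℕ∞)) k hk).trans (hsplit x hx)⟩
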